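/- Let $p\ge 3$ and $n-1>p$, let $X$ be an $n\times p$ real matrix with linearly independent columns, each of which sums to $0$, and consider the model $y=\alpha 1_n+X\beta+\sigma\epsilon$ with unknown $\alpha\in\mathbb R$, $\beta\in\mathbb R^p$, $\sigma^2>0$. The error $\epsilon$ is a scale mixture of normals with identity covariance: it has density $f(\epsilon'\epsilon)$ on $\mathbb R^n$ with $f(t)=\int_{(0,\infty)}(2\pi v)^{-n/2}e^{-t/(2v)}\,dG(v)$, where $G$ (the law of $\tau^2$) is a probability measure on $(0,\infty)$ with $\int v\,dG(v)=1$. The loss for estimating $\sigma^2$ by $\delta$ is Stein's loss $L(\delta,\sigma^2)=\delta/\sigma^2-\log(\delta/\sigma^2)-1$. Let $\bar y$ be the mean of the entries of $y$, $P=X(X'X)^{-1}X'$, $\mathrm{RSS}=\|(I-P)(y-\bar y1_n)\|^2$, $R^2=\|P(y-\bar y1_n)\|^2/\|y-\bar y1_n\|^2$, $\delta_U=\mathrm{RSS}/(n-p-1)$, and $$\delta^H=\phi^H(R^2)\,\frac{\mathrm{RSS}}{n-p-1},\qquad \phi^H(r)=\frac{n-p-1}{n-3}\;\frac{\int_0^1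 t^{p/2-2}(1-rt)^{(n-p-3)/2}\,dt}{\int_0^1 t^{p/2-2}(1-rt)^{(n-p-1)/2}\,dt}.$$ Then for every such $G$: (i) $\delta^H$ is the generalized Bayes estimator with respect to the harmonic prior density $(\beta'X'X\beta)^{-(p-2)/2}(\sigma^2)^{-1}$ on $(\alpha,\beta,\sigma^2)$: for almost every $y$ the posterior is proper and $d=\delta^H(y)>0$ minimizes the posterior expected loss, uniquely in the sense that the posterior expectation of $L(d,\sigma^2)-L(\delta^H(y),\sigma^2)$ exists and is positive for every $d>0$, $d\ne\delta^H(y)$. (ii) $\delta^H$ is minimax: its supremum risk over all $(\alpha,\beta,\sigma^2)$ is at most that of any other measurable estimator (an estimate that is not positive having infinite loss). (iii) $\delta^H$ dominates $\delta_U$: its risk is at most that of $\delta_U$ at every $(\alpha,\beta,\sigma^2)$; the risk difference $E[L(\delta_U,\sigma^2)-L(\delta^H,\sigma^2)]$ exists and is nonnegative at every parameter and positive at some parameter. If moreover $\int|\log v|\,dG(v)<\infty$, then the risk of $\delta^H$ is strictly smaller than that of $\delta_U$ at some parameter. -/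

import Mathlib

open MeasureTheory
open scoped ENNReal Matrix

noncomputable section

namespace VarianceEstimation

/-- The squared Euclidean norm of a vector. -/
def sqNorm {m : ℕ} (v : Fin m → ℝ) : ℝ := v ⬝ᵥ v

/-! ### Statistics of the linear model -/

/-- The centred observation, with entries `y i` minus the mean of `y`. -/
def centred {n : ℕ} (y : Fin n → ℝ) : Fin n → ℝ := fun i => y i - (∑ j, y j) / (n : ℝ)

/-- The projection matrix `X (X' X)⁻¹ X'`. -/
def hatMatrix {n p : ℕ} (X : Matrix (Fin n) (Fin p) ℝ) : Matrix (Fin n) (Fin n) ℝ :=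
  X * (Xᵀ * X)⁻¹ * Xᵀ

/-- The residual sum of squares. -/
def RSS {n p : ℕ} (X : Matrix (Fin n) (Fin p) ℝ) (y : Fin n → ℝ) : ℝ :=
  sqNorm ((1 - hatMatrix X) *ᵥ centred y)

/-- The coefficient of determination. -/
def Rsq {n p : ℕ} (X : Matrix (Fin n) (Fin p) ℝ) (y : Fin n → ℝ) : ℝ :=
  sqNorm (hatMatrix X *ᵥ centred y) / sqNorm (centred y)

/-- The best unbiased estimator of the error variance. -/
def deltaU {n p : ℕ} (X : Matrix (Fin n) (Fin p) ℝ) (y : Fin n → ℝ) : ℝ :=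
  RSS X y / ((n : ℝ) - p - 1)

/-- The shrinkage factor of the estimator attached to the harmonic prior. -/
def phiH (n p : ℕ) (r : ℝ) : ℝ :=
  (((n : ℝ) - p - 1) / ((n : ℝ) - 3)) *
    ((∫ t in (0 : ℝ)..1, t ^ ((p : ℝ) / 2 - 2) * (1 - r * t) ^ (((n : ℝ) - p - 3) / 2)) /
      (∫ t in (0 : ℝ)..1, t ^ ((p : ℝ) / 2 - 2) * (1 - r * t) ^ (((n : ℝ) - p - 1) / 2)))

/-- The estimator attached to the harmonic prior. -/
def deltaH {n p : ℕ} (X : Matrix (Fin n) (Fin p) ℝ) (y : Fin n → ℝ) : ℝ :=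
  phiH n p (Rsq X y) * (RSS X y / ((n : ℝ) - p - 1))

/-! ### Scale mixtures of normals and the sampling model -/

/-- `G`, the law of `τ²`, is a probability measure on `(0, ∞)` with mean one. -/
structure IsMixingLaw (G : Measure ℝ) : Prop where
  prob : IsProbabilityMeasure G
  pos : ∀ᵐ v ∂G, 0 < v
  mean_one : ∫⁻ v, ENNReal.ofReal v ∂G = 1

/-- The function `f` such that the error vector has density `f (ε' ε)` on `ℝⁿ`:
the mixture over `v = τ²` of the densities of `N(0, v Iₙ)`. -/
def mixtureDensity (n : ℕ) (G : Measure ℝ) (t : ℝ) : ℝ≥0∞ :=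
  ∫⁻ v, ENNReal.ofReal ((2 * Real.pi * v) ^ (-(n : ℝ) / 2) * Real.exp (-t / (2 * v))) ∂G

/-- The density at `y` of the observation `α 1 + X β + σ ε`, with `s = σ²`. -/
def samplingDensity {n p : ℕ} (X : Matrix (Fin n) (Fin p) ℝ) (G : Measure ℝ)
    (α : ℝ) (β : Fin p → ℝ) (s : ℝ) (y : Fin n → ℝ) : ℝ≥0∞ :=
  ENNReal.ofReal (s ^ (-(n : ℝ) / 2)) *
    mixtureDensity n G (sqNorm (fun i => y i - α - (X *ᵥ β) i) / s)

/-- The law of the observation under the parameter `(α, β, s)`, with `s = σ²`. -/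
def samplingLaw {n p : ℕ} (X : Matrix (Fin n) (Fin p) ℝ) (G : Measure ℝ)
    (α : ℝ) (β : Fin p → ℝ) (s : ℝ) : Measure (Fin n → ℝ) :=
  volume.withDensity (samplingDensity X G α β s)

/-! ### Loss, risk, domination, minimaxity -/

/-- Stein's loss, for `d > 0` and `s > 0`. -/
def steinLoss (d s : ℝ) : ℝ := d / s - Real.log (d / s) - 1

/-- Stein's loss with values in `[0, ∞]`; an estimate that is not positive costs `∞`. -/
def steinLossE (d s : ℝ) : ℝ≥0∞ :=
  if 0 < d then ENNReal.ofReal (steinLoss d s) else ∞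

/-- The risk of the estimator `δ` at the parameter `(α, β, s)`, with `s = σ²`. -/
def risk {n p : ℕ} (X : Matrix (Fin n) (Fin p) ℝ) (G : Measure ℝ) (δ : (Fin n → ℝ) → ℝ)
    (α : ℝ) (β : Fin p → ℝ) (s : ℝ) : ℝ≥0∞ :=
  ∫⁻ y, steinLossE (δ y) s ∂(samplingLaw X G α β s)

/-- The supremum of the risk over all parameters `α ∈ ℝ`, `β ∈ ℝᵖ`, `s = σ² > 0`. -/
def supRisk {n p : ℕ} (X : Matrix (Fin n) (Fin p) ℝ) (G : Measure ℝ)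
    (δ : (Fin n → ℝ) → ℝ) : ℝ≥0∞ :=
  ⨆ (α : ℝ) (β : Fin p → ℝ) (s : ℝ) (_ : 0 < s), risk X G δ α β s

/-- `δ` minimizes the maximal risk among all (measurable) estimators. -/
def IsMinimax {n p : ℕ} (X : Matrix (Fin n) (Fin p) ℝ) (G : Measure ℝ)
    (δ : (Fin n → ℝ) → ℝ) : Prop :=
  Measurable δ ∧ ∀ δ' : (Fin n → ℝ) → ℝ, Measurable δ' → supRisk X G δ ≤ supRisk X G δ'

/-- The risk of `δ` is nowhere larger than that of `δ'`. -/
def RiskLE {n p : ℕ} (X : Matrix (Fin n) (Fin p) ℝ) (G : Measure ℝ)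
    (δ δ' : (Fin n → ℝ) → ℝ) : Prop :=
  ∀ (α : ℝ) (β : Fin p → ℝ) (s : ℝ), 0 < s → risk X G δ α β s ≤ risk X G δ' α β s

/-- `δ` dominates `δ'`: its risk is nowhere larger, and somewhere smaller. -/
def Dominates {n p : ℕ} (X : Matrix (Fin n) (Fin p) ℝ) (G : Measure ℝ)
    (δ δ' : (Fin n → ℝ) → ℝ) : Prop :=
  RiskLE X G δ δ' ∧
    ∃ (α : ℝ) (β : Fin p → ℝ) (s : ℝ), 0 < s ∧ risk X G δ α β s < risk X G δ' α β s

/-- Domination through the risk difference, written as the expectation of the difference of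
the losses. This is meaningful also where both risks are infinite. -/
def DominatesByDifference {n p : ℕ} (X : Matrix (Fin n) (Fin p) ℝ) (G : Measure ℝ)
    (δ δ' : (Fin n → ℝ) → ℝ) : Prop :=
  (∀ (α : ℝ) (β : Fin p → ℝ) (s : ℝ), 0 < s →
    Integrable (fun y => steinLoss (δ' y) s - steinLoss (δ y) s) (samplingLaw X G α β s) ∧
    0 ≤ ∫ y, (steinLoss (δ' y) s - steinLoss (δ y) s) ∂(samplingLaw X G α β s)) ∧
  ∃ (α : ℝ) (β : Fin p → ℝ) (s : ℝ), 0 < s ∧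
    0 < ∫ y, (steinLoss (δ' y) s - steinLoss (δ y) s) ∂(samplingLaw X G α β s)

/-! ### Generalized Bayes estimators -/

/-- The harmonic (improper) prior density `(β' X' X β)^{-(p-2)/2} (σ²)⁻¹`, with `s = σ²`. -/
def harmonicPrior {n p : ℕ} (X : Matrix (Fin n) (Fin p) ℝ)
    (_α : ℝ) (β : Fin p → ℝ) (s : ℝ) : ℝ :=
  (β ⬝ᵥ ((Xᵀ * X) *ᵥ β)) ^ (-((p : ℝ) - 2) / 2) * s⁻¹

/-- The measure with density (likelihood at `y`) times (prior density) with respect to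
`dα dβ dσ²` on `ℝ × ℝᵖ × (0, ∞)`. -/
def jointAt {n p : ℕ} (X : Matrix (Fin n) (Fin p) ℝ) (G : Measure ℝ)
    (prior : ℝ → (Fin p → ℝ) → ℝ → ℝ) (y : Fin n → ℝ) : Measure (ℝ × (Fin p → ℝ) × ℝ) :=
  (volume.restrict {θ : ℝ × (Fin p → ℝ) × ℝ | 0 < θ.2.2}).withDensity
    (fun θ => samplingDensity X G θ.1 θ.2.1 θ.2.2 y *
      ENNReal.ofReal (prior θ.1 θ.2.1 θ.2.2))

/-- The marginal density of the observation at `y`. -/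
def marginal {n p : ℕ} (X : Matrix (Fin n) (Fin p) ℝ) (G : Measure ℝ)
    (prior : ℝ → (Fin p → ℝ) → ℝ → ℝ) (y : Fin n → ℝ) : ℝ≥0∞ :=
  jointAt X G prior y Set.univ

/-- The posterior distribution of `(α, β, σ²)` given `y`. -/
def posterior {n p : ℕ} (X : Matrix (Fin n) (Fin p) ℝ) (G : Measure ℝ)
    (prior : ℝ → (Fin p → ℝ) → ℝ → ℝ) (y : Fin n → ℝ) : Measure (ℝ × (Fin p → ℝ) × ℝ) :=
  (marginal X G prior y)⁻¹ • jointAt X G prior y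

/-- `δ` is the generalized Bayes estimator under Stein's loss: for almost every `y` the posterior
is proper and `δ y` minimizes the posterior expected loss. The last clause says that it is the
unique minimizer, in terms of the posterior expectation of the loss difference, so that it has
content also when the posterior expected loss itself is infinite. -/
def IsGeneralizedBayes {n p : ℕ} (X : Matrix (Fin n) (Fin p) ℝ) (G : Measure ℝ)
    (prior : ℝ → (Fin p → ℝ) → ℝ → ℝ) (δ : (Fin n → ℝ) → ℝ) : Prop :=
  ∀ᵐ y : Fin n → ℝ,
    marginal X G prior y ≠ 0 ∧ marginal X G prior y ≠ ∞ ∧ 0 < δ y ∧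
    (∀ d : ℝ, ∫⁻ θ, steinLossE (δ y) θ.2.2 ∂(posterior X G prior y) ≤
      ∫⁻ θ, steinLossE d θ.2.2 ∂(posterior X G prior y)) ∧
    (∀ d : ℝ, 0 < d → d ≠ δ y →
      Integrable (fun θ => steinLoss d θ.2.2 - steinLoss (δ y) θ.2.2) (posterior X G prior y) ∧
      0 < ∫ θ, (steinLoss d θ.2.2 - steinLoss (δ y) θ.2.2) ∂(posterior X G prior y))

end VarianceEstimation

end

noncomputable section

namespace VarianceEstimation

/-! In orthonormal coordinates adapted to the constant vector and to the column space of `X`, the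
observation is `(√n α + √w ζ₀, A β + √w ζ₁, √w η)` with `w = σ² τ²` and independent standard normal
`ζ₀, ζ₁, η`. Let `U` and `S = RSS` be the squared norms of the last two components, and put `a = p/2
- 1`, `b = (n-p-1)/2`, `c = U/S`, `N(c) = eulerRatio a b c`. One integration by parts
(`eulerInt_succ`) turns the shrinkage factor into `φ = b / (b + 1/N(c))`, which increases strictly
to 1 as `c` grows (`phiH_eq_shrink`, `shrink_strictMonoOn`).

Bayes property. Under Stein's loss the Bayes estimate is the reciprocal of the posterior mean of
`1/σ²` (`bayes_of_integral_inv`). The harmonic prior is a gamma mixture of Gaussian kernels, so the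
posterior integrals are explicit. After the substitution `w = σ² v` the mixing variable survives
only as a factor `v^q`, with `q = 0` for the normalizer and `q = 1` for the moment. Both factors
average to 1 under `G`, so the posterior mean of `1/σ²` does not depend on `G`
(`CanonicalCoords.lintegral_jointAt`).

Domination. With `W = δ_U/σ²` the loss difference is `(1 - φ) W + log φ`. Writing `1 - φ` and `-log
φ` as integrals over `[φ, 1]` of `dx` and `dx/x` reduces the claim to `E[W; φ ≤ x] ≥ P(φ ≤ x)/x` for
each level `x` (`integral_shrink`). A level set has the form `U ≤ r S`. For `β = 0` the mean of
`‖η‖²` on it is explicit and exceeds the required value, because the law of `U` carries the exponent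
`p/2 = a + 1` where the estimator carries `a` (`lt_lintegral_mul_ballProb_zero`). A nonzero centre
only helps, since the ratio of noncentral to central ball probabilities increases with the radius
(`ballProb_mul_le`). Mixing over `v` only helps too, since the probability of the level set
increases with `v` and `v` has mean one (`lintegral_mul_mono_of_mean_one`).

Minimaxity. The risk of `δ_U` is constant, and `δ_U` is the best multiple of `RSS` because `E W =
1`. The model is invariant under translations and scalings, so the risk of an arbitrary estimator is
averaged over a large ball of centres and a long interval of `log σ²`. With the latent variables
truncated to compact sets, boundary effects vanish in the limit, and the average is at least the
truncated risk of the best multiple (`le_of_risk_le`). Removing the truncation gives the risk of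
`δ_U` as a lower bound for every maximal risk, even when it is infinite (`le_of_forall_truncation`);
`δ^H` never exceeds it. -/

/-! ### Euler-type integrals -/

/-- The integral `∫₀¹ t^(a-1) (1 + c t)^(-k) dt`. -/
def eulerInt (a k c : ℝ) : ℝ := ∫ t in (0 : ℝ)..1, t ^ (a - 1) * (1 + c * t) ^ (-k)

lemma one_add_mul_pos {c t : ℝ} (hc : 0 ≤ c) (ht : 0 ≤ t) : 0 < 1 + c * t := by positivity

lemma continuousOn_one_add_mul_rpow {c : ℝ} (hc : 0 ≤ c) (k : ℝ) :
    ContinuousOn (fun t : ℝ => (1 + c * t) ^ k) (Set.Icc 0 1) := by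
  intro t ht
  refine ContinuousAt.continuousWithinAt ?_
  exact ContinuousAt.rpow_const (by fun_prop) (Or.inl (one_add_mul_pos hc ht.1).ne')

lemma intervalIntegrable_euler {a c : ℝ} (ha : 0 < a) (hc : 0 ≤ c) (k : ℝ) :
    IntervalIntegrable (fun t : ℝ => t ^ (a - 1) * (1 + c * t) ^ k) volume 0 1 := by
  refine (intervalIntegral.intervalIntegrable_rpow' (by linarith)).mul_continuousOn ?_
  rw [Set.uIcc_of_le zero_le_one]
  exact continuousOn_one_add_mul_rpow hc k

lemma eulerInt_pos {a c : ℝ} (ha : 0 < a) (hc : 0 ≤ c) (k : ℝ) : 0 < eulerInt a k c := by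
  refine intervalIntegral.intervalIntegral_pos_of_pos_on (intervalIntegrable_euler ha hc _) ?_
    zero_lt_one
  intro t ht
  have := one_add_mul_pos hc ht.1.le
  have := ht.1
  positivity

/-- Integration by parts: integrate the derivative of `t^a (1 + c t)^(-(a+b))`, writing `c t` as `(1
+ c t) - 1`. The boundary term at 0 vanishes because `a > 0`. -/
lemma eulerInt_succ {a b c : ℝ} (ha : 0 < a) (hc : 0 ≤ c) :
    (a + b) * eulerInt a (a + b + 1) c
      = b * eulerInt a (a + b) c + (1 + c) ^ (-(a + b)) := by
  have key : ∫ t in (0 : ℝ)..1, ((a + b) * (t ^ (a - 1) * (1 + c * t) ^ (-(a + b + 1)))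
      - b * (t ^ (a - 1) * (1 + c * t) ^ (-(a + b))))
      = (1 : ℝ) ^ a * (1 + c * 1) ^ (-(a + b)) - (0 : ℝ) ^ a * (1 + c * 0) ^ (-(a + b)) := by
    refine intervalIntegral.integral_eq_sub_of_hasDerivAt_of_le
      (f := fun t : ℝ => t ^ a * (1 + c * t) ^ (-(a + b))) zero_le_one ?_ ?_ ?_
    · exact (Real.continuous_rpow_const ha.le).continuousOn.mul
        (continuousOn_one_add_mul_rpow hc _)
    · intro t ht
      have h1 := one_add_mul_pos hc ht.1.le
      have d1 : HasDerivAt (fun t : ℝ => t ^ a) (a * t ^ (a - 1)) t :=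
        Real.hasDerivAt_rpow_const (Or.inl ht.1.ne')
      have d2 : HasDerivAt (fun t : ℝ => 1 + c * t) c t := by
        simpa using ((hasDerivAt_id t).const_mul c).const_add 1
      have d3 := d2.rpow_const (p := -(a + b)) (Or.inl h1.ne')
      refine (d1.mul d3).congr_deriv ?_
      have e1 : t ^ a = t ^ (a - 1) * t := by
        rw [← Real.rpow_add_one ht.1.ne']; ring_nf
      have e2 : (1 + c * t) ^ (-(a + b)) = (1 + c * t) ^ (-(a + b) - 1) * (1 + c * t) := by
        rw [← Real.rpow_add_one h1.ne']; ring_nf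
      have e3 : -(a + b + 1) = -(a + b) - 1 := by ring
      rw [e3, e1, e2]; ring
    · exact ((intervalIntegrable_euler ha hc _).const_mul _).sub
        ((intervalIntegrable_euler ha hc _).const_mul _)
  rw [intervalIntegral.integral_sub ((intervalIntegrable_euler ha hc _).const_mul _)
    ((intervalIntegrable_euler ha hc _).const_mul _), intervalIntegral.integral_const_mul,
    intervalIntegral.integral_const_mul, Real.zero_rpow ha.ne'] at key
  simp only [eulerInt]
  simp only [Real.one_rpow, mul_one, one_mul, zero_mul, sub_zero] at key
  linarith

/-- The Möbius substitution `u = (1 + c) t / (1 + c t)` maps the unit interval onto itself and turns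
`1 - c/(1+c) u` into `1/(1 + c t)`. Since `R² = c/(1+c)`, it applies to both integrals in `phiH`. -/
lemma integral_one_sub_eq_eulerInt {a c : ℝ} (q : ℝ) (hc : 0 ≤ c) :
    ∫ t in (0 : ℝ)..1, t ^ (a - 1) * (1 - c / (1 + c) * t) ^ q
      = (1 + c) ^ a * eulerInt a (a + q + 1) c := by
  have h1c : 0 < 1 + c := by positivity
  have himg : (fun t : ℝ => (1 + c) * t / (1 + c * t)) '' Set.Ioo 0 1 = Set.Ioo 0 1 := by
    ext u
    constructor
    · rintro ⟨t, ht, rfl⟩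
      have h1 := one_add_mul_pos hc ht.1.le
      refine ⟨div_pos (mul_pos h1c ht.1) h1, ?_⟩
      rw [div_lt_one h1]; nlinarith [ht.2]
    · intro hu
      have h2 : 0 < 1 + c - c * u := by nlinarith [hu.2]
      refine ⟨u / (1 + c - c * u), ⟨div_pos hu.1 h2, ?_⟩, ?_⟩
      · rw [div_lt_one h2]; nlinarith [hu.2]
      · have h3 : 1 + c * (u / (1 + c - c * u)) = (1 + c) / (1 + c - c * u) := by
          field_simp; ring
        simp only [h3]
        field_simp
  have hder : ∀ t ∈ Set.Ioo (0 : ℝ) 1, HasDerivWithinAt (fun t : ℝ => (1 + c) * t / (1 + c * t))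
      ((1 + c) / (1 + c * t) ^ 2) (Set.Ioo 0 1) t := by
    intro t ht
    have h1 := one_add_mul_pos hc ht.1.le
    have d1 : HasDerivAt (fun t : ℝ => (1 + c) * t) (1 + c) t := by
      simpa using (hasDerivAt_id t).const_mul (1 + c)
    have d2 : HasDerivAt (fun t : ℝ => 1 + c * t) c t := by
      simpa using ((hasDerivAt_id t).const_mul c).const_add 1
    refine ((d1.div d2 h1.ne').congr_deriv ?_).hasDerivWithinAt
    congr 1; ring
  have hinj : Set.InjOn (fun t : ℝ => (1 + c) * t / (1 + c * t)) (Set.Ioo 0 1) := by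
    intro s hs t ht hst
    have h1 := one_add_mul_pos hc ht.1.le
    have h2 := one_add_mul_pos hc hs.1.le
    simp only [div_eq_div_iff h2.ne' h1.ne'] at hst
    have : (1 + c) * (s - t) = 0 := by linarith
    rcases mul_eq_zero.1 this with h | h <;> linarith
  have := integral_image_eq_integral_abs_deriv_smul measurableSet_Ioo hder hinj
    (fun u : ℝ => u ^ (a - 1) * (1 - c / (1 + c) * u) ^ q)
  rw [himg] at this
  rw [eulerInt, intervalIntegral.integral_of_le zero_le_one, integral_Ioc_eq_integral_Ioo, this,
    intervalIntegral.integral_of_le zero_le_one, integral_Ioc_eq_integral_Ioo,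
    ← integral_const_mul]
  refine setIntegral_congr_fun measurableSet_Ioo fun t ht => ?_
  have h1 := one_add_mul_pos hc ht.1.le
  have e1 : 1 - c / (1 + c) * ((1 + c) * t / (1 + c * t)) = (1 + c * t)⁻¹ := by
    field_simp; ring
  have e2 : |(1 + c) / (1 + c * t) ^ 2| = (1 + c) / (1 + c * t) ^ 2 := abs_of_pos (by positivity)
  simp only [e1, e2, smul_eq_mul]
  rw [Real.div_rpow (by have := ht.1; positivity) h1.le, Real.mul_rpow h1c.le ht.1.le,
    Real.inv_rpow h1.le, ← Real.rpow_neg h1.le]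
  have e3 : (1 + c) ^ a = (1 + c) ^ (a - 1) * (1 + c) := by
    rw [← Real.rpow_add_one h1c.ne']; ring_nf
  have e4 : (1 + c * t) ^ (-(a + q + 1)) =
      (1 + c * t) ^ (-q) / ((1 + c * t) ^ (a - 1) * (1 + c * t) ^ 2) := by
    rw [← Real.rpow_natCast, ← Real.rpow_add h1, ← Real.rpow_sub h1]
    congr 1; push_cast; ring
  rw [e3, e4]
  have := Real.rpow_pos_of_pos h1 (a - 1)
  field_simp

/-- The normalized integral `∫₀¹ t^(a-1) ((1 + c) / (1 + c t))^(a+b) dt`. -/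
def eulerRatio (a b c : ℝ) : ℝ := (1 + c) ^ (a + b) * eulerInt a (a + b) c

lemma eulerRatio_pos {a c : ℝ} (b : ℝ) (ha : 0 < a) (hc : 0 ≤ c) : 0 < eulerRatio a b c :=
  mul_pos (by positivity) (eulerInt_pos ha hc _)

lemma eulerRatio_eq (a b c : ℝ) : eulerRatio a b c
    = ∫ t in (0 : ℝ)..1, (1 + c) ^ (a + b) * (t ^ (a - 1) * (1 + c * t) ^ (-(a + b))) := by
  rw [intervalIntegral.integral_const_mul]; rfl

/-- For each `t` in the open unit interval `(1 + c)/(1 + c t)` is strictly increasing in `c`. -/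
lemma eulerRatio_strictMonoOn {a b : ℝ} (ha : 0 < a) (hb : 0 < b) :
    StrictMonoOn (eulerRatio a b) (Set.Ici 0) := by
  intro c hc d hd hcd
  simp only [Set.mem_Ici] at hc hd
  rw [← sub_pos, eulerRatio_eq _ _ _, eulerRatio_eq _ _ _, ← intervalIntegral.integral_sub
    ((intervalIntegrable_euler ha hd _).const_mul _)
    ((intervalIntegrable_euler ha hc _).const_mul _)]
  refine intervalIntegral.intervalIntegral_pos_of_pos_on
    (((intervalIntegrable_euler ha hd _).const_mul _).sub
    ((intervalIntegrable_euler ha hc _).const_mul _)) ?_ zero_lt_one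
  intro t ht
  have h1 := one_add_mul_pos hc ht.1.le
  have h2 := one_add_mul_pos hd ht.1.le
  have e : ∀ x : ℝ, 0 ≤ x → (1 + x) ^ (a + b) * (t ^ (a - 1) * (1 + x * t) ^ (-(a + b)))
      = t ^ (a - 1) * ((1 + x) / (1 + x * t)) ^ (a + b) := by
    intro x hx
    have h := one_add_mul_pos hx ht.1.le
    rw [Real.div_rpow (by positivity) h.le, Real.rpow_neg h.le]; ring
  rw [sub_pos, e c hc, e d hd]
  refine mul_lt_mul_of_pos_left ?_ (Real.rpow_pos_of_pos ht.1 _)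
  refine Real.rpow_lt_rpow (by positivity) ?_ (by positivity)
  rw [div_lt_div_iff₀ h1 h2]
  nlinarith [mul_pos (sub_pos.2 hcd) (sub_pos.2 ht.2)]

/-- Raising `a` by one multiplies the integrand by `t (1 + c)/(1 + c t) < 1`. This gap between the
exponents `p/2 - 1` of the estimator and `p/2` of the chi-square law is the source of strict
domination. -/
lemma eulerRatio_succ_lt {a b c : ℝ} (ha : 0 < a) (hc : 0 ≤ c) :
    eulerRatio (a + 1) b c < eulerRatio a b c := by
  rw [← sub_pos, eulerRatio_eq _ _ _, eulerRatio_eq _ _ _, ← intervalIntegral.integral_sub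
    ((intervalIntegrable_euler ha hc _).const_mul _)
    ((intervalIntegrable_euler (by linarith : 0 < a + 1) hc _).const_mul _)]
  refine intervalIntegral.intervalIntegral_pos_of_pos_on
    (((intervalIntegrable_euler ha hc _).const_mul _).sub
    ((intervalIntegrable_euler (by linarith : 0 < a + 1) hc _).const_mul _)) ?_ zero_lt_one
  intro t ht
  have h1 := one_add_mul_pos hc ht.1.le
  have h1c : 0 < 1 + c := by positivity
  have e1 : t ^ (a + 1 - 1) = t ^ (a - 1) * t := by
    rw [← Real.rpow_add_one ht.1.ne']; ring_nf
  have e2 : (1 + c * t) ^ (-(a + b)) = (1 + c * t) ^ (-(a + 1 + b)) * (1 + c * t) := by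
    rw [← Real.rpow_add_one h1.ne']; ring_nf
  have e3 : (1 + c) ^ (a + 1 + b) = (1 + c) ^ (a + b) * (1 + c) := by
    rw [← Real.rpow_add_one h1c.ne']; ring_nf
  rw [e1, e2, e3]
  have hp : 0 < (1 + c) ^ (a + b) * t ^ (a - 1) * (1 + c * t) ^ (-(a + 1 + b)) := by
    have := ht.1; positivity
  have := mul_pos hp (sub_pos.2 ht.2)
  nlinarith

lemma continuousOn_eulerInt {a k : ℝ} (ha : 0 < a) (hk : 0 ≤ k) :
    ContinuousOn (eulerInt a k) (Set.Ici 0) := by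
  intro c₀ hc₀
  refine intervalIntegral.continuousWithinAt_of_dominated_interval
    (bound := fun t => t ^ (a - 1)) ?_ ?_ ?_ ?_
  · filter_upwards [self_mem_nhdsWithin] with c hc
    exact (intervalIntegrable_euler ha hc _).def'.aestronglyMeasurable
  · filter_upwards [self_mem_nhdsWithin] with c hc
    refine ae_of_all _ fun t ht => ?_
    rw [Set.uIoc_of_le zero_le_one] at ht
    have h1 := one_add_mul_pos hc ht.1.le
    have := ht.1
    rw [Real.norm_of_nonneg (by positivity)]
    refine mul_le_of_le_one_right (by positivity) ?_
    refine Real.rpow_le_one_of_one_le_of_nonpos ?_ (by linarith)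
    simp only [Set.mem_Ici] at hc
    nlinarith
  · exact intervalIntegral.intervalIntegrable_rpow' (by linarith)
  · refine ae_of_all _ fun t ht => ?_
    rw [Set.uIoc_of_le zero_le_one] at ht
    refine continuousWithinAt_const.mul (ContinuousWithinAt.rpow_const (by fun_prop) ?_)
    exact Or.inl (one_add_mul_pos hc₀ ht.1.le).ne'

lemma continuousOn_eulerRatio {a b : ℝ} (ha : 0 < a) (hb : 0 < b) :
    ContinuousOn (eulerRatio a b) (Set.Ici 0) := by
  refine ContinuousOn.mul (ContinuousOn.rpow_const (by fun_prop) ?_)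
    (continuousOn_eulerInt ha (by positivity))
  intro c _
  exact Or.inr (by positivity)

/-- On `0 ≤ t ≤ 1/(1 + c)` the base `1 + c t` is at most 2, and this piece of the integral already
gives the bound. -/
lemma eulerRatio_lower {a b c : ℝ} (ha : 0 < a) (hb : 0 < b) (hc : 0 ≤ c) :
    2 ^ (-(a + b)) / a * (1 + c) ^ b ≤ eulerRatio a b c := by
  have h1c : 0 < 1 + c := by positivity
  have hle : (1 + c)⁻¹ ≤ 1 := inv_le_one_of_one_le₀ (by linarith)
  have hint := intervalIntegrable_euler ha hc (-(a + b))
  have hsub : Set.uIcc (0 : ℝ) (1 + c)⁻¹ ⊆ Set.uIcc 0 1 := by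
    rw [Set.uIcc_of_le (by positivity), Set.uIcc_of_le zero_le_one]
    exact Set.Icc_subset_Icc_right hle
  have h1 : ∫ t in (0 : ℝ)..(1 + c)⁻¹, t ^ (a - 1) * 2 ^ (-(a + b))
      ≤ ∫ t in (0 : ℝ)..(1 + c)⁻¹, t ^ (a - 1) * (1 + c * t) ^ (-(a + b)) := by
    refine intervalIntegral.integral_mono_on (by positivity)
      ((intervalIntegral.intervalIntegrable_rpow' (by linarith)).mul_const _)
      (hint.mono_set hsub) ?_
    intro t ht
    have h2 := one_add_mul_pos hc ht.1
    refine mul_le_mul_of_nonneg_left ?_ (Real.rpow_nonneg ht.1 _)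
    refine Real.rpow_le_rpow_of_nonpos h2 ?_ (by linarith)
    have : c * t ≤ c * (1 + c)⁻¹ := mul_le_mul_of_nonneg_left ht.2 hc
    have h3 : c * (1 + c)⁻¹ ≤ 1 := by
      rw [← div_eq_mul_inv, div_le_one h1c]; linarith
    linarith
  have h2 : ∫ t in (0 : ℝ)..(1 + c)⁻¹, t ^ (a - 1) * (1 + c * t) ^ (-(a + b))
      ≤ eulerInt a (a + b) c := by
    refine intervalIntegral.integral_mono_interval le_rfl (by positivity) hle ?_ hint
    filter_upwards [ae_restrict_mem measurableSet_Ioc] with t ht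
    have h2 := one_add_mul_pos hc ht.1.le
    have := ht.1
    simp only [Pi.zero_apply]
    positivity
  rw [intervalIntegral.integral_mul_const, integral_rpow (Or.inl (by linarith))] at h1
  have h3 := mul_le_mul_of_nonneg_left (h1.trans h2) (Real.rpow_nonneg h1c.le (a + b))
  refine le_trans (le_of_eq ?_) h3
  simp only [sub_add_cancel]
  rw [Real.zero_rpow ha.ne', Real.inv_rpow h1c.le, Real.rpow_add h1c]
  have := Real.rpow_pos_of_pos h1c a
  field_simp
  ring

lemma tendsto_eulerRatio {a b : ℝ} (ha : 0 < a) (hb : 0 < b) :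
    Filter.Tendsto (eulerRatio a b) Filter.atTop Filter.atTop := by
  have h1 : Filter.Tendsto (fun c : ℝ => 2 ^ (-(a + b)) / a * (1 + c) ^ b)
      Filter.atTop Filter.atTop := by
    refine Filter.Tendsto.const_mul_atTop (by positivity) ?_
    exact (tendsto_rpow_atTop hb).comp (Filter.tendsto_atTop_add_const_left _ _ Filter.tendsto_id)
  refine Filter.tendsto_atTop_mono' _ ?_ h1
  filter_upwards [Filter.eventually_ge_atTop 0] with c hc using eulerRatio_lower ha hb hc

/-- `eulerInt_succ` in quotient form. The same identity evaluates the shrinkage factor, the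
posterior mean of `1/σ²` and the mean of a chi-square variable on a level set. -/
lemma mul_eulerInt_div {a b c : ℝ} (ha : 0 < a) (hc : 0 ≤ c) :
    (a + b) * eulerInt a (a + b + 1) c
      = (b + (eulerRatio a b c)⁻¹) * eulerInt a (a + b) c := by
  have h1c : 0 < 1 + c := by positivity
  have := (eulerInt_pos ha hc (a + b)).ne'
  rw [eulerInt_succ ha hc, eulerRatio, Real.rpow_neg h1c.le]
  have := Real.rpow_pos_of_pos h1c (a + b)
  field_simp

/-! ### The shrinkage factor as a function of the ratio of the sums of squares -/

/-- The function `c ↦ b / (b + 1 / N(c))` through which the shrinkage factor is expressed. -/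
def shrink (a b c : ℝ) : ℝ := b / (b + (eulerRatio a b c)⁻¹)

/-- After the substitution the two integrals become Euler integrals with exponents `a + b` and `a +
b + 1` and a common factor `(1 + c)^a`, so `mul_eulerInt_div` gives their quotient. -/
lemma phiH_eq_shrink {n p : ℕ} (hp : 3 ≤ p) (hn : p + 1 < n) {c : ℝ} (hc : 0 ≤ c) :
    phiH n p (c / (1 + c)) = shrink ((p : ℝ) / 2 - 1) (((n : ℝ) - p - 1) / 2) c := by
  have hp' : (3 : ℝ) ≤ p := by exact_mod_cast hp
  have hn' : (p : ℝ) + 1 < n := by exact_mod_cast hn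
  have h1c : 0 < 1 + c := by positivity
  set a : ℝ := (p : ℝ) / 2 - 1 with ha_def
  set b : ℝ := ((n : ℝ) - p - 1) / 2 with hb_def
  have ha : 0 < a := by rw [ha_def]; linarith
  have hb : 0 < b := by rw [hb_def]; linarith
  have e1 : (p : ℝ) / 2 - 2 = a - 1 := by rw [ha_def]; ring
  have e2 : ((n : ℝ) - p - 3) / 2 = b - 1 := by rw [hb_def]; ring
  have e3 : ((n : ℝ) - p - 1) = 2 * b := by rw [hb_def]; ring
  have e4 : (n : ℝ) - 3 = 2 * (a + b) := by rw [ha_def, hb_def]; ring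
  rw [phiH, e1, e2, e3, e4, mul_div_cancel_left₀ b two_ne_zero,
    integral_one_sub_eq_eulerInt _ hc, integral_one_sub_eq_eulerInt _ hc]
  have e5 : a + (b - 1) + 1 = a + b := by ring
  rw [e5, shrink]
  have hr := eulerRatio_pos b ha hc
  have hk := mul_eulerInt_div (b := b) ha hc
  have h1 := eulerInt_pos ha hc (a + b)
  have h2 := eulerInt_pos ha hc (a + b + 1)
  have h3 := Real.rpow_pos_of_pos h1c a
  have h4 : 0 < a + b := by positivity
  have h5 : 0 < b + (eulerRatio a b c)⁻¹ := by positivity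
  rw [mul_div_mul_left _ _ h3.ne', mul_div_mul_left _ _ two_ne_zero, div_mul_div_comm,
    div_eq_div_iff (by positivity) (by positivity)]
  rw [hk]; ring

lemma shrink_pos {a b c : ℝ} (ha : 0 < a) (hb : 0 < b) (hc : 0 ≤ c) : 0 < shrink a b c := by
  have := eulerRatio_pos b ha hc
  rw [shrink]; positivity

lemma shrink_lt_one {a b c : ℝ} (ha : 0 < a) (hb : 0 < b) (hc : 0 ≤ c) : shrink a b c < 1 := by
  have := inv_pos.2 (eulerRatio_pos b ha hc)
  rw [shrink, div_lt_one (by positivity)]; linarith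

lemma shrink_strictMonoOn {a b : ℝ} (ha : 0 < a) (hb : 0 < b) :
    StrictMonoOn (shrink a b) (Set.Ici 0) := by
  intro c hc d hd hcd
  have h1 := eulerRatio_pos b ha hc
  have h2 := eulerRatio_pos b ha hd
  have h3 := eulerRatio_strictMonoOn ha hb hc hd hcd
  rw [shrink, shrink]
  have := inv_pos.2 h2
  refine div_lt_div_of_pos_left hb (by positivity) ?_
  gcongr

/-- Intermediate value theorem, with the limit 1 at infinity. It lets each level set `φ ≤ x` be
written as `U ≤ c S`. -/
lemma exists_shrink_eq {a b x : ℝ} (ha : 0 < a) (hb : 0 < b) (hx : shrink a b 0 < x)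
    (hx1 : x < 1) : ∃ c, 0 ≤ c ∧ shrink a b c = x := by
  have hcont : ContinuousOn (shrink a b) (Set.Ici 0) := by
    refine continuousOn_const.div (continuousOn_const.add
      ((continuousOn_eulerRatio ha hb).inv₀ fun c hc => (eulerRatio_pos b ha hc).ne')) ?_
    intro c hc
    have := eulerRatio_pos b ha hc
    positivity
  have hlim : Filter.Tendsto (shrink a b) Filter.atTop (nhds 1) := by
    have h1 : Filter.Tendsto (fun c => (eulerRatio a b c)⁻¹) Filter.atTop (nhds 0) :=
      (tendsto_eulerRatio ha hb).inv_tendsto_atTop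
    have h2 : Filter.Tendsto (fun c => b / (b + (eulerRatio a b c)⁻¹)) Filter.atTop
        (nhds (b / (b + 0))) := tendsto_const_nhds.div (h1.const_add b) (by simpa using hb.ne')
    rw [add_zero, div_self hb.ne'] at h2
    exact h2
  obtain ⟨d, hd0, hd⟩ := ((Filter.eventually_ge_atTop 0).and
    (hlim.eventually (lt_mem_nhds hx1))).exists
  obtain ⟨c, hc, hcx⟩ := intermediate_value_Icc hd0
    (hcont.mono Set.Icc_subset_Ici_self) ⟨hx.le, hd.le⟩
  exact ⟨c, hc.1, hcx⟩

/-! ### Canonical coordinates -/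

/-- Orthonormal coordinates of the sample space adapted to the linear model: one coordinate along
the constant vector, `p` along the column space of `X`, the others along the residual space. -/
structure CanonicalCoords {n p : ℕ} (X : Matrix (Fin n) (Fin p) ℝ) where
  e : (Fin n → ℝ) ≃ᵐ ℝ × EuclideanSpace ℝ (Fin p) × EuclideanSpace ℝ (Fin (n - p - 1))
  measurePreserving : MeasurePreserving e volume volume
  A : (Fin p → ℝ) ≃ₗ[ℝ] EuclideanSpace ℝ (Fin p)
  e_sub : ∀ (y : Fin n → ℝ) (α : ℝ) (β : Fin p → ℝ), e (fun i => y i - α - (X *ᵥ β) i)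
    = ((e y).1 - √n * α, (e y).2.1 - A β, (e y).2.2)
  dot : ∀ y z : Fin n → ℝ, y ⬝ᵥ z
    = (e y).1 * (e z).1 + inner ℝ (e y).2.1 (e z).2.1 + inner ℝ (e y).2.2 (e z).2.2
  fst_eq : ∀ y : Fin n → ℝ, (e y).1 = (√n)⁻¹ * ∑ i, y i

namespace CanonicalCoords

variable {n p : ℕ} {X : Matrix (Fin n) (Fin p) ℝ}

/-- Linearity of `e` is not part of the structure, but `dot` at the zero vector forces the three
squared norms to sum to zero. -/
lemma e_zero (c : CanonicalCoords X) : c.e 0 = 0 := by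
  have h := c.dot 0 0
  simp only [dotProduct_zero, real_inner_self_eq_norm_sq] at h
  have h1 : (c.e 0).1 = 0 := by
    have : (c.e 0).1 ^ 2 = 0 := by
      nlinarith [sq_nonneg (c.e 0).1, sq_nonneg ‖(c.e 0).2.1‖, sq_nonneg ‖(c.e 0).2.2‖]
    exact pow_eq_zero_iff two_ne_zero |>.1 this
  have h2 : (c.e 0).2.1 = 0 := by
    have : ‖(c.e 0).2.1‖ ^ 2 = 0 := by
      nlinarith [sq_nonneg (c.e 0).1, sq_nonneg ‖(c.e 0).2.1‖, sq_nonneg ‖(c.e 0).2.2‖]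
    exact norm_eq_zero.1 (pow_eq_zero_iff two_ne_zero |>.1 this)
  have h3 : (c.e 0).2.2 = 0 := by
    have : ‖(c.e 0).2.2‖ ^ 2 = 0 := by
      nlinarith [sq_nonneg (c.e 0).1, sq_nonneg ‖(c.e 0).2.1‖, sq_nonneg ‖(c.e 0).2.2‖]
    exact norm_eq_zero.1 (pow_eq_zero_iff two_ne_zero |>.1 this)
  exact Prod.ext h1 (Prod.ext h2 h3)

lemma sqNorm_eq (c : CanonicalCoords X) (y : Fin n → ℝ) :
    sqNorm y = (c.e y).1 ^ 2 + ‖(c.e y).2.1‖ ^ 2 + ‖(c.e y).2.2‖ ^ 2 := by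
  rw [sqNorm, c.dot, real_inner_self_eq_norm_sq, real_inner_self_eq_norm_sq, ← sq (c.e y).1]

lemma e_mulVec (c : CanonicalCoords X) (β : Fin p → ℝ) : c.e (X *ᵥ β) = (0, c.A β, 0) := by
  have h := c.e_sub 0 0 (-β)
  simpa [c.e_zero, Matrix.mulVec_neg] using h

/-- In these coordinates the prior depends on `β` only through `‖A β‖`, hence is a Euclidean
harmonic function of `A β`. -/
lemma quadratic_form (c : CanonicalCoords X) (β : Fin p → ℝ) :
    β ⬝ᵥ ((Xᵀ * X) *ᵥ β) = ‖c.A β‖ ^ 2 := by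
  have h := c.sqNorm_eq (X *ᵥ β)
  rw [c.e_mulVec] at h
  simp only [ne_eq, OfNat.ofNat_ne_zero, not_false_eq_true, zero_pow, zero_add, norm_zero,
    add_zero] at h
  rw [← h, sqNorm, ← Matrix.mulVec_mulVec, Matrix.dotProduct_mulVec, Matrix.vecMul_transpose]

lemma sqNorm_residual (c : CanonicalCoords X) (y : Fin n → ℝ) (α : ℝ) (β : Fin p → ℝ) :
    sqNorm (fun i => y i - α - (X *ᵥ β) i)
      = ((c.e y).1 - √n * α) ^ 2 + ‖(c.e y).2.1 - c.A β‖ ^ 2 + ‖(c.e y).2.2‖ ^ 2 := by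
  rw [c.sqNorm_eq, c.e_sub]

lemma e_centred (c : CanonicalCoords X) (hn : n ≠ 0) (y : Fin n → ℝ) :
    c.e (centred y) = (0, (c.e y).2.1, (c.e y).2.2) := by
  have h := c.e_sub y ((∑ j, y j) / n) 0
  have hn' : (0 : ℝ) < n := by exact_mod_cast Nat.pos_of_ne_zero hn
  have h1 : (c.e y).1 - √n * ((∑ j, y j) / n) = 0 := by
    rw [c.fst_eq]
    rw [← Real.sqrt_div_self]
    ring
  rw [h1] at h
  have h2 : centred y = fun i => y i - (∑ j, y j) / n - (X *ᵥ 0) i := by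
    ext i; simp [centred]
  rw [h2, h]
  simp

lemma isUnit_gram (c : CanonicalCoords X) : IsUnit (Xᵀ * X).det := by
  rw [← Matrix.isUnit_iff_isUnit_det, ← Matrix.mulVec_injective_iff_isUnit]
  intro β γ h
  have h1 : (Xᵀ * X) *ᵥ (β - γ) = 0 := by
    rw [Matrix.mulVec_sub, sub_eq_zero]; exact h
  have h2 := c.quadratic_form (β - γ)
  rw [h1, dotProduct_zero] at h2
  have h3 : c.A (β - γ) = 0 := norm_eq_zero.1 (pow_eq_zero_iff two_ne_zero |>.1 h2.symm)
  exact sub_eq_zero.1 ((LinearEquiv.map_eq_zero_iff c.A).1 h3)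

/-- Removing the column-space component from the centred observation leaves a vector orthogonal to
all columns of `X`. The hat matrix kills it and fixes the component removed. -/
lemma hatMatrix_mulVec_centred (c : CanonicalCoords X) (hn : n ≠ 0) (y : Fin n → ℝ) :
    hatMatrix X *ᵥ centred y = X *ᵥ (c.A.symm (c.e y).2.1) := by
  set β := c.A.symm (c.e y).2.1 with hβ
  -- The zero intercept gives `z` the shape required by `e_sub`.
  set z : Fin n → ℝ := fun i => centred y i - 0 - (X *ᵥ β) i with hz
  have hez : c.e z = (0, 0, (c.e y).2.2) := by
    rw [hz, c.e_sub, c.e_centred hn, hβ]; simp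
  have hXz : Xᵀ *ᵥ z = 0 := by
    ext j
    have h1 : (Xᵀ *ᵥ z) j = (X *ᵥ Pi.single j 1) ⬝ᵥ z := by
      rw [Matrix.mulVec_single_one]; rfl
    rw [h1, c.dot, c.e_mulVec, hez]; simp
  have hdec : centred y = X *ᵥ β + z := by ext i; simp [hz]
  have hu := c.isUnit_gram
  rw [hdec, hatMatrix, Matrix.mulVec_add]
  have h2 : (X * (Xᵀ * X)⁻¹ * Xᵀ) *ᵥ z = 0 := by
    rw [← Matrix.mulVec_mulVec, hXz, Matrix.mulVec_zero]
  have h3 : (X * (Xᵀ * X)⁻¹ * Xᵀ) *ᵥ (X *ᵥ β) = X *ᵥ β := by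
    rw [Matrix.mulVec_mulVec, Matrix.mul_assoc, Matrix.mul_assoc, Matrix.nonsing_inv_mul _ hu,
      Matrix.mul_one]
  rw [h2, h3, add_zero]

lemma RSS_eq (c : CanonicalCoords X) (hn : n ≠ 0) (y : Fin n → ℝ) :
    RSS X y = ‖(c.e y).2.2‖ ^ 2 := by
  rw [RSS, Matrix.sub_mulVec, Matrix.one_mulVec, c.hatMatrix_mulVec_centred hn]
  have h := c.sqNorm_residual (centred y) 0 (c.A.symm (c.e y).2.1)
  rw [c.e_centred hn] at h
  simp only [sub_zero, mul_zero, LinearEquiv.apply_symm_apply, sub_self, norm_zero, ne_eq,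
    OfNat.ofNat_ne_zero, not_false_eq_true, zero_pow, zero_add] at h
  exact h

lemma Rsq_eq (c : CanonicalCoords X) (hn : n ≠ 0) (y : Fin n → ℝ) :
    Rsq X y = ‖(c.e y).2.1‖ ^ 2 / (‖(c.e y).2.1‖ ^ 2 + ‖(c.e y).2.2‖ ^ 2) := by
  rw [Rsq, c.hatMatrix_mulVec_centred hn, c.sqNorm_eq, c.e_mulVec, c.sqNorm_eq, c.e_centred hn]
  simp

end CanonicalCoords

/-- Because the columns sum to zero, the normalized constant vector is orthogonal to the column
space. Together with an orthonormal basis of that space it extends to a basis of the whole space;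
`A` reads off the coordinates of `X β`. -/
lemma exists_adapted_orthonormalBasis {n p : ℕ} (hn : p + 1 < n)
    (X : Matrix (Fin n) (Fin p) ℝ) (hXcentred : ∀ j, ∑ i, X i j = 0)
    (hXindep : LinearIndependent ℝ X.col) :
    ∃ (b : OrthonormalBasis (Fin 1 ⊕ Fin p ⊕ Fin (n - p - 1)) ℝ (EuclideanSpace ℝ (Fin n)))
      (A : (Fin p → ℝ) ≃ₗ[ℝ] EuclideanSpace ℝ (Fin p)),
      b (Sum.inl 0) = (√n)⁻¹ • WithLp.toLp 2 (fun _ => (1 : ℝ)) ∧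
      ∀ β, WithLp.toLp 2 (X *ᵥ β) = ∑ i, A β i • b (Sum.inr (Sum.inl i)) := by
  have hn0 : (0 : ℝ) < n := by exact_mod_cast (by omega : 0 < n)
  let L : (Fin p → ℝ) →ₗ[ℝ] EuclideanSpace ℝ (Fin n) :=
    (WithLp.linearEquiv 2 ℝ (Fin n → ℝ)).symm.toLinearMap ∘ₗ X.mulVecLin
  have hL : Function.Injective L :=
    (WithLp.linearEquiv 2 ℝ (Fin n → ℝ)).symm.injective.comp
      (Matrix.mulVec_injective_iff.2 hXindep)
  have hLapp : ∀ β, L β = WithLp.toLp 2 (X *ᵥ β) := fun β => rfl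
  have hfr : Module.finrank ℝ (LinearMap.range L) = p := by
    rw [LinearMap.finrank_range_of_inj hL]; simp
  let b₀ : OrthonormalBasis (Fin p) ℝ (LinearMap.range L) :=
    (stdOrthonormalBasis ℝ (LinearMap.range L)).reindex (finCongr hfr)
  let u : EuclideanSpace ℝ (Fin n) := (√n)⁻¹ • WithLp.toLp 2 (fun _ => (1 : ℝ))
  have hu1 : inner ℝ u u = (1 : ℝ) := by
    have : inner ℝ (WithLp.toLp 2 (fun _ : Fin n => (1 : ℝ)))
        (WithLp.toLp 2 (fun _ : Fin n => (1 : ℝ))) = (n : ℝ) := by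
      simp [EuclideanSpace.norm_sq_eq]
    simp only [u, real_inner_smul_left, real_inner_smul_right, this]
    have h2 : √(n : ℝ) ≠ 0 := (Real.sqrt_pos.2 hn0).ne'
    field_simp
    rw [Real.sq_sqrt hn0.le]
  have huL : ∀ w ∈ LinearMap.range L, inner ℝ u w = (0 : ℝ) := by
    rintro _ ⟨β, rfl⟩
    rw [hLapp]
    simp only [u, real_inner_smul_left, EuclideanSpace.inner_toLp_toLp]
    have : (X *ᵥ β) ⬝ᵥ (fun _ : Fin n => (1 : ℝ)) = 0 := by
      simp only [dotProduct, Matrix.mulVec, mul_one]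
      rw [Finset.sum_comm]
      simp [← Finset.sum_mul, hXcentred]
    simpa using Or.inr this
  let v : Fin 1 ⊕ Fin p ⊕ Fin (n - p - 1) → EuclideanSpace ℝ (Fin n) :=
    Sum.elim (fun _ => u) (Sum.elim (fun i => (b₀ i : EuclideanSpace ℝ (Fin n))) (fun _ => 0))
  let s : Set (Fin 1 ⊕ Fin p ⊕ Fin (n - p - 1)) := {i | ∀ k, i ≠ Sum.inr (Sum.inr k)}
  have hv : Orthonormal ℝ (s.domRestrict v) := by
    classical
    rw [orthonormal_iff_ite]
    have hb := orthonormal_iff_ite.1 b₀.orthonormal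
    rintro ⟨i, hi⟩ ⟨j, hj⟩
    rcases i with i | i | i
    · rcases j with j | j | j
      · rw [if_pos (by obtain rfl := Subsingleton.elim i j; rfl)]; exact hu1
      · simp [Set.domRestrict, v, huL _ (b₀ j).2]
      · exact absurd rfl (hj j)
    · rcases j with j | j | j
      · simp [Set.domRestrict, v, real_inner_comm, huL _ (b₀ i).2]
      · have := hb i j
        simpa [Set.domRestrict, v] using this
      · exact absurd rfl (hj j)
    · exact absurd rfl (hi i)
  obtain ⟨b, hb⟩ := hv.exists_orthonormalBasis_extension_of_card_eq (by
    simp only [finrank_euclideanSpace, Fintype.card_fin, Fintype.card_sum]; omega)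
  refine ⟨b, (LinearEquiv.ofInjective L hL).trans b₀.repr.toLinearEquiv, ?_, ?_⟩
  · rw [hb _ (by intro k; simp)]; rfl
  · intro β
    have h1 := b₀.sum_repr (LinearEquiv.ofInjective L hL β)
    have h2 := congrArg (Subtype.val) h1
    rw [LinearEquiv.ofInjective_apply, hLapp] at h2
    rw [← h2, Submodule.coe_sum]
    refine Finset.sum_congr rfl fun i _ => ?_
    rw [hb (Sum.inr (Sum.inl i)) (by intro k; simp)]
    rfl

/-- The coordinates in the adapted basis form an isometry, hence preserve volume. The isometry is
built into an `L²` product first, since the plain product carries the sup norm. -/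
lemma nonempty_canonicalCoords {n p : ℕ} (hn : p + 1 < n)
    (X : Matrix (Fin n) (Fin p) ℝ) (hXcentred : ∀ j, ∑ i, X i j = 0)
    (hXindep : LinearIndependent ℝ X.col) : Nonempty (CanonicalCoords X) := by
  classical
  obtain ⟨b, A, hb, hA⟩ := exists_adapted_orthonormalBasis hn X hXcentred hXindep
  have hn0 : (0 : ℝ) < n := by exact_mod_cast (by omega : 0 < n)
  have hsq : √(n : ℝ) ≠ 0 := (Real.sqrt_pos.2 hn0).ne'
  let V := EuclideanSpace ℝ (Fin n)
  let W := WithLp 2 (ℝ × WithLp 2 (EuclideanSpace ℝ (Fin p) × EuclideanSpace ℝ (Fin (n - p - 1))))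
  let T₀ : V →ₗ[ℝ] W :=
    { toFun := fun y => WithLp.toLp 2 (inner ℝ (b (Sum.inl 0)) y,
        WithLp.toLp 2 (WithLp.toLp 2 (fun i => inner ℝ (b (Sum.inr (Sum.inl i))) y),
          WithLp.toLp 2 (fun i => inner ℝ (b (Sum.inr (Sum.inr i))) y)))
      map_add' := by
        intro x y
        simp only [inner_add_right]; rfl
      map_smul' := by
        intro r y
        simp only [real_inner_smul_right]; rfl }
  let T₁ : V →ₗᵢ[ℝ] W :=
    { toLinearMap := T₀
      norm_map' := by
        intro y
        have h1 : ‖T₀ y‖ ^ 2 = ‖y‖ ^ 2 := by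
          rw [← b.sum_sq_norm_inner_right y]
          simp only [Fintype.sum_sum_type, Fin.sum_univ_one]
          refine (WithLp.prod_norm_sq_eq_of_L2 (T₀ y)).trans (congrArg₂ _ rfl ?_)
          refine (WithLp.prod_norm_sq_eq_of_L2 (T₀ y).snd).trans ?_
          exact congrArg₂ _ (EuclideanSpace.norm_sq_eq _) (EuclideanSpace.norm_sq_eq _)
        exact (sq_eq_sq₀ (norm_nonneg _) (norm_nonneg _)).1 h1 }
  let T : V ≃ₗᵢ[ℝ] W := T₁.toLinearIsometryEquiv (by
    have h1 : Module.finrank ℝ W = Module.finrank ℝ (ℝ × (EuclideanSpace ℝ (Fin p) ×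
        EuclideanSpace ℝ (Fin (n - p - 1)))) := by
      refine LinearEquiv.finrank_eq ?_
      exact (WithLp.linearEquiv 2 ℝ _).trans
        ((LinearEquiv.refl ℝ ℝ).prodCongr (WithLp.linearEquiv 2 ℝ _))
    rw [h1]
    simp only [V, finrank_euclideanSpace, Fintype.card_fin, Module.finrank_prod,
      Module.finrank_self]
    omega)
  let e : (Fin n → ℝ) ≃ᵐ ℝ × EuclideanSpace ℝ (Fin p) × EuclideanSpace ℝ (Fin (n - p - 1)) :=
    (MeasurableEquiv.toLp 2 (Fin n → ℝ)).trans <| T.toHomeomorph.toMeasurableEquiv.trans <|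
      (MeasurableEquiv.toLp 2 _).symm.trans <|
        MeasurableEquiv.prodCongr (MeasurableEquiv.refl ℝ) (MeasurableEquiv.toLp 2 _).symm
  have he : ∀ y, e y = (inner ℝ (b (Sum.inl 0)) (WithLp.toLp 2 y),
      WithLp.toLp 2 (fun i => inner ℝ (b (Sum.inr (Sum.inl i))) (WithLp.toLp 2 y)),
      WithLp.toLp 2 (fun i => inner ℝ (b (Sum.inr (Sum.inr i))) (WithLp.toLp 2 y))) :=
    fun y => rfl
  have hfst : ∀ y : Fin n → ℝ, (e y).1 = (√n)⁻¹ * ∑ i, y i := by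
    intro y
    rw [he, hb]
    simp [PiLp.inner_apply, ← Finset.sum_mul, mul_comm]
  have hbb := orthonormal_iff_ite.1 b.orthonormal
  have hone : (WithLp.toLp 2 (fun _ => (1 : ℝ)) : V) = √n • b (Sum.inl 0) := by
    rw [hb, smul_smul, mul_inv_cancel₀ hsq, one_smul]
  refine ⟨⟨e, ?_, A, ?_, ?_, hfst⟩⟩
  · refine (PiLp.volume_preserving_toLp (Fin n)).trans ?_
    refine (T.measurePreserving).trans ?_
    refine (WithLp.volume_preserving_ofLp _ _).trans ?_
    exact (MeasurePreserving.id volume).prod (WithLp.volume_preserving_ofLp _ _)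
  · intro y α β
    have hdec : (WithLp.toLp 2 (fun i => y i - α - (X *ᵥ β) i) : V)
        = WithLp.toLp 2 y - (α * √n) • b (Sum.inl 0)
          - ∑ i, A β i • b (Sum.inr (Sum.inl i)) := by
      rw [← hA β, mul_smul, ← hone]
      ext i
      simp
    rw [he, he, hdec]
    simp only [inner_sub_right, real_inner_smul_right, inner_sum, hbb]
    refine Prod.ext ?_ (Prod.ext ?_ ?_)
    · simp [mul_comm]
    · ext i; simp
    · ext i; simp
  · intro y z
    have h1 : y ⬝ᵥ z = inner ℝ (WithLp.toLp 2 y) (WithLp.toLp 2 z : V) := by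
      simp [PiLp.inner_apply, dotProduct, mul_comm]
    rw [h1, ← b.sum_inner_mul_inner]
    simp only [Fintype.sum_sum_type, Fin.sum_univ_one, he, PiLp.inner_apply, real_inner_comm]
    simp [mul_comm, add_assoc]

/-! ### Integrals over the half line -/

/-- In the variable `u = log x` scalings and inversion of the half line become translations and
reflection, which preserve Lebesgue measure. -/
lemma setLIntegral_Ioi_eq_exp (f : ℝ → ℝ≥0∞) :
    ∫⁻ x in Set.Ioi (0 : ℝ), f x = ∫⁻ u : ℝ, ENNReal.ofReal (Real.exp u) * f (Real.exp u) := by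
  have h := lintegral_image_eq_lintegral_abs_deriv_mul (s := Set.univ) (f := Real.exp)
    (f' := Real.exp) MeasurableSet.univ
    (fun x _ => (Real.hasDerivAt_exp x).hasDerivWithinAt) (Real.exp_injective.injOn) f
  rw [Set.image_univ, Real.range_exp] at h
  rw [h, setLIntegral_univ]
  simp only [abs_of_pos (Real.exp_pos _)]

lemma setLIntegral_Ioi_scale {c : ℝ} (hc : 0 < c) (f : ℝ → ℝ≥0∞) :
    ∫⁻ x in Set.Ioi (0 : ℝ), f x = ∫⁻ x in Set.Ioi (0 : ℝ), ENNReal.ofReal c * f (c * x) := by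
  rw [setLIntegral_Ioi_eq_exp, setLIntegral_Ioi_eq_exp,
    ← lintegral_add_right_eq_self _ (Real.log c)]
  refine lintegral_congr fun u => ?_
  rw [Real.exp_add, Real.exp_log hc, ENNReal.ofReal_mul (Real.exp_pos _).le, mul_comm c, mul_assoc]

lemma setLIntegral_Ioi_inv (f : ℝ → ℝ≥0∞) :
    ∫⁻ x in Set.Ioi (0 : ℝ), ENNReal.ofReal x⁻¹ * f x
      = ∫⁻ x in Set.Ioi (0 : ℝ), ENNReal.ofReal x⁻¹ * f x⁻¹ := by
  have key : ∀ g : ℝ → ℝ≥0∞, ∫⁻ x in Set.Ioi (0 : ℝ), ENNReal.ofReal x⁻¹ * g x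
      = ∫⁻ u : ℝ, g (Real.exp u) := by
    intro g
    rw [setLIntegral_Ioi_eq_exp]
    refine lintegral_congr fun u => ?_
    rw [← mul_assoc, ← ENNReal.ofReal_mul (Real.exp_pos _).le,
      mul_inv_cancel₀ (Real.exp_pos _).ne', ENNReal.ofReal_one, one_mul]
  rw [key, key (fun x => f x⁻¹), ← lintegral_sub_left_eq_self _ (0 : ℝ)]
  refine lintegral_congr fun u => ?_
  rw [zero_sub, Real.exp_neg]

lemma lintegral_gamma {a r : ℝ} (ha : 0 < a) (hr : 0 < r) :
    ∫⁻ x in Set.Ioi (0 : ℝ), ENNReal.ofReal (x ^ (a - 1) * Real.exp (-(r * x)))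
      = ENNReal.ofReal ((1 / r) ^ a * Real.Gamma a) := by
  have hpos : 0 < (1 / r) ^ a * Real.Gamma a := by
    have := Real.Gamma_pos_of_pos ha; positivity
  have h := Real.integral_rpow_mul_exp_neg_mul_Ioi ha hr
  -- A function that is not integrable has Bochner integral 0, so the positive value forces
  -- integrability.
  have hint : IntegrableOn (fun x : ℝ => x ^ (a - 1) * Real.exp (-(r * x))) (Set.Ioi 0) := by
    by_contra hcon
    rw [integral_undef hcon] at h
    exact hpos.ne h
  rw [← h, ofReal_integral_eq_lintegral_ofReal hint]
  filter_upwards [ae_restrict_mem measurableSet_Ioi] with x hx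
  have : (0 : ℝ) < x := hx
  simp only [Pi.zero_apply]
  positivity

/-! ### Centred Gaussian measures -/

section Gauss

set_option linter.unusedSectionVars false

variable {E : Type*} [NormedAddCommGroup E] [InnerProductSpace ℝ E] [FiniteDimensional ℝ E]
  [MeasurableSpace E] [BorelSpace E]

/-- The density of the centred normal law with covariance `w` times the identity. -/
def gaussDens (w : ℝ) (z : E) : ℝ≥0∞ :=
  ENNReal.ofReal ((2 * Real.pi * w) ^ (-(Module.finrank ℝ E : ℝ) / 2) *
    Real.exp (-‖z‖ ^ 2 / (2 * w)))

@[fun_prop]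
lemma measurable_gaussDens_comp {Ω : Type*} [MeasurableSpace Ω] {f : Ω → ℝ} {g : Ω → E}
    (hf : Measurable f) (hg : Measurable g) : Measurable fun x => gaussDens (f x) (g x) := by
  unfold gaussDens
  fun_prop

lemma measurable_gaussDens (w : ℝ) : Measurable (gaussDens (E := E) w) := by
  unfold gaussDens
  fun_prop

variable (E) in
/-- The standard normal law. -/
def gauss : Measure E := volume.withDensity (gaussDens 1)

lemma lintegral_gauss {h : E → ℝ≥0∞} (hh : Measurable h) :
    ∫⁻ z, h z ∂(gauss E) = ∫⁻ z, gaussDens 1 z * h z := by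
  rw [gauss, lintegral_withDensity_eq_lintegral_mul _ (measurable_gaussDens 1) hh]
  rfl

lemma lintegral_comp_smul_haar {r : ℝ} (hr : 0 < r) {h : E → ℝ≥0∞} (hh : Measurable h) :
    ∫⁻ z, h (r • z) = ENNReal.ofReal ((r ^ Module.finrank ℝ E)⁻¹) * ∫⁻ z, h z := by
  have h1 : ∫⁻ z, h (r • z) = ∫⁻ z, h z ∂(Measure.map (r • ·) (volume : Measure E)) := by
    rw [lintegral_map hh (by fun_prop)]
  rw [h1, Measure.map_addHaar_smul _ hr.ne', lintegral_smul_measure, abs_of_pos (by positivity)]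
  rfl

lemma gaussDens_smul {w : ℝ} (hw : 0 < w) (z : E) :
    gaussDens w (√w • z) = ENNReal.ofReal ((√w ^ Module.finrank ℝ E)⁻¹) * gaussDens 1 z := by
  have hs := Real.sqrt_pos.2 hw
  have h2 : ‖√w • z‖ ^ 2 = w * ‖z‖ ^ 2 := by
    rw [norm_smul, mul_pow, Real.norm_of_nonneg hs.le, Real.sq_sqrt hw.le]
  rw [gaussDens, gaussDens, ← ENNReal.ofReal_mul (by positivity), h2, mul_one,
    Real.mul_rpow (by positivity) hw.le]
  have h3 : w ^ (-(Module.finrank ℝ E : ℝ) / 2) = (√w ^ Module.finrank ℝ E)⁻¹ := by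
    rw [Real.sqrt_eq_rpow, ← Real.rpow_natCast, ← Real.rpow_mul hw.le, ← Real.rpow_neg hw.le]
    congr 1; ring
  rw [h3]
  congr 1
  have h4 : -(w * ‖z‖ ^ 2) / (2 * w) = -‖z‖ ^ 2 / (2 * 1) := by field_simp
  rw [h4, mul_one]; ring

lemma lintegral_gaussDens_mul {w : ℝ} (hw : 0 < w) (μ : E) {h : E → ℝ≥0∞} (hh : Measurable h) :
    ∫⁻ y, gaussDens w (y - μ) * h y = ∫⁻ ζ, h (μ + √w • ζ) ∂(gauss E) := by
  have hs := Real.sqrt_pos.2 hw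
  have hm := measurable_gaussDens (E := E) w
  have h1 : ∫⁻ y, gaussDens w (y - μ) * h y = ∫⁻ z, gaussDens w z * h (μ + z) := by
    rw [← lintegral_add_left_eq_self (fun y => gaussDens w (y - μ) * h y) μ]
    simp
  have h2 := lintegral_comp_smul_haar (E := E) hs
    (h := fun z => gaussDens w z * h (μ + z)) (by fun_prop)
  have hc : ENNReal.ofReal ((√w ^ Module.finrank ℝ E)⁻¹) ≠ 0 := by
    rw [Ne, ENNReal.ofReal_eq_zero, not_le]; positivity
  rw [h1, lintegral_gauss (by fun_prop)]
  refine (ENNReal.mul_right_inj hc ENNReal.ofReal_ne_top).1 ?_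
  rw [← h2, ← lintegral_const_mul _ (by have := measurable_gaussDens (E := E) 1; fun_prop)]
  refine lintegral_congr fun z => ?_
  rw [gaussDens_smul hw, mul_assoc]

instance isProbabilityMeasure_gauss : IsProbabilityMeasure (gauss E) := by
  constructor
  have h : gauss E Set.univ = ∫⁻ z : E, gaussDens 1 z := by simp [gauss]
  have h1 := GaussianFourier.integral_rexp_neg_mul_sq_norm (V := E) (b := 1 / 2) (by norm_num)
  have h2 : ∫ z : E, ((2 * Real.pi * 1) ^ (-(Module.finrank ℝ E : ℝ) / 2) *
      Real.exp (-‖z‖ ^ 2 / (2 * 1))) = 1 := by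
    have e : ∀ z : E, -‖z‖ ^ 2 / (2 * 1) = -(1 / 2) * ‖z‖ ^ 2 := by intro z; ring
    simp only [e]
    rw [integral_const_mul, h1, neg_div, Real.rpow_neg (by positivity)]
    have : Real.pi / (1 / 2) = 2 * Real.pi * 1 := by ring
    rw [this, inv_mul_cancel₀ (by positivity)]
  have hint : Integrable (fun z : E => ((2 * Real.pi * 1) ^ (-(Module.finrank ℝ E : ℝ) / 2) *
      Real.exp (-‖z‖ ^ 2 / (2 * 1)))) := by
    by_contra hcon
    rw [integral_undef hcon] at h2
    exact zero_ne_one h2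
  rw [h]
  unfold gaussDens
  rw [← ofReal_integral_eq_lintegral_ofReal hint (ae_of_all _ fun z => by positivity), h2,
    ENNReal.ofReal_one]

lemma gauss_absolutelyContinuous : gauss E ≪ volume := withDensity_absolutelyContinuous _ _

/-- The density of the logarithm of `‖ζ‖²` up to a constant, for `ζ` standard normal. -/
def logChiDens (d : ℕ) (τ : ℝ) : ℝ≥0∞ :=
  ENNReal.ofReal ((2 * Real.pi) ^ (-(d : ℝ) / 2) * Real.exp (d * τ / 2 - Real.exp τ / 2))

@[fun_prop]
lemma measurable_logChiDens (d : ℕ) : Measurable (logChiDens d) := by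
  unfold logChiDens; fun_prop

/-- When the variance is `‖y‖² e^(-τ)`, the density splits into a scale-invariant weight in `y` and
a function of `τ` alone. Hence a flat measure on the log variance makes the law of `τ` given `y`
free of `y`. -/
lemma gaussDens_exp_log_sub {y : E} (hy : y ≠ 0) (τ : ℝ) :
    gaussDens (Real.exp (Real.log (‖y‖ ^ 2) - τ)) y
      = ENNReal.ofReal ((‖y‖ ^ 2) ^ (-(Module.finrank ℝ E : ℝ) / 2)) *
        logChiDens (Module.finrank ℝ E) τ := by
  have hS : 0 < ‖y‖ ^ 2 := by have := norm_pos_iff.2 hy; positivity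
  rw [gaussDens, logChiDens, ← ENNReal.ofReal_mul (by positivity), Real.exp_sub, Real.exp_log hS]
  congr 1
  rw [Real.mul_rpow (by positivity) (by positivity), Real.div_rpow hS.le (Real.exp_pos _).le,
    ← Real.exp_mul]
  have e1 : -‖y‖ ^ 2 / (2 * (‖y‖ ^ 2 / Real.exp τ)) = -(Real.exp τ / 2) := by
    have := Real.exp_pos τ
    field_simp
  rw [e1, Real.exp_sub, Real.exp_neg,
    show τ * (-(Module.finrank ℝ E : ℝ) / 2) = -(Module.finrank ℝ E * τ / 2) by ring, Real.exp_neg]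
  field_simp

variable [Nontrivial E]

lemma ae_ne_zero : ∀ᵐ y : E, y ≠ 0 := by
  rw [ae_iff]; simp

lemma gauss_ae_ne_zero : ∀ᵐ y ∂(gauss E), y ≠ 0 :=
  gauss_absolutelyContinuous.ae_le ae_ne_zero

/-- Integration over the scale group: for `u` distributed along Lebesgue measure and `η` standard
normal, the joint law of `exp (u / 2) η` and `u`. -/
lemma lintegral_scale_gauss {F : E × ℝ → ℝ≥0∞} (hF : Measurable F) :
    ∫⁻ u : ℝ, ∫⁻ η, F (√(Real.exp u) • η, u) ∂(gauss E)
      = ∫⁻ y : E, ENNReal.ofReal ((‖y‖ ^ 2) ^ (-(Module.finrank ℝ E : ℝ) / 2)) *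
        ∫⁻ τ : ℝ, logChiDens (Module.finrank ℝ E) τ * F (y, Real.log (‖y‖ ^ 2) - τ) := by
  have h1 : ∀ u : ℝ, ∫⁻ η, F (√(Real.exp u) • η, u) ∂(gauss E)
      = ∫⁻ y, gaussDens (Real.exp u) y * F (y, u) := by
    intro u
    have := lintegral_gaussDens_mul (Real.exp_pos u) (0 : E) (h := fun y => F (y, u)) (by fun_prop)
    simpa using this.symm
  simp only [h1]
  rw [lintegral_lintegral_swap]
  · refine lintegral_congr_ae ?_
    filter_upwards [ae_ne_zero (E := E)] with y hy
    -- For fixed `y` the log variance `u` is replaced by `τ = log ‖y‖² - u`.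
    rw [← lintegral_sub_left_eq_self _ (Real.log (‖y‖ ^ 2)), ← lintegral_const_mul]
    · refine lintegral_congr fun τ => ?_
      rw [gaussDens_exp_log_sub hy, mul_assoc]
    · have := measurable_logChiDens (Module.finrank ℝ E)
      fun_prop
  · refine Measurable.aemeasurable ?_
    refine Measurable.mul ?_ ?_
    · fun_prop
    · exact hF.comp (measurable_snd.prodMk measurable_fst)

variable (E) in
/-- The mass of the shell `|log ‖y‖²| ≤ M` under the scale invariant measure. -/
def shellMass (M : ℝ) : ℝ≥0∞ :=
  ∫⁻ y in {y : E | |Real.log (‖y‖ ^ 2)| ≤ M},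
    ENNReal.ofReal ((‖y‖ ^ 2) ^ (-(Module.finrank ℝ E : ℝ) / 2))

lemma measurableSet_shell (M : ℝ) : MeasurableSet {y : E | |Real.log (‖y‖ ^ 2)| ≤ M} := by
  refine measurableSet_le ?_ measurable_const
  fun_prop

lemma volume_abs_add_le (c M : ℝ) : volume {u : ℝ | |u + c| ≤ M} = ENNReal.ofReal (2 * M) := by
  have : {u : ℝ | |u + c| ≤ M} = Set.Icc (-M - c) (M - c) := by
    ext u; simp only [Set.mem_ofPred_eq, Set.mem_Icc, abs_le]
    constructor <;> rintro ⟨h1, h2⟩ <;> constructor <;> linarith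
  rw [this, Real.volume_Icc]; congr 1; ring

/-- Apply `lintegral_scale_gauss` to the indicator of a shell in `y` times `h(‖y‖² e^(-u))`.
Integrating over `u` first gives an interval of length `2 M` and the law of `‖η‖²`; integrating over
`y` first gives the mass of the shell and the explicit density. -/
lemma two_mul_lintegral_gauss (M : ℝ) {h : ℝ → ℝ≥0∞} (hh : Measurable h) :
    ENNReal.ofReal (2 * M) * ∫⁻ η, h (‖η‖ ^ 2) ∂(gauss E)
      = shellMass E M * ∫⁻ τ, logChiDens (Module.finrank ℝ E) τ * h (Real.exp τ) := by
  have hs := measurableSet_shell (E := E) M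
  let F : E × ℝ → ℝ≥0∞ := fun q =>
    Set.indicator {y : E | |Real.log (‖y‖ ^ 2)| ≤ M} (fun y => h (‖y‖ ^ 2 * Real.exp (-q.2))) q.1
  have hF : Measurable F := by
    have : F = Set.indicator (Prod.fst ⁻¹' {y : E | |Real.log (‖y‖ ^ 2)| ≤ M})
        (fun q : E × ℝ => h (‖q.1‖ ^ 2 * Real.exp (-q.2))) := by
      ext q; rfl
    rw [this]
    exact Measurable.indicator (by fun_prop) (measurable_fst hs)
  have key := lintegral_scale_gauss hF
  have hL : ∫⁻ u : ℝ, ∫⁻ η, F (√(Real.exp u) • η, u) ∂(gauss E)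
      = ENNReal.ofReal (2 * M) * ∫⁻ η, h (‖η‖ ^ 2) ∂(gauss E) := by
    rw [lintegral_lintegral_swap]
    · rw [← lintegral_const_mul _ (by fun_prop)]
      refine lintegral_congr_ae ?_
      filter_upwards [gauss_ae_ne_zero (E := E)] with η hη
      have hS : 0 < ‖η‖ ^ 2 := by have := norm_pos_iff.2 hη; positivity
      have e1 : ∀ u : ℝ, F (√(Real.exp u) • η, u)
          = Set.indicator {u : ℝ | |u + Real.log (‖η‖ ^ 2)| ≤ M} (fun _ => h (‖η‖ ^ 2)) u := by
        intro u
        have e2 : ‖√(Real.exp u) • η‖ ^ 2 = Real.exp u * ‖η‖ ^ 2 := by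
          rw [norm_smul, mul_pow, Real.norm_of_nonneg (Real.sqrt_nonneg _),
            Real.sq_sqrt (Real.exp_pos _).le]
        simp only [F, Set.indicator, Set.mem_ofPred_eq, e2,
          Real.log_mul (Real.exp_pos u).ne' hS.ne', Real.log_exp]
        congr 2
        rw [Real.exp_neg]
        field_simp
      simp only [e1]
      rw [lintegral_indicator_const, volume_abs_add_le, mul_comm]
      exact measurableSet_le (by fun_prop) measurable_const
    · refine Measurable.aemeasurable ?_
      exact hF.comp (f := fun q : ℝ × E => (√(Real.exp q.1) • q.2, q.1)) (by fun_prop)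
  have hR : ∫⁻ y : E, ENNReal.ofReal ((‖y‖ ^ 2) ^ (-(Module.finrank ℝ E : ℝ) / 2)) *
        ∫⁻ τ : ℝ, logChiDens (Module.finrank ℝ E) τ * F (y, Real.log (‖y‖ ^ 2) - τ)
      = shellMass E M * ∫⁻ τ, logChiDens (Module.finrank ℝ E) τ * h (Real.exp τ) := by
    rw [shellMass, ← lintegral_indicator hs, ← lintegral_mul_const _ (by
      exact Measurable.indicator (by fun_prop) hs)]
    refine lintegral_congr_ae ?_
    filter_upwards [ae_ne_zero (E := E)] with y hy
    have hS : 0 < ‖y‖ ^ 2 := by have := norm_pos_iff.2 hy; positivity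
    by_cases hy1 : |Real.log (‖y‖ ^ 2)| ≤ M
    · rw [Set.indicator_of_mem (by exact hy1)]
      congr 1
      refine lintegral_congr fun τ => ?_
      congr 1
      simp only [F]
      rw [Set.indicator_of_mem (by exact hy1), neg_sub, Real.exp_sub, Real.exp_log hS]
      congr 1
      field_simp
    · rw [Set.indicator_of_notMem (by exact hy1), zero_mul]
      have : ∀ τ : ℝ, F (y, Real.log (‖y‖ ^ 2) - τ) = 0 := fun τ =>
        Set.indicator_of_notMem (by exact hy1) _
      simp only [this, mul_zero, lintegral_zero]
  rw [← hL, key, hR]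

variable (E) in
/-- The normalizing constant of the density of `log ‖ζ‖²`. -/
def chiConst : ℝ≥0∞ := shellMass E 1 / 2

lemma lintegral_gauss_norm_sq {h : ℝ → ℝ≥0∞} (hh : Measurable h) :
    ∫⁻ η, h (‖η‖ ^ 2) ∂(gauss E)
      = chiConst E * ∫⁻ τ, logChiDens (Module.finrank ℝ E) τ * h (Real.exp τ) := by
  have := two_mul_lintegral_gauss (E := E) 1 hh
  rw [mul_one] at this
  rw [chiConst, ENNReal.mul_comm_div, ← mul_div_assoc, ← this,
    show ENNReal.ofReal 2 = 2 by simp, mul_comm, ENNReal.mul_div_cancel_right] <;> simp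

lemma chiConst_mul : chiConst E * ∫⁻ τ, logChiDens (Module.finrank ℝ E) τ = 1 := by
  have := lintegral_gauss_norm_sq (E := E) (h := fun _ => 1) measurable_const
  simpa using this.symm

lemma chiConst_ne_zero : chiConst E ≠ 0 := fun h => by
  have := chiConst_mul (E := E); simp [h] at this

lemma lintegral_logChiDens_ne_zero : ∫⁻ τ, logChiDens (Module.finrank ℝ E) τ ≠ 0 := fun h => by
  have := chiConst_mul (E := E); simp [h] at this

lemma chiConst_ne_top : chiConst E ≠ ∞ := fun h => by
  have := chiConst_mul (E := E)
  rw [h, ENNReal.top_mul lintegral_logChiDens_ne_zero] at this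
  exact ENNReal.top_ne_one this

/-- Compare total masses by taking `h = 1`. Linearity in `M` makes the ends of the range of log
scales negligible in the minimax argument. -/
lemma shellMass_eq (M : ℝ) : shellMass E M = ENNReal.ofReal (2 * M) * chiConst E := by
  have h1 := two_mul_lintegral_gauss (E := E) M (h := fun _ => 1) measurable_const
  have h2 := chiConst_mul (E := E)
  simp only [mul_one, lintegral_one, measure_univ] at h1
  rw [h1, mul_assoc, mul_comm _ (chiConst E), h2, mul_one]

/-- The law of the squared norm of a standard normal vector. -/
lemma lintegral_gauss_norm_sq' {h : ℝ → ℝ≥0∞} (hh : Measurable h) :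
    ∫⁻ η, h (‖η‖ ^ 2) ∂(gauss E)
      = chiConst E * ENNReal.ofReal ((2 * Real.pi) ^ (-(Module.finrank ℝ E : ℝ) / 2)) *
        ∫⁻ x in Set.Ioi (0 : ℝ), ENNReal.ofReal (x ^ ((Module.finrank ℝ E : ℝ) / 2 - 1) *
          Real.exp (-(1 / 2 * x))) * h x := by
  rw [lintegral_gauss_norm_sq hh, setLIntegral_Ioi_eq_exp, mul_assoc]
  congr 1
  rw [← lintegral_const_mul _ (by fun_prop)]
  refine lintegral_congr fun τ => ?_
  rw [← mul_assoc, ← mul_assoc, logChiDens, ← ENNReal.ofReal_mul (by positivity),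
    ← ENNReal.ofReal_mul (by positivity)]
  congr 2
  rw [← Real.exp_mul, mul_assoc, ← mul_assoc (Real.exp τ), ← Real.exp_add, ← Real.exp_add]
  congr 2; ring

end Gauss

/-! ### The latent representation of the sampling law -/

instance nontrivial_euclideanSpace {d : ℕ} [NeZero d] :
    Nontrivial (EuclideanSpace ℝ (Fin d)) := by
  refine Module.nontrivial_of_finrank_pos (R := ℝ) ?_
  simpa using Nat.pos_of_ne_zero (NeZero.ne d)

lemma mul_mixture_kernel_eq {n p : ℕ} (hn : p + 1 < n) {s v : ℝ} (hs : 0 < s) (hv : 0 < v)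
    (z₀ : ℝ) (z₁ : EuclideanSpace ℝ (Fin p)) (z₂ : EuclideanSpace ℝ (Fin (n - p - 1))) :
    ENNReal.ofReal (s ^ (-(n : ℝ) / 2)) * ENNReal.ofReal ((2 * Real.pi * v) ^ (-(n : ℝ) / 2) *
      Real.exp (-((z₀ ^ 2 + ‖z₁‖ ^ 2 + ‖z₂‖ ^ 2) / s) / (2 * v)))
      = gaussDens (s * v) z₀ * (gaussDens (s * v) z₁ * gaussDens (s * v) z₂) := by
  have hm : ((n - p - 1 : ℕ) : ℝ) = n - p - 1 := by
    rw [Nat.sub_sub, Nat.cast_sub hn.le]; push_cast; ring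
  have hw : 0 < 2 * Real.pi * (s * v) := by positivity
  simp only [gaussDens]
  rw [← ENNReal.ofReal_mul (by positivity), ← ENNReal.ofReal_mul (by positivity),
    ← ENNReal.ofReal_mul (by positivity)]
  congr 1
  simp only [Module.finrank_self, finrank_euclideanSpace, Fintype.card_fin, hm]
  have e1 : s ^ (-(n : ℝ) / 2) * (2 * Real.pi * v) ^ (-(n : ℝ) / 2)
      = (2 * Real.pi * (s * v)) ^ (-(n : ℝ) / 2) := by
    rw [← Real.mul_rpow hs.le (by positivity)]; congr 1; ring
  have e2 : (2 * Real.pi * (s * v)) ^ (-(n : ℝ) / 2)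
      = (2 * Real.pi * (s * v)) ^ (-((1 : ℕ) : ℝ) / 2) * ((2 * Real.pi * (s * v)) ^ (-(p : ℝ) / 2) *
        (2 * Real.pi * (s * v)) ^ (-((n : ℝ) - p - 1) / 2)) := by
    rw [← Real.rpow_add hw, ← Real.rpow_add hw]
    congr 1; push_cast; ring
  have e3 : Real.exp (-((z₀ ^ 2 + ‖z₁‖ ^ 2 + ‖z₂‖ ^ 2) / s) / (2 * v))
      = Real.exp (-‖z₀‖ ^ 2 / (2 * (s * v))) * (Real.exp (-‖z₁‖ ^ 2 / (2 * (s * v))) *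
        Real.exp (-‖z₂‖ ^ 2 / (2 * (s * v)))) := by
    rw [← Real.exp_add, ← Real.exp_add, Real.norm_eq_abs, sq_abs]
    congr 1; field_simp; ring
  rw [← mul_assoc, e1, e2, e3]; ring

namespace CanonicalCoords

variable {n p : ℕ} {X : Matrix (Fin n) (Fin p) ℝ}

lemma samplingDensity_eq (c : CanonicalCoords X) (hn : p + 1 < n) {G : Measure ℝ}
    (hG : IsMixingLaw G) (α : ℝ) (β : Fin p → ℝ) {s : ℝ} (hs : 0 < s) (y : Fin n → ℝ) :
    samplingDensity X G α β s y = ∫⁻ v, gaussDens (s * v) ((c.e y).1 - √n * α) *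
      (gaussDens (s * v) ((c.e y).2.1 - c.A β) * gaussDens (s * v) (c.e y).2.2) ∂G := by
  rw [samplingDensity, mixtureDensity, ← lintegral_const_mul _ (by fun_prop)]
  refine lintegral_congr_ae ?_
  filter_upwards [hG.pos] with v hv
  rw [c.sqNorm_residual, mul_mixture_kernel_eq hn hs hv]

/-- The observation as a function of the latent variables `(v, ζ₀, ζ₁, η)`. -/
def observe (c : CanonicalCoords X) (α : ℝ) (β : Fin p → ℝ) (s : ℝ)
    (ω : ℝ × ℝ × EuclideanSpace ℝ (Fin p) × EuclideanSpace ℝ (Fin (n - p - 1))) : Fin n → ℝ :=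
  c.e.symm (√n * α + √(s * ω.1) * ω.2.1, c.A β + √(s * ω.1) • ω.2.2.1, √(s * ω.1) • ω.2.2.2)

@[fun_prop]
lemma measurable_observe (c : CanonicalCoords X) (α : ℝ) (β : Fin p → ℝ) (s : ℝ) :
    Measurable (c.observe α β s) := by
  unfold observe
  exact c.e.symm.measurable.comp (by fun_prop)

end CanonicalCoords

/-- The law of the latent variables `(v, ζ₀, ζ₁, η)`. -/
def latentLaw (p m : ℕ) (G : Measure ℝ) :
    Measure (ℝ × ℝ × EuclideanSpace ℝ (Fin p) × EuclideanSpace ℝ (Fin m)) :=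
  G.prod ((gauss ℝ).prod ((gauss _).prod (gauss _)))

instance isProbabilityMeasure_latentLaw (p m : ℕ) (G : Measure ℝ) [IsProbabilityMeasure G] :
    IsProbabilityMeasure (latentLaw p m G) := by
  unfold latentLaw; infer_instance

lemma lintegral_latentLaw {p m : ℕ} (G : Measure ℝ) [IsProbabilityMeasure G]
    {h : ℝ × ℝ × EuclideanSpace ℝ (Fin p) × EuclideanSpace ℝ (Fin m) → ℝ≥0∞} (hh : Measurable h) :
    ∫⁻ ω, h ω ∂(latentLaw p m G) =
      ∫⁻ v, ∫⁻ ζ₀, ∫⁻ ζ₁, ∫⁻ η, h (v, ζ₀, ζ₁, η) ∂(gauss _) ∂(gauss _) ∂(gauss ℝ) ∂G := by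
  rw [latentLaw, lintegral_prod _ hh.aemeasurable]
  refine lintegral_congr fun v => ?_
  rw [lintegral_prod _ (by fun_prop)]
  refine lintegral_congr fun ζ₀ => ?_
  rw [lintegral_prod _ (by fun_prop)]

/-- Fubini brings `v` outside; for fixed `v` the density is a product of three normal densities in
the canonical coordinates, and each is standardized with the common scale `√(s v)`. -/
lemma CanonicalCoords.samplingLaw_eq {n p : ℕ} {X : Matrix (Fin n) (Fin p) ℝ}
    (c : CanonicalCoords X) (hn : p + 1 < n) {G : Measure ℝ}
    (hG : IsMixingLaw G) (α : ℝ) (β : Fin p → ℝ) {s : ℝ} (hs : 0 < s) :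
    samplingLaw X G α β s = (latentLaw p (n - p - 1) G).map (c.observe α β s) := by
  have := hG.prob
  refine Measure.ext_of_lintegral _ fun h hh => ?_
  have he := c.e.measurable
  have hes := c.e.symm.measurable
  have hd : samplingDensity X G α β s = fun y => ∫⁻ v, gaussDens (s * v) ((c.e y).1 - √n * α) *
      (gaussDens (s * v) ((c.e y).2.1 - c.A β) * gaussDens (s * v) (c.e y).2.2) ∂G :=
    funext fun y => c.samplingDensity_eq hn hG α β hs y
  have hmeas : Measurable (samplingDensity X G α β s) := by
    rw [hd]
    exact Measurable.lintegral_prod_right' (f := fun q : (Fin n → ℝ) × ℝ =>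
      gaussDens (s * q.2) ((c.e q.1).1 - √n * α) * (gaussDens (s * q.2) ((c.e q.1).2.1 - c.A β) *
        gaussDens (s * q.2) (c.e q.1).2.2)) (by fun_prop)
  rw [lintegral_map hh (by fun_prop), lintegral_latentLaw _ (by fun_prop), samplingLaw,
    lintegral_withDensity_eq_lintegral_mul _ hmeas hh, hd]
  simp only [Pi.mul_apply]
  have h1 : ∀ y, (∫⁻ v, gaussDens (s * v) ((c.e y).1 - √n * α) *
      (gaussDens (s * v) ((c.e y).2.1 - c.A β) * gaussDens (s * v) (c.e y).2.2) ∂G) * h y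
      = ∫⁻ v, gaussDens (s * v) ((c.e y).1 - √n * α) *
      (gaussDens (s * v) ((c.e y).2.1 - c.A β) * (gaussDens (s * v) (c.e y).2.2 * h y)) ∂G := by
    intro y
    rw [← lintegral_mul_const _ (by fun_prop)]
    simp only [mul_assoc]
  simp only [h1]
  rw [lintegral_lintegral_swap (by fun_prop)]
  refine lintegral_congr_ae ?_
  filter_upwards [hG.pos] with v hv
  have hw : 0 < s * v := mul_pos hs hv
  have h2 := c.measurePreserving.lintegral_comp (f := fun q => gaussDens (s * v) (q.1 - √n * α) *
      (gaussDens (s * v) (q.2.1 - c.A β) * (gaussDens (s * v) q.2.2 * h (c.e.symm q))))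
      (by fun_prop)
  simp only [MeasurableEquiv.symm_apply_apply] at h2
  rw [h2, Measure.volume_eq_prod, lintegral_prod _ (by fun_prop)]
  have h3 : ∀ z₀ : ℝ, ∫⁻ q : EuclideanSpace ℝ (Fin p) × EuclideanSpace ℝ (Fin (n - p - 1)),
      gaussDens (s * v) (z₀ - √n * α) * (gaussDens (s * v) (q.1 - c.A β) *
        (gaussDens (s * v) q.2 * h (c.e.symm (z₀, q))))
      = gaussDens (s * v) (z₀ - √n * α) *
        ∫⁻ ζ₁, ∫⁻ η, h (c.e.symm (z₀, c.A β + √(s * v) • ζ₁, √(s * v) • η))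
          ∂(gauss _) ∂(gauss _) := by
    intro z₀
    rw [lintegral_const_mul _ (by fun_prop), Measure.volume_eq_prod,
      lintegral_prod _ (by fun_prop)]
    congr 1
    have h4 : ∀ z₁ : EuclideanSpace ℝ (Fin p),
        ∫⁻ q : EuclideanSpace ℝ (Fin (n - p - 1)), gaussDens (s * v) (z₁ - c.A β) *
          (gaussDens (s * v) q * h (c.e.symm (z₀, z₁, q)))
        = gaussDens (s * v) (z₁ - c.A β) *
          ∫⁻ η, h (c.e.symm (z₀, z₁, √(s * v) • η)) ∂(gauss _) := by
      intro z₁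
      rw [lintegral_const_mul _ (by fun_prop)]
      congr 1
      have := lintegral_gaussDens_mul hw (0 : EuclideanSpace ℝ (Fin (n - p - 1)))
        (h := fun q => h (c.e.symm (z₀, z₁, q))) (by fun_prop)
      simpa using this
    simp only [h4]
    exact lintegral_gaussDens_mul hw (c.A β)
      (h := fun z₁ => ∫⁻ η, h (c.e.symm (z₀, z₁, √(s * v) • η)) ∂(gauss _))
      (Measurable.lintegral_prod_right' (f := fun q : EuclideanSpace ℝ (Fin p) ×
        EuclideanSpace ℝ (Fin (n - p - 1)) => h (c.e.symm (z₀, q.1, √(s * v) • q.2)))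
        (by fun_prop))
  simp only [h3]
  rw [lintegral_gaussDens_mul hw (√n * α)
      (h := fun z₀ => ∫⁻ ζ₁, ∫⁻ η, h (c.e.symm (z₀, c.A β + √(s * v) • ζ₁, √(s * v) • η))
          ∂(gauss _) ∂(gauss _))]
  · rfl
  · refine Measurable.lintegral_prod_right' (f := fun r : ℝ × EuclideanSpace ℝ (Fin p) =>
      ∫⁻ η : EuclideanSpace ℝ (Fin (n - p - 1)),
        h (c.e.symm (r.1, c.A β + √(s * v) • r.2, √(s * v) • η)) ∂(gauss _)) ?_
    exact Measurable.lintegral_prod_right' (f := fun q : (ℝ × EuclideanSpace ℝ (Fin p)) ×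
      EuclideanSpace ℝ (Fin (n - p - 1)) =>
        h (c.e.symm (q.1.1, c.A β + √(s * v) • q.1.2, √(s * v) • q.2))) (by fun_prop)

/-! ### Marginals for the harmonic prior -/

section Harmonic

variable {E : Type*} [NormedAddCommGroup E] [InnerProductSpace ℝ E] [FiniteDimensional ℝ E]
  [MeasurableSpace E] [BorelSpace E]

set_option linter.unusedSectionVars false

lemma lintegral_gaussDens_sub {w : ℝ} (hw : 0 < w) (μ : E) :
    ∫⁻ y, gaussDens w (y - μ) = 1 := by
  have := lintegral_gaussDens_mul hw μ (h := fun _ => 1) measurable_const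
  simpa using this

lemma gaussDens_sub_comm (w : ℝ) (y z : E) : gaussDens w (y - z) = gaussDens w (z - y) := by
  rw [gaussDens, gaussDens, norm_sub_rev]

/-- Completing the square in `θ`. -/
lemma gaussDens_mul_exp_neg {w l : ℝ} (hw : 0 < w) (hl : 0 ≤ l) (y θ : E) :
    gaussDens w (y - θ) * ENNReal.ofReal (Real.exp (-(‖θ‖ ^ 2 * l)))
      = ENNReal.ofReal ((1 + 2 * l * w) ^ (-(Module.finrank ℝ E : ℝ) / 2) *
          Real.exp (-(l * ‖y‖ ^ 2) / (1 + 2 * l * w))) *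
        gaussDens (w / (1 + 2 * l * w)) (θ - (1 + 2 * l * w)⁻¹ • y) := by
  have hk : 0 < 1 + 2 * l * w := by positivity
  set k := 1 + 2 * l * w with hk_def
  rw [gaussDens, gaussDens, ← ENNReal.ofReal_mul (by positivity),
    ← ENNReal.ofReal_mul (by positivity)]
  congr 1
  have e1 : k ^ (-(Module.finrank ℝ E : ℝ) / 2) *
      (2 * Real.pi * (w / k)) ^ (-(Module.finrank ℝ E : ℝ) / 2)
      = (2 * Real.pi * w) ^ (-(Module.finrank ℝ E : ℝ) / 2) := by
    rw [← Real.mul_rpow hk.le (by positivity)]; congr 1; field_simp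
  have e2 : Real.exp (-‖y - θ‖ ^ 2 / (2 * w)) * Real.exp (-(‖θ‖ ^ 2 * l))
      = Real.exp (-(l * ‖y‖ ^ 2) / k) * Real.exp (-‖θ - k⁻¹ • y‖ ^ 2 / (2 * (w / k))) := by
    rw [← Real.exp_add, ← Real.exp_add]
    congr 1
    rw [norm_sub_sq_real, norm_sub_sq_real, real_inner_smul_right, norm_smul,
      Real.norm_of_nonneg (by positivity), real_inner_comm]
    field_simp
    rw [hk_def]; ring
  calc _ = (2 * Real.pi * w) ^ (-(Module.finrank ℝ E : ℝ) / 2) *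
        (Real.exp (-‖y - θ‖ ^ 2 / (2 * w)) * Real.exp (-(‖θ‖ ^ 2 * l))) := by ring
    _ = _ := by rw [e2, ← e1]; ring

lemma lintegral_gaussDens_mul_exp_neg {w l : ℝ} (hw : 0 < w) (hl : 0 ≤ l) (y : E) :
    ∫⁻ θ, gaussDens w (y - θ) * ENNReal.ofReal (Real.exp (-(‖θ‖ ^ 2 * l)))
      = ENNReal.ofReal ((1 + 2 * l * w) ^ (-(Module.finrank ℝ E : ℝ) / 2) *
          Real.exp (-(l * ‖y‖ ^ 2) / (1 + 2 * l * w))) := by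
  simp only [gaussDens_mul_exp_neg hw hl]
  have hk : 0 < 1 + 2 * l * w := by positivity
  rw [lintegral_const_mul _ (by fun_prop), lintegral_gaussDens_sub (by positivity), mul_one]

/-- The substitution `l = t/(2 w (1 - t))` sends `1 + 2 l w` to `1/(1 - t)`. With the exponent `a +
1`, half the dimension, all powers of `1 - t` cancel; this is where the harmonic exponent matters.
-/
lemma setLIntegral_mixing_eq {a w U : ℝ} (hw : 0 < w) :
    ∫⁻ l in Set.Ioi (0 : ℝ), ENNReal.ofReal (l ^ (a - 1)) *
        ENNReal.ofReal ((1 + 2 * l * w) ^ (-(a + 1)) * Real.exp (-(l * U) / (1 + 2 * l * w)))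
      = ENNReal.ofReal ((2 * w) ^ (-a)) *
        ∫⁻ t in Set.Ioo (0 : ℝ) 1, ENNReal.ofReal (t ^ (a - 1) *
          Real.exp (-(t * U) / (2 * w))) := by
  have himg : (fun t : ℝ => t / (2 * w * (1 - t))) '' Set.Ioo 0 1 = Set.Ioi 0 := by
    ext l
    constructor
    · rintro ⟨t, ht, rfl⟩
      exact div_pos ht.1 (mul_pos (by positivity) (sub_pos.2 ht.2))
    · intro hl
      have hl' : (0 : ℝ) < l := hl
      refine ⟨2 * l * w / (1 + 2 * l * w), ⟨by positivity, ?_⟩, ?_⟩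
      · rw [div_lt_one (by positivity)]; linarith
      · have : 1 - 2 * l * w / (1 + 2 * l * w) = 1 / (1 + 2 * l * w) := by field_simp; ring
        simp only [this]; field_simp
  have hder : ∀ t ∈ Set.Ioo (0 : ℝ) 1, HasDerivWithinAt (fun t : ℝ => t / (2 * w * (1 - t)))
      (1 / (2 * w * (1 - t) ^ 2)) (Set.Ioo 0 1) t := by
    intro t ht
    have h1 : 0 < 1 - t := sub_pos.2 ht.2
    have d2 : HasDerivAt (fun t : ℝ => 2 * w * (1 - t)) (2 * w * (-1)) t := by
      simpa using ((hasDerivAt_id t).const_sub 1).const_mul (2 * w)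
    refine (((hasDerivAt_id t).div d2 (by positivity)).congr_deriv ?_).hasDerivWithinAt
    simp only [id]
    field_simp; ring
  have hinj : Set.InjOn (fun t : ℝ => t / (2 * w * (1 - t))) (Set.Ioo 0 1) := by
    intro s hs t ht hst
    have h1 : 0 < 1 - t := sub_pos.2 ht.2
    have h2 : 0 < 1 - s := sub_pos.2 hs.2
    have h3 := hst
    simp only [div_eq_div_iff (by positivity : 2 * w * (1 - s) ≠ 0)
      (by positivity : 2 * w * (1 - t) ≠ 0)] at h3
    have : 2 * w * (s - t) = 0 := by linarith
    rcases mul_eq_zero.1 this with h | h <;> linarith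
  rw [← himg, lintegral_image_eq_lintegral_abs_deriv_mul measurableSet_Ioo hder hinj,
    ← lintegral_const_mul _ (by fun_prop)]
  refine setLIntegral_congr_fun measurableSet_Ioo fun t ht => ?_
  have h1 : 0 < 1 - t := sub_pos.2 ht.2
  have h0 : 0 < t := ht.1
  have e1 : 1 + 2 * (t / (2 * w * (1 - t))) * w = (1 - t)⁻¹ := by field_simp; ring
  have e2 : -(t / (2 * w * (1 - t)) * U) / (1 - t)⁻¹ = -(t * U) / (2 * w) := by field_simp
  simp only [e1, e2]
  rw [abs_of_pos (by positivity), ← ENNReal.ofReal_mul (by positivity),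
    ← ENNReal.ofReal_mul (by positivity), ← ENNReal.ofReal_mul (by positivity)]
  congr 1
  rw [Real.div_rpow h0.le (by positivity), Real.mul_rpow (by positivity) h1.le,
    Real.inv_rpow h1.le, Real.rpow_neg h1.le, inv_inv, Real.rpow_neg (by positivity)]
  have e3 : (2 * w) ^ a = (2 * w) ^ (a - 1) * (2 * w) := by
    rw [← Real.rpow_add_one (by positivity)]; ring_nf
  have e4 : (1 - t) ^ (a + 1) = (1 - t) ^ (a - 1) * (1 - t) ^ 2 := by
    rw [← Real.rpow_natCast, ← Real.rpow_add h1]; congr 1; push_cast; ring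
  rw [e3, e4]
  have := Real.rpow_pos_of_pos h1 (a - 1)
  have := Real.rpow_pos_of_pos (by positivity : 0 < 2 * w) (a - 1)
  field_simp

/-- The convolution of the harmonic function `‖θ‖ ^ (-2 a)`, `a = d / 2 - 1`, with a normal
density. -/
lemma lintegral_gaussDens_mul_harmonic [Nontrivial E] {a w : ℝ} (ha : 0 < a)
    (hda : (Module.finrank ℝ E : ℝ) / 2 = a + 1) (hw : 0 < w) (y : E) :
    ENNReal.ofReal (Real.Gamma a) *
        ∫⁻ θ, gaussDens w (y - θ) * ENNReal.ofReal ((‖θ‖ ^ 2) ^ (-a))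
      = ENNReal.ofReal ((2 * w) ^ (-a)) *
        ∫⁻ t in Set.Ioo (0 : ℝ) 1, ENNReal.ofReal (t ^ (a - 1) *
          Real.exp (-(t * ‖y‖ ^ 2) / (2 * w))) := by
  rw [← setLIntegral_mixing_eq hw, ← lintegral_const_mul _ (by fun_prop)]
  -- Off the origin the harmonic function is a mixture of Gaussian kernels: `Γ(a) ‖θ‖^(-2a) = ∫
  -- l^(a-1) e^(-l ‖θ‖²) dl`.
  have h1 : ∀ᵐ θ : E, ENNReal.ofReal (Real.Gamma a) * (gaussDens w (y - θ) *
      ENNReal.ofReal ((‖θ‖ ^ 2) ^ (-a)))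
      = ∫⁻ l in Set.Ioi (0 : ℝ), ENNReal.ofReal (l ^ (a - 1)) *
        (gaussDens w (y - θ) * ENNReal.ofReal (Real.exp (-(‖θ‖ ^ 2 * l)))) := by
    filter_upwards [ae_ne_zero (E := E)] with θ hθ
    have hS : 0 < ‖θ‖ ^ 2 := by have := norm_pos_iff.2 hθ; positivity
    have hg := lintegral_gamma ha hS
    have e1 : (1 / ‖θ‖ ^ 2) ^ a * Real.Gamma a = Real.Gamma a * (‖θ‖ ^ 2) ^ (-a) := by
      rw [one_div, Real.inv_rpow hS.le, Real.rpow_neg hS.le, mul_comm]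
    have hG := Real.Gamma_pos_of_pos ha
    rw [e1, ENNReal.ofReal_mul hG.le] at hg
    rw [mul_left_comm, ← hg, ← lintegral_const_mul _ (by fun_prop)]
    refine setLIntegral_congr_fun measurableSet_Ioi fun l hl => ?_
    have : (0 : ℝ) < l := hl
    rw [ENNReal.ofReal_mul (by positivity), mul_left_comm]
  rw [lintegral_congr_ae h1, lintegral_lintegral_swap (by fun_prop)]
  refine setLIntegral_congr_fun measurableSet_Ioi fun l hl => ?_
  rw [lintegral_const_mul _ (by fun_prop), lintegral_gaussDens_mul_exp_neg hw (le_of_lt hl),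
    neg_div, hda]

end Harmonic

lemma setLIntegral_inv_gamma {q r : ℝ} (hq : 0 < q) (hr : 0 < r) :
    ∫⁻ w in Set.Ioi (0 : ℝ), ENNReal.ofReal w⁻¹ *
        ENNReal.ofReal (w ^ (-q) * Real.exp (-(r / w)))
      = ENNReal.ofReal ((1 / r) ^ q * Real.Gamma q) := by
  rw [setLIntegral_Ioi_inv (fun w => ENNReal.ofReal (w ^ (-q) * Real.exp (-(r / w)))),
    ← lintegral_gamma hq hr]
  refine setLIntegral_congr_fun measurableSet_Ioi fun w hw => ?_
  have hw' : (0 : ℝ) < w := hw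
  rw [← ENNReal.ofReal_mul (by positivity)]
  congr 1
  rw [Real.inv_rpow hw'.le, Real.rpow_neg hw'.le, inv_inv, div_inv_eq_mul, Real.rpow_sub_one hw'.ne']
  field_simp

/-- The posterior moments of `w = σ² τ²` up to a factor. -/
lemma setLIntegral_posterior {a b q S U : ℝ} (ha : 0 < a) (hb : 0 < b) (hq : 0 ≤ q)
    (hS : 0 < S) (hU : 0 ≤ U) :
    ∫⁻ w in Set.Ioi (0 : ℝ), ENNReal.ofReal w⁻¹ * (ENNReal.ofReal (w ^ (-q)) *
        (ENNReal.ofReal ((2 * w) ^ (-a)) * (∫⁻ t in Set.Ioo (0 : ℝ) 1,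
          ENNReal.ofReal (t ^ (a - 1) * Real.exp (-(t * U) / (2 * w)))) *
          ENNReal.ofReal ((2 * Real.pi * w) ^ (-b) * Real.exp (-S / (2 * w)))))
      = ENNReal.ofReal (2 ^ (-a) * (2 * Real.pi) ^ (-b)) * ENNReal.ofReal
        (Real.Gamma (a + b + q) * (2 / S) ^ (a + b + q) * eulerInt a (a + b + q) (U / S)) := by
  have hc : 0 ≤ U / S := by positivity
  have hk : 0 < a + b + q := by positivity
  have hG := Real.Gamma_pos_of_pos hk
  -- With the integral over `t` outside, the powers of `w` merge into one and the exponentials into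
  -- one of rate `(S + t U)/2`, leaving an inverse gamma integral.
  have h1 : ∀ w ∈ Set.Ioi (0 : ℝ), ENNReal.ofReal w⁻¹ * (ENNReal.ofReal (w ^ (-q)) *
        (ENNReal.ofReal ((2 * w) ^ (-a)) * (∫⁻ t in Set.Ioo (0 : ℝ) 1,
          ENNReal.ofReal (t ^ (a - 1) * Real.exp (-(t * U) / (2 * w)))) *
          ENNReal.ofReal ((2 * Real.pi * w) ^ (-b) * Real.exp (-S / (2 * w)))))
      = ∫⁻ t in Set.Ioo (0 : ℝ) 1, ENNReal.ofReal (2 ^ (-a) * (2 * Real.pi) ^ (-b) * t ^ (a - 1)) *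
        (ENNReal.ofReal w⁻¹ * ENNReal.ofReal (w ^ (-(a + b + q)) *
          Real.exp (-((S + t * U) / 2 / w)))) := by
    intro w hw
    have hw' : (0 : ℝ) < w := hw
    rw [mul_right_comm, ← mul_assoc, ← mul_assoc, ← lintegral_const_mul _ (by fun_prop)]
    refine setLIntegral_congr_fun measurableSet_Ioo fun t ht => ?_
    have ht0 := ht.1
    rw [← ENNReal.ofReal_mul (by positivity), ← ENNReal.ofReal_mul (by positivity),
      ← ENNReal.ofReal_mul (by positivity), ← ENNReal.ofReal_mul (by positivity),
      ← ENNReal.ofReal_mul (by positivity), ← ENNReal.ofReal_mul (by positivity)]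
    congr 1
    have e1 : Real.exp (-((S + t * U) / 2 / w))
        = Real.exp (-S / (2 * w)) * Real.exp (-(t * U) / (2 * w)) := by
      rw [← Real.exp_add]; congr 1; field_simp; ring
    have e2 : w ^ (-(a + b + q)) = w ^ (-a) * w ^ (-b) * w ^ (-q) := by
      rw [← Real.rpow_add hw', ← Real.rpow_add hw']; congr 1; ring
    rw [e1, e2, Real.mul_rpow two_pos.le hw'.le, Real.mul_rpow (by positivity) hw'.le]
    ring
  rw [setLIntegral_congr_fun measurableSet_Ioi h1, lintegral_lintegral_swap (by fun_prop)]
  have h2 : ∀ t ∈ Set.Ioo (0 : ℝ) 1, ∫⁻ w in Set.Ioi (0 : ℝ),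
      ENNReal.ofReal (2 ^ (-a) * (2 * Real.pi) ^ (-b) * t ^ (a - 1)) *
        (ENNReal.ofReal w⁻¹ * ENNReal.ofReal (w ^ (-(a + b + q)) *
          Real.exp (-((S + t * U) / 2 / w))))
      = ENNReal.ofReal (2 ^ (-a) * (2 * Real.pi) ^ (-b)) * ENNReal.ofReal
        (Real.Gamma (a + b + q) * (2 / S) ^ (a + b + q) *
          (t ^ (a - 1) * (1 + U / S * t) ^ (-(a + b + q)))) := by
    intro t ht
    have ht0 := ht.1
    rw [lintegral_const_mul _ (by fun_prop), setLIntegral_inv_gamma hk (by positivity),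
      ← ENNReal.ofReal_mul (by positivity), ← ENNReal.ofReal_mul (by positivity)]
    congr 1
    have e1 : 1 / ((S + t * U) / 2) = 2 / S * (1 + U / S * t)⁻¹ := by field_simp
    rw [e1, Real.mul_rpow (x := 2 / S) (by positivity) (by positivity), Real.inv_rpow (by positivity),
      Real.rpow_neg (x := 1 + U / S * t) (by positivity)]
    ring
  rw [setLIntegral_congr_fun measurableSet_Ioo h2, lintegral_const_mul _ (by fun_prop)]
  congr 1
  have hint := intervalIntegrable_euler ha hc (-(a + b + q))
  rw [intervalIntegrable_iff_integrableOn_Ioo_of_le zero_le_one] at hint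
  rw [← ofReal_integral_eq_lintegral_ofReal (hint.const_mul _), integral_const_mul, eulerInt,
    intervalIntegral.integral_of_le zero_le_one, integral_Ioc_eq_integral_Ioo]
  filter_upwards [ae_restrict_mem measurableSet_Ioo] with t ht
  have ht0 := ht.1
  simp only [Pi.zero_apply]
  positivity

/-- Uniqueness of Haar measure. The Jacobian `k` need not be computed because it cancels in the
posterior. -/
lemma exists_lintegral_comp_linearEquiv {p : ℕ}
    (A : (Fin p → ℝ) ≃ₗ[ℝ] EuclideanSpace ℝ (Fin p)) :
    ∃ k : ℝ≥0∞, k ≠ 0 ∧ k ≠ ∞ ∧ ∀ h : EuclideanSpace ℝ (Fin p) → ℝ≥0∞, Measurable h →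
      ∫⁻ β, h (A β) = k * ∫⁻ θ, h θ := by
  let A' := A.toContinuousLinearEquiv
  have hA : ∀ β, A' β = A β := fun β => rfl
  have hH : (Measure.map A' volume : Measure (EuclideanSpace ℝ (Fin p))).IsAddHaarMeasure :=
    A'.isAddHaarMeasure_map volume
  have h1 := Measure.isAddLeftInvariant_eq_smul
    (Measure.map A' volume : Measure (EuclideanSpace ℝ (Fin p))) volume
  set k := Measure.addHaarScalarFactor (Measure.map A' volume) volume with hk
  refine ⟨k, ?_, ENNReal.coe_ne_top, fun h hh => ?_⟩
  · intro hk0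
    rw [ENNReal.coe_eq_zero] at hk0
    rw [hk0, zero_smul] at h1
    have h2 := isOpen_univ.measure_ne_zero (Measure.map A' volume) Set.univ_nonempty
    rw [h1] at h2
    exact h2 rfl
  · have h2 : ∫⁻ β, h (A β) = ∫⁻ θ, h θ ∂(Measure.map A' volume) := by
      rw [lintegral_map hh A'.continuous.measurable]; rfl
    rw [h2, h1, lintegral_smul_measure]; rfl

lemma lintegral_gaussDens_sub_mul {w r : ℝ} (hw : 0 < w) (hr : 0 < r) (x : ℝ) :
    ∫⁻ α : ℝ, gaussDens w (x - r * α) = ENNReal.ofReal r⁻¹ := by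
  have h := lintegral_comp_smul_haar (E := ℝ) hr (h := fun z => gaussDens w (z - x)) (by fun_prop)
  rw [lintegral_gaussDens_sub hw, mul_one] at h
  simp only [Module.finrank_self, pow_one, smul_eq_mul] at h
  rw [← h]
  exact lintegral_congr fun α => gaussDens_sub_comm _ _ _

/-- For each `v`, integrate out `α` and `β`, then substitute `w = s v`: the remaining integral no
longer involves `v`, which appears only as `v^q`. The constant `K` is the same for both values of
`q`, so their ratio is free of `G`. -/
lemma CanonicalCoords.lintegral_jointAt {n p : ℕ} {X : Matrix (Fin n) (Fin p) ℝ}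
    (c : CanonicalCoords X) (hp : 3 ≤ p) (hn : p + 1 < n) {G : Measure ℝ} (hG : IsMixingLaw G) :
    ∃ K : ℝ≥0∞, K ≠ 0 ∧ K ≠ ∞ ∧ ∀ (y : Fin n → ℝ), 0 < ‖(c.e y).2.2‖ ^ 2 →
      ∀ q : ℕ, q ≤ 1 → ∫⁻ θ, ENNReal.ofReal (θ.2.2⁻¹ ^ q) ∂(jointAt X G (harmonicPrior X) y)
        = K * ENNReal.ofReal (Real.Gamma (((n : ℝ) - 3) / 2 + q) *
          (2 / ‖(c.e y).2.2‖ ^ 2) ^ (((n : ℝ) - 3) / 2 + q) *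
          eulerInt ((p : ℝ) / 2 - 1) (((n : ℝ) - 3) / 2 + q)
            (‖(c.e y).2.1‖ ^ 2 / ‖(c.e y).2.2‖ ^ 2)) := by
  have := hG.prob
  have hp' : (3 : ℝ) ≤ p := by exact_mod_cast hp
  have hn' : (p : ℝ) + 1 < n := by exact_mod_cast hn
  have hm : ((n - p - 1 : ℕ) : ℝ) = n - p - 1 := by
    rw [Nat.sub_sub, Nat.cast_sub hn.le]; push_cast; ring
  have hn0 : (0 : ℝ) < n := by linarith
  have hsq : 0 < √(n : ℝ) := Real.sqrt_pos.2 hn0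
  have : NeZero p := ⟨by omega⟩
  set a : ℝ := (p : ℝ) / 2 - 1 with ha_def
  set b : ℝ := ((n : ℝ) - p - 1) / 2 with hb_def
  have ha : 0 < a := by rw [ha_def]; linarith
  have hb : 0 < b := by rw [hb_def]; linarith
  have hab : ((n : ℝ) - 3) / 2 = a + b := by rw [ha_def, hb_def]; ring
  have hGa := Real.Gamma_pos_of_pos ha
  obtain ⟨k, hk0, hk1, hk⟩ := exists_lintegral_comp_linearEquiv c.A
  have hGa0 : ENNReal.ofReal (Real.Gamma a) ≠ 0 := by simpa using hGa
  refine ⟨ENNReal.ofReal (√n)⁻¹ * k * (ENNReal.ofReal (Real.Gamma a))⁻¹ *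
    ENNReal.ofReal (2 ^ (-a) * (2 * Real.pi) ^ (-b)), ?_, ?_, ?_⟩
  · refine mul_ne_zero (mul_ne_zero (mul_ne_zero ?_ hk0) (by simp)) ?_
    · rw [Ne, ENNReal.ofReal_eq_zero, not_le]; positivity
    · rw [Ne, ENNReal.ofReal_eq_zero, not_le]; positivity
  · exact ENNReal.mul_ne_top (ENNReal.mul_ne_top (ENNReal.mul_ne_top ENNReal.ofReal_ne_top hk1)
      (ENNReal.inv_ne_top.2 hGa0)) ENNReal.ofReal_ne_top
  intro y hS q hq1
  set S := ‖(c.e y).2.2‖ ^ 2 with hS_def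
  set U := ‖(c.e y).2.1‖ ^ 2 with hU_def
  have hU : 0 ≤ U := by positivity
  have hcA : Measurable c.A := c.A.toContinuousLinearEquiv.continuous.measurable
  -- the harmonic integral
  let H : ℝ → ℝ≥0∞ := fun w => ∫⁻ θ, gaussDens w ((c.e y).2.1 - θ) *
    ENNReal.ofReal ((‖θ‖ ^ 2) ^ (-a))
  have hH : Measurable H := Measurable.lintegral_prod_right'
    (f := fun r : ℝ × EuclideanSpace ℝ (Fin p) => gaussDens r.1 ((c.e y).2.1 - r.2) *
      ENNReal.ofReal ((‖r.2‖ ^ 2) ^ (-a))) (by fun_prop)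
  -- the integrand of the marginal
  let D : ℝ × ℝ × (Fin p → ℝ) × ℝ → ℝ≥0∞ := fun r =>
    gaussDens (r.2.2.2 * r.1) ((c.e y).1 - √n * r.2.1) *
      (gaussDens (r.2.2.2 * r.1) ((c.e y).2.1 - c.A r.2.2.1) *
        gaussDens (r.2.2.2 * r.1) (c.e y).2.2) *
      ENNReal.ofReal ((‖c.A r.2.2.1‖ ^ 2) ^ (-a)) * ENNReal.ofReal (r.2.2.2⁻¹ ^ (q + 1))
  have hD : Measurable D := by fun_prop
  have hset : {θ : ℝ × (Fin p → ℝ) × ℝ | 0 < θ.2.2}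
      = Set.univ ×ˢ (Set.univ ×ˢ Set.Ioi (0 : ℝ)) := by
    ext θ; simp
  have hsetm : MeasurableSet {θ : ℝ × (Fin p → ℝ) × ℝ | 0 < θ.2.2} := by
    rw [hset]; exact MeasurableSet.univ.prod (MeasurableSet.univ.prod measurableSet_Ioi)
  have hdens : ∀ᵐ θ : ℝ × (Fin p → ℝ) × ℝ ∂(volume.restrict {θ | 0 < θ.2.2}),
      samplingDensity X G θ.1 θ.2.1 θ.2.2 y *
        ENNReal.ofReal (harmonicPrior X θ.1 θ.2.1 θ.2.2) * ENNReal.ofReal (θ.2.2⁻¹ ^ q)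
      = ∫⁻ v, D (v, θ) ∂G := by
    filter_upwards [ae_restrict_mem hsetm] with θ hθ
    have hs : 0 < θ.2.2 := hθ
    rw [c.samplingDensity_eq hn hG _ _ hs, harmonicPrior, c.quadratic_form, mul_assoc,
      ← lintegral_mul_const _ (by fun_prop)]
    refine lintegral_congr fun v => ?_
    have e1 : -((p : ℝ) - 2) / 2 = -a := by rw [ha_def]; ring
    -- One of the `q + 1` factors `1/s` comes from the prior, the others from the moment being
    -- computed.
    have e2 : ENNReal.ofReal (θ.2.2⁻¹ ^ (q + 1))
        = ENNReal.ofReal θ.2.2⁻¹ * ENNReal.ofReal (θ.2.2⁻¹ ^ q) := by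
      rw [← ENNReal.ofReal_mul (by positivity), pow_succ']
    simp only [D]
    rw [e1, e2, ENNReal.ofReal_mul (by positivity)]
    ring
  have hdensm : Measurable (fun θ : ℝ × (Fin p → ℝ) × ℝ => samplingDensity X G θ.1 θ.2.1 θ.2.2 y *
        ENNReal.ofReal (harmonicPrior X θ.1 θ.2.1 θ.2.2)) := by
    unfold samplingDensity mixtureDensity harmonicPrior
    simp only [c.sqNorm_residual, c.quadratic_form]
    refine Measurable.mul (Measurable.mul (by fun_prop) ?_) (by fun_prop)
    exact Measurable.lintegral_prod_right' (f := fun r : (ℝ × (Fin p → ℝ) × ℝ) × ℝ =>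
      ENNReal.ofReal ((2 * Real.pi * r.2) ^ (-(n : ℝ) / 2) * Real.exp (-((((c.e y).1 -
        √n * r.1.1) ^ 2 + ‖(c.e y).2.1 - c.A r.1.2.1‖ ^ 2 + ‖(c.e y).2.2‖ ^ 2) / r.1.2.2) /
          (2 * r.2)))) (by fun_prop)
  have step1 : ∫⁻ θ, ENNReal.ofReal (θ.2.2⁻¹ ^ q) ∂(jointAt X G (harmonicPrior X) y)
      = ∫⁻ v, (∫⁻ s in Set.Ioi (0 : ℝ), ∫⁻ α, ∫⁻ β : Fin p → ℝ, D (v, α, β, s)) ∂G := by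
    rw [jointAt, lintegral_withDensity_eq_lintegral_mul _ hdensm (by fun_prop)]
    simp only [Pi.mul_apply]
    rw [lintegral_congr_ae hdens, lintegral_lintegral_swap (by fun_prop)]
    refine lintegral_congr fun v => ?_
    rw [hset, Measure.volume_eq_prod, ← Measure.prod_restrict, Measure.restrict_univ,
      lintegral_prod _ (by fun_prop)]
    have e2 : ∀ α : ℝ, ∫⁻ r : (Fin p → ℝ) × ℝ, D (v, α, r)
        ∂(volume.restrict (Set.univ ×ˢ Set.Ioi (0 : ℝ)))
        = ∫⁻ s in Set.Ioi (0 : ℝ), ∫⁻ β : Fin p → ℝ, D (v, α, β, s) := by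
      intro α
      rw [Measure.volume_eq_prod, ← Measure.prod_restrict, Measure.restrict_univ,
        lintegral_prod_symm _ (by fun_prop)]
    simp only [e2]
    rw [lintegral_lintegral_swap]
    refine Measurable.aemeasurable ?_
    exact Measurable.lintegral_prod_right' (f := fun r : (ℝ × ℝ) × (Fin p → ℝ) =>
      D (v, r.1.1, r.2, r.1.2)) (by fun_prop)
  have step2 : ∀ v : ℝ, 0 < v → ∫⁻ s in Set.Ioi (0 : ℝ), ∫⁻ α, ∫⁻ β : Fin p → ℝ, D (v, α, β, s)
      = ENNReal.ofReal (√n)⁻¹ * k * ∫⁻ s in Set.Ioi (0 : ℝ), H (s * v) *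
        gaussDens (s * v) (c.e y).2.2 * ENNReal.ofReal (s⁻¹ ^ (q + 1)) := by
    intro v hv
    rw [← lintegral_const_mul _ (by fun_prop)]
    refine setLIntegral_congr_fun measurableSet_Ioi fun s hs => ?_
    have hw : 0 < s * v := mul_pos hs hv
    have e3 : ∀ α : ℝ, ∫⁻ β : Fin p → ℝ, D (v, α, β, s) = gaussDens (s * v) ((c.e y).1 - √n * α) *
        (k * H (s * v) * gaussDens (s * v) (c.e y).2.2 * ENNReal.ofReal (s⁻¹ ^ (q + 1))) := by
      intro α
      have e4 : ∀ β, D (v, α, β, s) = gaussDens (s * v) ((c.e y).1 - √n * α) *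
          (gaussDens (s * v) (c.e y).2.2 * ENNReal.ofReal (s⁻¹ ^ (q + 1))) *
          (gaussDens (s * v) ((c.e y).2.1 - c.A β) * ENNReal.ofReal ((‖c.A β‖ ^ 2) ^ (-a))) := by
        intro β; simp only [D]; ring
      simp only [e4]
      rw [lintegral_const_mul _ (by fun_prop), hk (fun θ => gaussDens (s * v) ((c.e y).2.1 - θ) *
        ENNReal.ofReal ((‖θ‖ ^ 2) ^ (-a))) (by fun_prop)]
      simp only [H]; ring
    simp only [e3]
    rw [lintegral_mul_const _ (by fun_prop), lintegral_gaussDens_sub_mul hw hsq]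
    ring
  have step3 : ∀ v : ℝ, 0 < v → ∫⁻ s in Set.Ioi (0 : ℝ), H (s * v) *
        gaussDens (s * v) (c.e y).2.2 * ENNReal.ofReal (s⁻¹ ^ (q + 1))
      = ENNReal.ofReal (v ^ q) * ∫⁻ w in Set.Ioi (0 : ℝ), H w * gaussDens w (c.e y).2.2 *
        ENNReal.ofReal (w⁻¹ ^ (q + 1)) := by
    intro v hv
    rw [setLIntegral_Ioi_scale hv (fun w => H w * gaussDens w (c.e y).2.2 *
        ENNReal.ofReal (w⁻¹ ^ (q + 1))), ← lintegral_const_mul _ (by fun_prop)]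
    refine setLIntegral_congr_fun measurableSet_Ioi fun s hs => ?_
    have hs' : (0 : ℝ) < s := hs
    have e5 : ENNReal.ofReal (s⁻¹ ^ (q + 1)) = ENNReal.ofReal (v ^ q) * (ENNReal.ofReal v *
        ENNReal.ofReal ((v * s)⁻¹ ^ (q + 1))) := by
      rw [← ENNReal.ofReal_mul (by positivity), ← ENNReal.ofReal_mul (by positivity)]
      congr 1
      rw [mul_inv, mul_pow, pow_succ v⁻¹, inv_pow v]
      field_simp
    rw [e5, mul_comm s v]; ring
  -- Total mass for `q = 0`, the normalization of the mean for `q = 1`; this restricts the lemma to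
  -- `q ≤ 1`.
  have hvq : ∫⁻ v, ENNReal.ofReal (v ^ q) ∂G = 1 := by
    interval_cases q
    · simp
    · simpa using hG.mean_one
  have step4 : ∫⁻ w in Set.Ioi (0 : ℝ), H w * gaussDens w (c.e y).2.2 *
        ENNReal.ofReal (w⁻¹ ^ (q + 1))
      = (ENNReal.ofReal (Real.Gamma a))⁻¹ * (ENNReal.ofReal (2 ^ (-a) * (2 * Real.pi) ^ (-b)) *
        ENNReal.ofReal (Real.Gamma (a + b + q) * (2 / S) ^ (a + b + q) *
          eulerInt a (a + b + q) (U / S))) := by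
    rw [← setLIntegral_posterior ha hb (Nat.cast_nonneg q) hS hU,
      ← lintegral_const_mul' _ _ (ENNReal.inv_ne_top.2 hGa0)]
    refine setLIntegral_congr_fun measurableSet_Ioi fun w hw => ?_
    have hw' : (0 : ℝ) < w := hw
    have e6 := lintegral_gaussDens_mul_harmonic ha (by simp [ha_def]) hw' (c.e y).2.1
    rw [← e6]
    have e7 : gaussDens w (c.e y).2.2
        = ENNReal.ofReal ((2 * Real.pi * w) ^ (-b) * Real.exp (-S / (2 * w))) := by
      rw [gaussDens]
      simp only [finrank_euclideanSpace, Fintype.card_fin, hm]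
      rw [← hS_def, show -((n : ℝ) - p - 1) / 2 = -b by rw [hb_def]; ring]
    have e8 : ENNReal.ofReal (w⁻¹ ^ (q + 1))
        = ENNReal.ofReal w⁻¹ * ENNReal.ofReal (w ^ (-(q : ℝ))) := by
      rw [← ENNReal.ofReal_mul (by positivity), Real.rpow_neg hw'.le, Real.rpow_natCast,
        pow_succ', inv_pow]
    rw [← e7, e8]
    have e9 : (ENNReal.ofReal (Real.Gamma a))⁻¹ * ENNReal.ofReal (Real.Gamma a) = 1 :=
      ENNReal.inv_mul_cancel hGa0 ENNReal.ofReal_ne_top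
    change H w * _ * _ = _ * (_ * (_ * (_ * H w * _)))
    calc H w * gaussDens w (c.e y).2.2 * (ENNReal.ofReal w⁻¹ * ENNReal.ofReal (w ^ (-(q : ℝ))))
        = 1 * (H w * gaussDens w (c.e y).2.2 *
          (ENNReal.ofReal w⁻¹ * ENNReal.ofReal (w ^ (-(q : ℝ))))) := (one_mul _).symm
      _ = _ := by rw [← e9]; ring
  rw [step1]
  have step5 : ∀ᵐ v ∂G, ∫⁻ s in Set.Ioi (0 : ℝ), ∫⁻ α, ∫⁻ β : Fin p → ℝ, D (v, α, β, s)
      = ENNReal.ofReal (√n)⁻¹ * k * (ENNReal.ofReal (v ^ q) *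
        ∫⁻ w in Set.Ioi (0 : ℝ), H w * gaussDens w (c.e y).2.2 *
          ENNReal.ofReal (w⁻¹ ^ (q + 1))) := by
    filter_upwards [hG.pos] with v hv
    rw [step2 v hv, step3 v hv]
  rw [lintegral_congr_ae step5, lintegral_const_mul _ (by fun_prop),
    lintegral_mul_const _ (by fun_prop), hvq, one_mul, step4, hab]
  ring

/-! ### Stein's loss and Bayes estimates -/

lemma steinLoss_nonneg {d s : ℝ} (hd : 0 < d) (hs : 0 < s) : 0 ≤ steinLoss d s := by
  have := Real.log_le_sub_one_of_pos (div_pos hd hs)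
  rw [steinLoss]; linarith

/-- The terms in `log s` cancel, so expected loss differences need only the mean of `1/s`, even when
the expected losses are infinite. -/
lemma steinLoss_sub {d d' s : ℝ} (hd : 0 < d) (hd' : 0 < d') (hs : 0 < s) :
    steinLoss d s - steinLoss d' s = (d - d') * s⁻¹ - Real.log (d / d') := by
  rw [steinLoss, steinLoss, Real.log_div hd.ne' hs.ne', Real.log_div hd'.ne' hs.ne',
    Real.log_div hd.ne' hd'.ne']
  ring

lemma integrable_of_lintegral_ofReal_ne_top {Ω : Type*} [MeasurableSpace Ω] {μ : Measure Ω}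
    {f : Ω → ℝ} (hf : AEStronglyMeasurable f μ) (h0 : 0 ≤ᵐ[μ] f)
    (h : ∫⁻ x, ENNReal.ofReal (f x) ∂μ ≠ ∞) : Integrable f μ :=
  ⟨hf, (hasFiniteIntegral_iff_ofReal h0).2 h.lt_top⟩

/-- Trivial if `g` has infinite integral; otherwise `f = g - (g - f)` is integrable as well. -/
lemma lintegral_ofReal_le_of_integral_sub_nonneg {Ω : Type*} [MeasurableSpace Ω] {μ : Measure Ω}
    {f g : Ω → ℝ} (hg : AEStronglyMeasurable g μ) (hf0 : 0 ≤ᵐ[μ] f) (hg0 : 0 ≤ᵐ[μ] g)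
    (hint : Integrable (fun x => g x - f x) μ) (hle : 0 ≤ ∫ x, (g x - f x) ∂μ) :
    ∫⁻ x, ENNReal.ofReal (f x) ∂μ ≤ ∫⁻ x, ENNReal.ofReal (g x) ∂μ := by
  by_cases htop : ∫⁻ x, ENNReal.ofReal (g x) ∂μ = ∞
  · rw [htop]; exact le_top
  have hgi := integrable_of_lintegral_ofReal_ne_top hg hg0 htop
  have hfi : Integrable f μ := (hgi.sub hint).congr (ae_of_all _ fun x => by simp)
  rw [integral_sub hgi hfi] at hle
  rw [← ofReal_integral_eq_lintegral_ofReal hgi hg0, ← ofReal_integral_eq_lintegral_ofReal hfi hf0]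
  exact ENNReal.ofReal_le_ofReal (by linarith)

lemma lintegral_ofReal_lt_of_integral_sub_pos {Ω : Type*} [MeasurableSpace Ω] {μ : Measure Ω}
    {f g : Ω → ℝ} (hf0 : 0 ≤ᵐ[μ] f) (hg0 : 0 ≤ᵐ[μ] g) (hgi : Integrable g μ)
    (hint : Integrable (fun x => g x - f x) μ) (hlt : 0 < ∫ x, (g x - f x) ∂μ) :
    ∫⁻ x, ENNReal.ofReal (f x) ∂μ < ∫⁻ x, ENNReal.ofReal (g x) ∂μ := by
  have hfi : Integrable f μ := (hgi.sub hint).congr (ae_of_all _ fun x => by simp)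
  rw [integral_sub hgi hfi] at hlt
  have := integral_nonneg_of_ae hf0
  rw [← ofReal_integral_eq_lintegral_ofReal hgi hg0, ← ofReal_integral_eq_lintegral_ofReal hfi hf0]
  exact (ENNReal.ofReal_lt_ofReal_iff (by linarith)).2 (by linarith)

/-- A posterior under which `1 / σ²` has expectation `1 / δ` has Bayes estimate `δ`. -/
lemma bayes_of_integral_inv {Ω : Type*} [MeasurableSpace Ω] {π : Measure Ω}
    [IsProbabilityMeasure π] {σ : Ω → ℝ} (hσ : Measurable σ) (hpos : ∀ᵐ θ ∂π, 0 < σ θ)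
    {δ : ℝ} (hδ : 0 < δ) (hinv : ∫⁻ θ, ENNReal.ofReal (σ θ)⁻¹ ∂π = ENNReal.ofReal δ⁻¹) :
    (∀ d : ℝ, ∫⁻ θ, steinLossE δ (σ θ) ∂π ≤ ∫⁻ θ, steinLossE d (σ θ) ∂π) ∧
    (∀ d : ℝ, 0 < d → d ≠ δ →
      Integrable (fun θ => steinLoss d (σ θ) - steinLoss δ (σ θ)) π ∧
      0 < ∫ θ, (steinLoss d (σ θ) - steinLoss δ (σ θ)) ∂π) := by
  have h0 : 0 ≤ᵐ[π] fun θ => (σ θ)⁻¹ := by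
    filter_upwards [hpos] with θ hθ using (inv_pos.2 hθ).le
  have hi : Integrable (fun θ => (σ θ)⁻¹) π :=
    integrable_of_lintegral_ofReal_ne_top (by fun_prop) h0 (by rw [hinv]; simp)
  have hv : ∫ θ, (σ θ)⁻¹ ∂π = δ⁻¹ := by
    rw [integral_eq_lintegral_of_nonneg_ae h0 (by fun_prop), hinv,
      ENNReal.toReal_ofReal (by positivity)]
  have key : ∀ d : ℝ, 0 < d → d ≠ δ →
      Integrable (fun θ => steinLoss d (σ θ) - steinLoss δ (σ θ)) π ∧
      0 < ∫ θ, (steinLoss d (σ θ) - steinLoss δ (σ θ)) ∂π := by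
    intro d hd hne
    have hc : (fun θ => steinLoss d (σ θ) - steinLoss δ (σ θ))
        =ᵐ[π] fun θ => (d - δ) * (σ θ)⁻¹ - Real.log (d / δ) := by
      filter_upwards [hpos] with θ hθ using steinLoss_sub hd hδ hθ
    refine ⟨((hi.const_mul _).sub (integrable_const _)).congr hc.symm, ?_⟩
    rw [integral_congr_ae hc, integral_sub (hi.const_mul _) (integrable_const _),
      integral_const_mul, hv]
    -- Strictness of `log x < x - 1` away from `x = 1` yields uniqueness of the minimizer.
    have h1 := Real.log_lt_sub_one_of_pos (div_pos hd hδ) (by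
      rw [Ne, div_eq_one_iff_eq hδ.ne']; exact hne)
    have h2 : (d - δ) * δ⁻¹ = d / δ - 1 := by field_simp
    simp only [integral_const, probReal_univ, smul_eq_mul, one_mul]
    linarith
  refine ⟨fun d => ?_, key⟩
  rcases eq_or_ne d δ with rfl | hne
  · exact le_rfl
  by_cases hd : 0 < d
  · simp only [steinLossE, if_pos hd, if_pos hδ]
    obtain ⟨h1, h2⟩ := key d hd hne
    refine lintegral_ofReal_le_of_integral_sub_nonneg ?_ ?_ ?_ h1 h2.le
    · unfold steinLoss
      refine Measurable.aestronglyMeasurable ?_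
      fun_prop
    · filter_upwards [hpos] with θ hθ using steinLoss_nonneg hδ hθ
    · filter_upwards [hpos] with θ hθ using steinLoss_nonneg hd hθ
  · simp [steinLossE, if_neg hd]

namespace CanonicalCoords

variable {n p : ℕ} {X : Matrix (Fin n) (Fin p) ℝ}

lemma deltaU_eq (c : CanonicalCoords X) (hn : p + 1 < n) (y : Fin n → ℝ) :
    deltaU X y = ‖(c.e y).2.2‖ ^ 2 / ((n : ℝ) - p - 1) := by
  rw [deltaU, c.RSS_eq (by omega)]

lemma deltaH_eq (c : CanonicalCoords X) (hp : 3 ≤ p) (hn : p + 1 < n) (y : Fin n → ℝ)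
    (hS : 0 < ‖(c.e y).2.2‖ ^ 2) :
    deltaH X y = shrink ((p : ℝ) / 2 - 1) (((n : ℝ) - p - 1) / 2)
      (‖(c.e y).2.1‖ ^ 2 / ‖(c.e y).2.2‖ ^ 2) * (‖(c.e y).2.2‖ ^ 2 / ((n : ℝ) - p - 1)) := by
  rw [deltaH, c.RSS_eq (by omega), c.Rsq_eq (by omega), ← phiH_eq_shrink hp hn (by positivity)]
  congr 2
  rw [one_add_div hS.ne', div_div_div_cancel_right₀ hS.ne', add_comm]

lemma ae_residual_pos (c : CanonicalCoords X) (hn : p + 1 < n) :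
    ∀ᵐ y : Fin n → ℝ, 0 < ‖(c.e y).2.2‖ ^ 2 := by
  have : NeZero (n - p - 1) := ⟨by omega⟩
  have h1 : ∀ᵐ z : EuclideanSpace ℝ (Fin (n - p - 1)), 0 < ‖z‖ ^ 2 := by
    filter_upwards [ae_ne_zero (E := EuclideanSpace ℝ (Fin (n - p - 1)))] with z hz
    have := norm_pos_iff.2 hz; positivity
  have h2 : ∀ᵐ q : ℝ × EuclideanSpace ℝ (Fin p) × EuclideanSpace ℝ (Fin (n - p - 1)),
      0 < ‖q.2.2‖ ^ 2 :=
    Measure.quasiMeasurePreserving_snd.ae (Measure.quasiMeasurePreserving_snd.ae h1)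
  exact c.measurePreserving.quasiMeasurePreserving.ae h2

end CanonicalCoords

/-- The posterior mean of `1/σ²` is `g 1 / g 0`. The recursion of the gamma function supplies `a +
b`, the powers of `2/S` one factor `2/S`, and `mul_eulerInt_div` the rest: `(2/S)(b + 1/N(c))`, the
reciprocal of the estimator. -/
lemma isGeneralizedBayes_deltaH {n p : ℕ} {X : Matrix (Fin n) (Fin p) ℝ}
    (c : CanonicalCoords X) (hp : 3 ≤ p) (hn : p + 1 < n) {G : Measure ℝ} (hG : IsMixingLaw G) :
    IsGeneralizedBayes X G (harmonicPrior X) (deltaH X) := by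
  have hp' : (3 : ℝ) ≤ p := by exact_mod_cast hp
  have hn' : (p : ℝ) + 1 < n := by exact_mod_cast hn
  obtain ⟨K, hK0, hK1, hK⟩ := c.lintegral_jointAt hp hn hG
  filter_upwards [c.ae_residual_pos hn] with y hS
  set S := ‖(c.e y).2.2‖ ^ 2 with hS_def
  set U := ‖(c.e y).2.1‖ ^ 2 with hU_def
  set a : ℝ := (p : ℝ) / 2 - 1 with ha_def
  set b : ℝ := ((n : ℝ) - p - 1) / 2 with hb_def
  have ha : 0 < a := by rw [ha_def]; linarith
  have hb : 0 < b := by rw [hb_def]; linarith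
  have hab : ((n : ℝ) - 3) / 2 = a + b := by rw [ha_def, hb_def]; ring
  have hc : 0 ≤ U / S := by positivity
  set g : ℕ → ℝ := fun q => Real.Gamma (a + b + q) * (2 / S) ^ (a + b + q) *
    eulerInt a (a + b + q) (U / S) with hg_def
  have hg : ∀ q, 0 < g q := fun q => by
    have h1 := Real.Gamma_pos_of_pos (by positivity : 0 < a + b + q)
    have h2 := eulerInt_pos ha hc (a + b + q)
    positivity
  have h0 := hK y hS 0 (by norm_num)
  have h1 := hK y hS 1 le_rfl
  rw [hab] at h0 h1
  change _ = K * ENNReal.ofReal (g 0) at h0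
  change _ = K * ENNReal.ofReal (g 1) at h1
  simp only [pow_zero, ENNReal.ofReal_one, lintegral_one, pow_one] at h0 h1
  have hM : marginal X G (harmonicPrior X) y = K * ENNReal.ofReal (g 0) := h0
  have hg0 : ENNReal.ofReal (g 0) ≠ 0 := by simpa using hg 0
  have hM0 : marginal X G (harmonicPrior X) y ≠ 0 := by rw [hM]; exact mul_ne_zero hK0 hg0
  have hM1 : marginal X G (harmonicPrior X) y ≠ ∞ := by
    rw [hM]; exact ENNReal.mul_ne_top hK1 ENNReal.ofReal_ne_top
  have hδ : deltaH X y = shrink a b (U / S) * (S / ((n : ℝ) - p - 1)) := c.deltaH_eq hp hn y hS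
  have hδ0 : 0 < deltaH X y := by
    rw [hδ]
    exact mul_pos (shrink_pos ha hb hc) (div_pos hS (by linarith))
  have hprob : IsProbabilityMeasure (posterior X G (harmonicPrior X) y) := by
    constructor
    rw [posterior, Measure.smul_apply, smul_eq_mul]
    exact ENNReal.inv_mul_cancel hM0 hM1
  have hpos : ∀ᵐ θ ∂(posterior X G (harmonicPrior X) y), 0 < θ.2.2 := by
    refine Measure.ae_smul_measure ?_ _
    refine (withDensity_absolutelyContinuous _ _).ae_le ?_
    refine ae_restrict_mem ?_
    exact measurableSet_lt measurable_const (by fun_prop)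
  have hratio : g 1 / g 0 = (deltaH X y)⁻¹ := by
    have e1 : g 1 = (a + b) * Real.Gamma (a + b) * ((2 / S) ^ (a + b) * (2 / S)) *
        eulerInt a (a + b + 1) (U / S) := by
      simp only [hg_def, Nat.cast_one]
      rw [Real.Gamma_add_one (by positivity), Real.rpow_add_one (by positivity)]
    have e0 : g 0 = Real.Gamma (a + b) * (2 / S) ^ (a + b) * eulerInt a (a + b) (U / S) := by
      simp only [hg_def, Nat.cast_zero, add_zero]
    have h3 := Real.Gamma_pos_of_pos (by positivity : 0 < a + b)
    have h4 := eulerInt_pos ha hc (a + b)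
    have h5 := mul_eulerInt_div (b := b) ha hc
    have h6 := eulerRatio_pos b ha hc
    have h7 : 0 < (2 / S) ^ (a + b) := by positivity
    have h8 : (n : ℝ) - p - 1 = 2 * b := by rw [hb_def]; ring
    rw [hδ, h8, shrink, e0, e1]
    have h9 : (a + b) * Real.Gamma (a + b) * ((2 / S) ^ (a + b) * (2 / S)) *
        eulerInt a (a + b + 1) (U / S) = (2 / S) * (b + (eulerRatio a b (U / S))⁻¹) *
        (Real.Gamma (a + b) * (2 / S) ^ (a + b) * eulerInt a (a + b) (U / S)) := by
      linear_combination (Real.Gamma (a + b) * ((2 / S) ^ (a + b) * (2 / S))) * h5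
    rw [h9, mul_div_cancel_right₀ _ (by positivity)]
    have h10 : 0 < b + (eulerRatio a b (U / S))⁻¹ := by positivity
    field_simp
  have hinv : ∫⁻ θ, ENNReal.ofReal (θ.2.2)⁻¹ ∂(posterior X G (harmonicPrior X) y)
      = ENNReal.ofReal (deltaH X y)⁻¹ := by
    rw [posterior, lintegral_smul_measure, h1, hM, ← hratio, ENNReal.ofReal_div_of_pos (hg 0),
      smul_eq_mul, mul_comm, ← div_eq_mul_inv, ENNReal.mul_div_mul_left _ _ hK0 hK1]
  exact ⟨hM0, hM1, hδ0, bayes_of_integral_inv (by fun_prop) hpos hδ0 hinv⟩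

/-! ### Gaussian probabilities of balls -/

/-- The average of an increasing function over a sublevel set grows with the level: the supremum `M`
over the inner set bounds `g` above inside and below on the added shell. Products replace quotients
to avoid dividing by zero. -/
lemma lintegral_mul_measure_le_of_monotone {R : Type*} [MeasurableSpace R] (μ : Measure R)
    {r : R → ℝ} (hr : Measurable r) {g : R → ℝ≥0∞} (hg : ∀ a b, r a ≤ r b → g a ≤ g b) {x y : ℝ}
    (hxy : x ≤ y) :
    (∫⁻ a in {a | r a ≤ x}, g a ∂μ) * μ {a | r a ≤ y}
      ≤ (∫⁻ a in {a | r a ≤ y}, g a ∂μ) * μ {a | r a ≤ x} := by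
  have hmx : MeasurableSet {a | r a ≤ x} := measurableSet_le hr measurable_const
  have hmd : MeasurableSet {a | x < r a ∧ r a ≤ y} :=
    (measurableSet_lt measurable_const hr).inter (measurableSet_le hr measurable_const)
  have hunion : {a | r a ≤ y} = {a | r a ≤ x} ∪ {a | x < r a ∧ r a ≤ y} := by
    ext a
    simp only [Set.mem_ofPred_eq, Set.mem_union]
    constructor
    · intro h; rcases le_or_gt (r a) x with h1 | h1
      · exact Or.inl h1
      · exact Or.inr ⟨h1, h⟩
    · rintro (h | h)
      · exact h.trans hxy
      · exact h.2
  have hdisj : Disjoint {a | r a ≤ x} {a | x < r a ∧ r a ≤ y} := by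
    rw [Set.disjoint_left]; intro a h1 h2; exact absurd h2.1 (not_lt.2 h1)
  set M : ℝ≥0∞ := ⨆ a ∈ {a | r a ≤ x}, g a with hM
  have h1 : ∫⁻ a in {a | r a ≤ x}, g a ∂μ ≤ M * μ {a | r a ≤ x} := by
    rw [← setLIntegral_const]
    exact setLIntegral_mono' hmx fun a ha => le_iSup₂ (f := fun a _ => g a) a ha
  have h2 : M * μ {a | x < r a ∧ r a ≤ y} ≤ ∫⁻ a in {a | x < r a ∧ r a ≤ y}, g a ∂μ := by
    rw [← setLIntegral_const]
    refine setLIntegral_mono' hmd fun b hb => ?_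
    exact iSup₂_le fun a ha => hg a b (le_trans ha hb.1.le)
  rw [hunion, measure_union hdisj hmd, lintegral_union hmd hdisj, mul_add, add_mul]
  refine add_le_add le_rfl ?_
  calc (∫⁻ a in {a | r a ≤ x}, g a ∂μ) * μ {a | x < r a ∧ r a ≤ y}
      ≤ M * μ {a | r a ≤ x} * μ {a | x < r a ∧ r a ≤ y} := by gcongr
    _ = M * μ {a | x < r a ∧ r a ≤ y} * μ {a | r a ≤ x} := by ring
    _ ≤ _ := by gcongr

section Ball

variable {E : Type*} [NormedAddCommGroup E] [InnerProductSpace ℝ E] [FiniteDimensional ℝ E]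
  [MeasurableSpace E] [BorelSpace E]

set_option linter.unusedSectionVars false

/-- The probability that a standard normal vector shifted by `θ` lies in the ball of squared
radius `x`. -/
def ballProb (θ : E) (x : ℝ) : ℝ≥0∞ := gauss E {ζ | ‖θ + ζ‖ ^ 2 ≤ x}

lemma measurableSet_ball_sq (θ : E) (x : ℝ) : MeasurableSet {ζ : E | ‖θ + ζ‖ ^ 2 ≤ x} :=
  measurableSet_le (by fun_prop) measurable_const

lemma lintegral_polar [Nontrivial E] {f : E → ℝ≥0∞} (hf : Measurable f) :
    ∫⁻ z, f z = ∫⁻ ω, ∫⁻ ρ, f ((ρ : ℝ) • (ω : E))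
      ∂(Measure.volumeIoiPow (Module.finrank ℝ E - 1)) ∂((volume : Measure E).toSphere) := by
  have h1 : ∫⁻ z, f z = ∫⁻ z : ({(0)}ᶜ : Set E), f z.1 ∂((volume : Measure E).comap (↑)) := by
    rw [lintegral_subtype_comap (measurableSet_singleton _).compl, restrict_compl_singleton]
  have hg : Measurable fun q : Metric.sphere (0 : E) 1 × Set.Ioi (0 : ℝ) =>
      f ((q.2 : ℝ) • (q.1 : E)) := by
    refine hf.comp ?_
    exact (measurable_subtype_coe.comp measurable_snd).smul
      (measurable_subtype_coe.comp measurable_fst)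
  have h2 := (volume : Measure E).measurePreserving_homeomorphUnitSphereProd.lintegral_comp hg
  rw [h1, ← lintegral_prod _ hg.aemeasurable, ← h2]
  refine lintegral_congr fun z => ?_
  congr 1
  have hz : ‖(z : E)‖ ≠ 0 := norm_ne_zero_iff.2 z.2
  simp only [homeomorphUnitSphereProd_apply_snd_coe, homeomorphUnitSphereProd_apply_fst_coe]
  exact (smul_inv_smul₀ hz _).symm

lemma gauss_apply_ball (θ : E) (x : ℝ) :
    ballProb θ x = ∫⁻ z, gaussDens 1 (z - θ) * Set.indicator {z : E | ‖z‖ ^ 2 ≤ x} 1 z := by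
  have hm : MeasurableSet {z : E | ‖z‖ ^ 2 ≤ x} := measurableSet_le (by fun_prop) measurable_const
  rw [lintegral_gaussDens_mul one_pos θ (measurable_one.indicator hm), ballProb]
  rw [← lintegral_indicator_one (measurableSet_ball_sq θ x)]
  simp only [Real.sqrt_one, one_smul]
  rfl

/-- Averaging with the reflection `z ↦ -z` replaces `exp ⟨z, θ⟩` by a hyperbolic cosine, which,
unlike the exponential, is nondecreasing along every ray from the origin. -/
lemma ballProb_eq_cosh (θ : E) (x : ℝ) :
    ballProb θ x = ENNReal.ofReal (Real.exp (-‖θ‖ ^ 2 / 2)) *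
      ∫⁻ z, Set.indicator {z : E | ‖z‖ ^ 2 ≤ x}
        (fun z => gaussDens 1 z * ENNReal.ofReal (Real.cosh (inner ℝ z θ))) z := by
  have hm : MeasurableSet {z : E | ‖z‖ ^ 2 ≤ x} := measurableSet_le (by fun_prop) measurable_const
  have e1 : ∀ z : E, gaussDens 1 (z - θ) * Set.indicator {z : E | ‖z‖ ^ 2 ≤ x} 1 z
      = ENNReal.ofReal (Real.exp (-‖θ‖ ^ 2 / 2)) * Set.indicator {z : E | ‖z‖ ^ 2 ≤ x}
        (fun z => gaussDens 1 z * ENNReal.ofReal (Real.exp (inner ℝ z θ))) z := by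
    intro z
    by_cases hz : z ∈ {z : E | ‖z‖ ^ 2 ≤ x}
    · rw [Set.indicator_of_mem hz, Set.indicator_of_mem hz, Pi.one_apply, mul_one, gaussDens,
        gaussDens, ← ENNReal.ofReal_mul (by positivity), ← ENNReal.ofReal_mul (by positivity)]
      congr 1
      have : Real.exp (-‖z - θ‖ ^ 2 / (2 * 1)) = Real.exp (-‖θ‖ ^ 2 / 2) *
          (Real.exp (-‖z‖ ^ 2 / (2 * 1)) * Real.exp (inner ℝ z θ)) := by
        rw [← Real.exp_add, ← Real.exp_add, norm_sub_sq_real]; congr 1; ring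
      rw [this]; ring
    · rw [Set.indicator_of_notMem hz, Set.indicator_of_notMem hz]; simp
  set F : ℝ → E → ℝ≥0∞ := fun r => Set.indicator {z : E | ‖z‖ ^ 2 ≤ x}
        (fun z => gaussDens 1 z * ENNReal.ofReal (Real.exp (r * inner ℝ z θ))) with hF
  have hFm : ∀ r, Measurable (F r) := fun r => Measurable.indicator (by fun_prop) hm
  have e2 : ∫⁻ z, F 1 z = ∫⁻ z, F (-1) z := by
    rw [← lintegral_neg_eq_self]
    refine lintegral_congr fun z => ?_
    simp only [hF, Set.indicator, Set.mem_ofPred_eq, norm_neg, inner_neg_left, gaussDens]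
    congr 4; ring_nf
  have e3 : ∀ z, F 1 z + F (-1) z = 2 * Set.indicator {z : E | ‖z‖ ^ 2 ≤ x}
        (fun z => gaussDens 1 z * ENNReal.ofReal (Real.cosh (inner ℝ z θ))) z := by
    intro z
    by_cases hz : z ∈ {z : E | ‖z‖ ^ 2 ≤ x}
    · simp only [hF]
      rw [Set.indicator_of_mem hz, Set.indicator_of_mem hz, Set.indicator_of_mem hz, ← mul_add,
        ← ENNReal.ofReal_add (Real.exp_pos _).le (Real.exp_pos _).le, mul_left_comm]
      congr 1
      rw [Real.cosh_eq, one_mul, neg_one_mul, show (2 : ℝ≥0∞) = ENNReal.ofReal 2 by simp,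
        ← ENNReal.ofReal_mul two_pos.le]
      congr 1; ring
    · simp only [hF]
      rw [Set.indicator_of_notMem hz, Set.indicator_of_notMem hz, Set.indicator_of_notMem hz]
      simp
  rw [gauss_apply_ball]
  simp only [e1]
  rw [lintegral_const_mul _ (by
    have := hFm 1; simp only [hF, one_mul] at this; exact this)]
  congr 1
  have e4 : 2 * ∫⁻ z, F 1 z = 2 * ∫⁻ z, Set.indicator {z : E | ‖z‖ ^ 2 ≤ x}
        (fun z => gaussDens 1 z * ENNReal.ofReal (Real.cosh (inner ℝ z θ))) z := by
    rw [two_mul]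
    nth_rewrite 2 [e2]
    rw [← lintegral_add_left (hFm 1), ← lintegral_const_mul _ (Measurable.indicator (by
      have : Measurable fun x : ℝ => Real.cosh x := Real.measurable_cosh
      fun_prop) hm)]
    exact lintegral_congr e3
  have e5 := (ENNReal.mul_right_inj two_ne_zero ENNReal.ofNat_ne_top).1 e4
  simp only [hF, one_mul] at e5
  exact e5

/-- The ratio of a noncentral to a central ball probability increases with the radius. -/
lemma ballProb_mul_le [Nontrivial E] (θ : E) {x y : ℝ} (hxy : x ≤ y) :
    ballProb θ x * ballProb (0 : E) y ≤ ballProb θ y * ballProb (0 : E) x := by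
  have hcm : Measurable fun x : ℝ => Real.cosh x := Real.measurable_cosh
  set σ : Measure (Metric.sphere (0 : E) 1) := (volume : Measure E).toSphere with hσ
  set V : Measure (Set.Ioi (0 : ℝ)) := Measure.volumeIoiPow (Module.finrank ℝ E - 1) with hV
  set κ : Set.Ioi (0 : ℝ) → ℝ≥0∞ := fun ρ => ENNReal.ofReal
    ((2 * Real.pi * 1) ^ (-(Module.finrank ℝ E : ℝ) / 2) * Real.exp (-(ρ : ℝ) ^ 2 / (2 * 1)))
    with hκ
  have hκm : Measurable κ := by fun_prop
  set ν : Measure (Set.Ioi (0 : ℝ)) := V.withDensity κ with hν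
  set C : E → ℝ → ℝ≥0∞ := fun ω x => ∫⁻ ρ in {ρ : Set.Ioi (0 : ℝ) | (ρ : ℝ) ^ 2 ≤ x},
    ENNReal.ofReal (Real.cosh ((ρ : ℝ) * inner ℝ ω θ)) ∂ν with hC
  have hset : ∀ x : ℝ, MeasurableSet {ρ : Set.Ioi (0 : ℝ) | (ρ : ℝ) ^ 2 ≤ x} := fun x =>
    measurableSet_le (by fun_prop) measurable_const
  have hCeq : ∀ ψ : E, ∀ x : ℝ, ballProb ψ x = ENNReal.ofReal (Real.exp (-‖ψ‖ ^ 2 / 2)) *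
      ∫⁻ ω, ∫⁻ ρ in {ρ : Set.Ioi (0 : ℝ) | (ρ : ℝ) ^ 2 ≤ x},
        ENNReal.ofReal (Real.cosh ((ρ : ℝ) * inner ℝ (ω : E) ψ)) ∂ν ∂σ := by
    intro ψ x
    have hm : MeasurableSet {z : E | ‖z‖ ^ 2 ≤ x} :=
      measurableSet_le (by fun_prop) measurable_const
    rw [ballProb_eq_cosh, lintegral_polar (Measurable.indicator (by fun_prop) hm)]
    congr 1
    refine lintegral_congr fun ω => ?_
    rw [hν, restrict_withDensity (hset x), lintegral_withDensity_eq_lintegral_mul _ hκm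
      (by fun_prop), ← lintegral_indicator (hset x)]
    refine lintegral_congr fun ρ => ?_
    have hρ : ‖(ρ : ℝ) • (ω : E)‖ = ρ := by
      rw [norm_smul, Real.norm_of_nonneg (le_of_lt ρ.2)]
      simp
    by_cases hx : (ρ : ℝ) ^ 2 ≤ x
    · rw [Set.indicator_of_mem (by simpa [hρ] using hx), Set.indicator_of_mem (by exact hx),
        gaussDens, hρ, real_inner_smul_left]
      rfl
    · rw [Set.indicator_of_notMem (by simpa [hρ] using hx), Set.indicator_of_notMem (by exact hx)]
  -- For centre 0 the cosine is 1, so the probability splits into the area of the sphere and a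
  -- radial mass.
  have hzero : ∀ x, ballProb (0 : E) x
      = σ Set.univ * ν {ρ : Set.Ioi (0 : ℝ) | (ρ : ℝ) ^ 2 ≤ x} := by
    intro x
    rw [hCeq]
    simp [mul_comm]
  -- The monotonicity holds direction by direction; integration over the sphere preserves it since
  -- the radial masses do not depend on the direction.
  have hmono : ∀ ω : E, C ω x * ν {ρ : Set.Ioi (0 : ℝ) | (ρ : ℝ) ^ 2 ≤ y}
      ≤ C ω y * ν {ρ : Set.Ioi (0 : ℝ) | (ρ : ℝ) ^ 2 ≤ x} := by
    intro ω
    refine lintegral_mul_measure_le_of_monotone ν (r := fun ρ : Set.Ioi (0 : ℝ) => (ρ : ℝ) ^ 2)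
      (by fun_prop) ?_ hxy
    intro a b hab
    have hab' : (a : ℝ) ≤ b := by
      have ha : (0 : ℝ) < a := a.2
      have hb : (0 : ℝ) < b := b.2
      exact (pow_le_pow_iff_left₀ ha.le hb.le two_ne_zero).1 hab
    refine ENNReal.ofReal_le_ofReal (Real.cosh_le_cosh.2 ?_)
    rw [abs_mul, abs_mul, abs_of_pos (show (0 : ℝ) < a from a.2),
      abs_of_pos (show (0 : ℝ) < b from b.2)]
    gcongr
  have hCm : ∀ x, Measurable fun ω : Metric.sphere (0 : E) 1 => C ω x := by
    intro x
    have : SFinite ν := by rw [hν]; infer_instance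
    exact Measurable.lintegral_prod_right' (ν := ν.restrict _)
      (f := fun q : Metric.sphere (0 : E) 1 × Set.Ioi (0 : ℝ) =>
        ENNReal.ofReal (Real.cosh ((q.2 : ℝ) * inner ℝ (q.1 : E) θ))) (by fun_prop)
  rw [hzero, hzero, hCeq, hCeq]
  change _ * (∫⁻ ω : Metric.sphere (0 : E) 1, C ω x ∂σ) * _
    ≤ _ * (∫⁻ ω : Metric.sphere (0 : E) 1, C ω y ∂σ) * _
  have key : (∫⁻ ω : Metric.sphere (0 : E) 1, C ω x ∂σ) *
      ν {ρ : Set.Ioi (0 : ℝ) | (ρ : ℝ) ^ 2 ≤ y}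
      ≤ (∫⁻ ω : Metric.sphere (0 : E) 1, C ω y ∂σ) *
      ν {ρ : Set.Ioi (0 : ℝ) | (ρ : ℝ) ^ 2 ≤ x} := by
    rw [← lintegral_mul_const _ (hCm x), ← lintegral_mul_const _ (hCm y)]
    exact lintegral_mono fun ω => hmono ω
  calc _ = ENNReal.ofReal (Real.exp (-‖θ‖ ^ 2 / 2)) * σ Set.univ *
        ((∫⁻ ω : Metric.sphere (0 : E) 1, C ω x ∂σ) *
          ν {ρ : Set.Ioi (0 : ℝ) | (ρ : ℝ) ^ 2 ≤ y}) := by ring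
    _ ≤ ENNReal.ofReal (Real.exp (-‖θ‖ ^ 2 / 2)) * σ Set.univ *
        ((∫⁻ ω : Metric.sphere (0 : E) 1, C ω y ∂σ) *
          ν {ρ : Set.Ioi (0 : ℝ) | (ρ : ℝ) ^ 2 ≤ x}) := by gcongr
    _ = _ := by ring

/-- Moving a ball away from the origin decreases its Gaussian probability. -/
lemma ballProb_smul_antitone (θ : E) (x : ℝ) {t₁ t₂ : ℝ} (h1 : 0 ≤ t₁) (h12 : t₁ ≤ t₂) :
    ballProb (t₂ • θ) x ≤ ballProb (t₁ • θ) x := by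
  rcases h12.eq_or_lt with rfl | hlt
  · exact le_rfl
  -- `σ` below is the reflection in the hyperplane that bisects the segment between the two centres
  -- `-t₁ θ` and `-t₂ θ`; it exchanges the two balls.
  let R := (Submodule.span ℝ {θ})ᗮ.reflection
  have hRθ : R θ = -θ := Submodule.reflection_orthogonalComplement_singleton_eq_neg θ
  let σ : E → E := fun ζ => R ζ - (t₁ + t₂) • θ
  have hσ : MeasurePreserving σ volume volume :=
    (measurePreserving_sub_right volume ((t₁ + t₂) • θ)).comp R.measurePreserving
  have hinner : ∀ ζ, inner ℝ (R ζ) θ = -inner ℝ ζ θ := by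
    intro ζ
    have := R.inner_map_map ζ θ
    rw [hRθ, inner_neg_right] at this
    linarith
  have hσ1 : ∀ ζ, ‖t₁ • θ + σ ζ‖ = ‖t₂ • θ + ζ‖ := by
    intro ζ
    rw [← R.norm_map (t₂ • θ + ζ)]
    congr 1
    simp only [σ, map_add, map_smul, hRθ]
    module
  have hσ2 : ∀ ζ, ‖t₂ • θ + σ ζ‖ = ‖t₁ • θ + ζ‖ := by
    intro ζ
    rw [← R.norm_map (t₁ • θ + ζ)]
    congr 1
    simp only [σ, map_add, map_smul, hRθ]
    module
  have hσn : ∀ ζ, ‖σ ζ‖ ^ 2 = ‖ζ‖ ^ 2 + 2 * (t₁ + t₂) * inner ℝ ζ θ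
      + (t₁ + t₂) ^ 2 * ‖θ‖ ^ 2 := by
    intro ζ
    have h0 : 0 ≤ t₁ + t₂ := by linarith
    simp only [σ]
    rw [norm_sub_sq_real, real_inner_smul_right, hinner, R.norm_map, norm_smul,
      Real.norm_of_nonneg h0]
    ring
  have hdiff : ∀ ζ, ‖t₂ • θ + ζ‖ ^ 2 - ‖t₁ • θ + ζ‖ ^ 2
      = (t₂ - t₁) * (2 * inner ℝ ζ θ + (t₁ + t₂) * ‖θ‖ ^ 2) := by
    intro ζ
    rw [norm_add_sq_real, norm_add_sq_real, real_inner_smul_left, real_inner_smul_left, norm_smul,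
      norm_smul, mul_pow, mul_pow, Real.norm_eq_abs, Real.norm_eq_abs, sq_abs, sq_abs,
      real_inner_comm]
    ring
  have hdens : ∀ z z' : E, ‖z‖ ^ 2 ≤ ‖z'‖ ^ 2 → gaussDens 1 z' ≤ gaussDens 1 z := by
    intro z z' h
    refine ENNReal.ofReal_le_ofReal (mul_le_mul_of_nonneg_left ?_ (by positivity))
    refine Real.exp_le_exp.2 ?_
    linarith
  have hball : ∀ t : ℝ, ballProb (t • θ) x
      = ∫⁻ ζ, gaussDens 1 ζ * Set.indicator {ζ : E | ‖t • θ + ζ‖ ^ 2 ≤ x} 1 ζ := by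
    intro t
    rw [← lintegral_gauss (measurable_one.indicator (measurableSet_ball_sq _ _)),
      lintegral_indicator_one (measurableSet_ball_sq _ _), ballProb]
  have hswap : ∀ t t' : ℝ, (∀ ζ, ‖t • θ + σ ζ‖ = ‖t' • θ + ζ‖) → ballProb (t • θ) x
      = ∫⁻ ζ, gaussDens 1 (σ ζ) * Set.indicator {ζ : E | ‖t' • θ + ζ‖ ^ 2 ≤ x} 1 ζ := by
    intro t t' h
    have h2 := hσ.lintegral_comp (f := fun ζ => gaussDens 1 ζ *
      Set.indicator {ζ : E | ‖t • θ + ζ‖ ^ 2 ≤ x} 1 ζ) ((measurable_gaussDens 1).mul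
      (measurable_one.indicator (measurableSet_ball_sq _ _)))
    rw [hball, ← h2]
    refine lintegral_congr fun ζ => ?_
    simp only [Set.indicator, Set.mem_ofPred_eq, h, Pi.one_apply]
  have hσm : Measurable σ := hσ.measurable
  have hm : ∀ t : ℝ, Measurable (Set.indicator {ζ : E | ‖t • θ + ζ‖ ^ 2 ≤ x} (1 : E → ℝ≥0∞)) :=
    fun t => measurable_one.indicator (measurableSet_ball_sq _ _)
  -- Each probability is written once directly and once through `σ`, so that the comparison becomes
  -- pointwise: a point in only one of the balls has larger density than its mirror image exactly
  -- when the ball is the one nearer the origin.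
  have hsum : ballProb (t₂ • θ) x + ballProb (t₂ • θ) x
      ≤ ballProb (t₁ • θ) x + ballProb (t₁ • θ) x := by
    nth_rewrite 1 [hball t₂]
    nth_rewrite 1 [hswap t₂ t₁ hσ2]
    nth_rewrite 1 [hball t₁]
    rw [hswap t₁ t₂ hσ1]
    have := hm t₁
    have := hm t₂
    rw [← lintegral_add_left (by fun_prop), ← lintegral_add_left (by fun_prop)]
    refine lintegral_mono fun ζ => ?_
    have hd := hdiff ζ
    have hn := hσn ζ
    have h0 : 0 ≤ t₁ + t₂ := by linarith
    by_cases hz1 : ‖t₁ • θ + ζ‖ ^ 2 ≤ x <;> by_cases hz2 : ‖t₂ • θ + ζ‖ ^ 2 ≤ x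
    · simp [Set.indicator, hz1, hz2]
    · simp only [Set.indicator, Set.mem_ofPred_eq, hz1, hz2, if_true, if_false, Pi.one_apply,
        mul_one, mul_zero, add_zero, zero_add]
      refine hdens _ _ ?_
      have h3 : 0 < (t₂ - t₁) * (2 * inner ℝ ζ θ + (t₁ + t₂) * ‖θ‖ ^ 2) := by
        rw [← hd]; linarith [not_le.1 hz2]
      have h4 := (pos_iff_pos_of_mul_pos h3).1 (sub_pos.2 hlt)
      nlinarith
    · simp only [Set.indicator, Set.mem_ofPred_eq, hz1, hz2, if_true, if_false, Pi.one_apply,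
        mul_one, mul_zero, add_zero, zero_add]
      refine hdens _ _ ?_
      have h3 : (t₂ - t₁) * (2 * inner ℝ ζ θ + (t₁ + t₂) * ‖θ‖ ^ 2) < 0 := by
        rw [← hd]; linarith [not_le.1 hz1]
      have h4 : 2 * inner ℝ ζ θ + (t₁ + t₂) * ‖θ‖ ^ 2 < 0 := by
        by_contra hcon
        have := mul_nonneg (sub_pos.2 hlt).le (not_lt.1 hcon)
        linarith
      nlinarith
    · simp [Set.indicator, hz1, hz2]
  rw [← two_mul, ← two_mul] at hsum
  exact (ENNReal.mul_le_mul_iff_right two_ne_zero ENNReal.ofNat_ne_top).1 hsum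

end Ball

/-! ### Ball probabilities with a chi-square radius -/

/-- The two sides differ by `(k - s)(B - A)`. -/
lemma ennreal_rearrangement {s k A B : ℝ≥0∞} (h : s ≤ k) (h' : A ≤ B) :
    s * B + k * A ≤ s * A + k * B := by
  obtain ⟨d, rfl⟩ := exists_add_of_le h
  obtain ⟨e, rfl⟩ := exists_add_of_le h'
  calc s * (A + e) + (s + d) * A ≤ s * (A + e) + (s + d) * A + d * e := le_self_add
    _ = _ := by ring

lemma setLIntegral_eulerInt {a c : ℝ} (ha : 0 < a) (hc : 0 ≤ c) (k : ℝ) :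
    ∫⁻ t in Set.Ioc (0 : ℝ) 1, ENNReal.ofReal (t ^ (a - 1) * (1 + c * t) ^ (-k))
      = ENNReal.ofReal (eulerInt a k c) := by
  have hint := (intervalIntegrable_iff_integrableOn_Ioc_of_le zero_le_one).1
    (intervalIntegrable_euler ha hc (-k))
  rw [eulerInt, intervalIntegral.integral_of_le zero_le_one,
    ofReal_integral_eq_lintegral_ofReal hint]
  filter_upwards [ae_restrict_mem measurableSet_Ioc] with t ht
  have := one_add_mul_pos hc ht.1.le
  have := ht.1
  positivity

section Ball

variable {E F : Type*} [NormedAddCommGroup E] [InnerProductSpace ℝ E] [FiniteDimensional ℝ E]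
  [MeasurableSpace E] [BorelSpace E] [NormedAddCommGroup F] [InnerProductSpace ℝ F]
  [FiniteDimensional ℝ F] [MeasurableSpace F] [BorelSpace F]

set_option linter.unusedSectionVars false

@[fun_prop]
lemma measurable_ballProb {Ω : Type*} [MeasurableSpace Ω] {f : Ω → E} {g : Ω → ℝ}
    (hf : Measurable f) (hg : Measurable g) : Measurable fun x => ballProb (f x) (g x) :=
  measurable_measure_prodMk_left (ν := gauss E) (s := {q : Ω × E | ‖f q.1 + q.2‖ ^ 2 ≤ g q.1})
    (measurableSet_le (by fun_prop) (by fun_prop))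

lemma ballProb_le_one (θ : E) (x : ℝ) : ballProb θ x ≤ 1 := prob_le_one

lemma ballProb_ne_top (θ : E) (x : ℝ) : ballProb θ x ≠ ∞ := measure_ne_top _ _

lemma volume_absolutelyContinuous_gauss : (volume : Measure E) ≪ gauss E := by
  refine withDensity_absolutelyContinuous' (measurable_gaussDens 1).aemeasurable ?_
  refine ae_of_all _ fun z => ?_
  rw [gaussDens, Ne, ENNReal.ofReal_eq_zero, not_le]
  positivity

lemma ballProb_zero_ne_zero {x : ℝ} (hx : 0 < x) : ballProb (0 : E) x ≠ 0 := by
  intro h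
  have h1 : (volume : Measure E) {ζ | ‖(0 : E) + ζ‖ ^ 2 ≤ x} = 0 :=
    volume_absolutelyContinuous_gauss h
  have h2 : (volume : Measure E) (Metric.ball 0 √x) ≠ 0 :=
    (Metric.measure_ball_pos _ _ (Real.sqrt_pos.2 hx)).ne'
  refine h2 (measure_mono_null ?_ h1)
  intro ζ hζ
  simp only [Metric.mem_ball, dist_zero_right] at hζ
  simp only [Set.mem_ofPred_eq, zero_add]
  have := (Real.lt_sqrt (norm_nonneg ζ)).1 hζ
  exact this.le

variable (E) in
lemma exists_lintegral_gauss_norm_sq [Nontrivial E] : ∃ k : ℝ≥0∞, k ≠ 0 ∧ k ≠ ∞ ∧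
    ∀ h : ℝ → ℝ≥0∞, Measurable h → ∫⁻ η, h (‖η‖ ^ 2) ∂(gauss E) = k *
      ∫⁻ x in Set.Ioi (0 : ℝ), ENNReal.ofReal (x ^ ((Module.finrank ℝ E : ℝ) / 2 - 1) *
        Real.exp (-(1 / 2 * x))) * h x := by
  refine ⟨_, mul_ne_zero (chiConst_ne_zero (E := E)) ?_,
    ENNReal.mul_ne_top (chiConst_ne_top (E := E)) ENNReal.ofReal_ne_top,
    fun h hh => lintegral_gauss_norm_sq' hh⟩
  rw [Ne, ENNReal.ofReal_eq_zero, not_le]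
  positivity

/-- Total mass and mean share the normalizing constant `k`, so it is eliminated and only the gamma
recursion remains. -/
lemma lintegral_gauss_norm_sq_self [Nontrivial E] :
    ∫⁻ η, ENNReal.ofReal (‖η‖ ^ 2) ∂(gauss E) = Module.finrank ℝ E := by
  obtain ⟨k, hk0, hk1, hk⟩ := exists_lintegral_gauss_norm_sq E
  have hd : 0 < (Module.finrank ℝ E : ℝ) / 2 := by
    have : 0 < Module.finrank ℝ E := Module.finrank_pos
    positivity
  have h0 := hk (fun _ => 1) measurable_const
  have h1 := hk ENNReal.ofReal ENNReal.measurable_ofReal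
  rw [h1]
  simp only [mul_one, lintegral_one, measure_univ] at h0
  rw [lintegral_gamma hd (by norm_num)] at h0
  have e1 : ∫⁻ x in Set.Ioi (0 : ℝ), ENNReal.ofReal (x ^ ((Module.finrank ℝ E : ℝ) / 2 - 1) *
        Real.exp (-(1 / 2 * x))) * ENNReal.ofReal x
      = ∫⁻ x in Set.Ioi (0 : ℝ), ENNReal.ofReal (x ^ ((Module.finrank ℝ E : ℝ) / 2 + 1 - 1) *
        Real.exp (-(1 / 2 * x))) := by
    refine setLIntegral_congr_fun measurableSet_Ioi fun x hx => ?_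
    have hx' : (0 : ℝ) < x := hx
    rw [← ENNReal.ofReal_mul (by positivity)]
    congr 1
    rw [show (Module.finrank ℝ E : ℝ) / 2 + 1 - 1 = (Module.finrank ℝ E : ℝ) / 2 - 1 + 1 by ring,
      Real.rpow_add_one hx'.ne']
    ring
  have hG := Real.Gamma_pos_of_pos hd
  rw [e1, lintegral_gamma (by positivity) (by norm_num), Real.Gamma_add_one hd.ne',
    Real.rpow_add_one (by norm_num)]
  rw [show (1 / (1 / 2) : ℝ) ^ ((Module.finrank ℝ E : ℝ) / 2) * (1 / (1 / 2)) *
      ((Module.finrank ℝ E : ℝ) / 2 * Real.Gamma ((Module.finrank ℝ E : ℝ) / 2))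
      = (1 / (1 / 2) : ℝ) ^ ((Module.finrank ℝ E : ℝ) / 2) *
        Real.Gamma ((Module.finrank ℝ E : ℝ) / 2) * (Module.finrank ℝ E : ℝ) by ring,
    ENNReal.ofReal_mul (by positivity), ← mul_assoc, ← h0, one_mul, ENNReal.ofReal_natCast]

/-- A central ball probability is an incomplete gamma integral; rescaled to `t` in the unit interval
and integrated over `S = ‖η‖²` first, it gives a gamma integral of rate `(1 + c t)/2`. The constant
does not depend on `q`, so ratios of moments are explicit. -/
lemma exists_lintegral_norm_sq_pow_mul_ballProb [Nontrivial E] [Nontrivial F] {c : ℝ}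
    (hc : 0 < c) : ∃ k : ℝ≥0∞, k ≠ 0 ∧ k ≠ ∞ ∧ ∀ q : ℕ,
    ∫⁻ η : F, ENNReal.ofReal ((‖η‖ ^ 2) ^ q) * ballProb (0 : E) (c * ‖η‖ ^ 2) ∂(gauss F)
      = k * ENNReal.ofReal (2 ^ q * Real.Gamma
          ((Module.finrank ℝ E : ℝ) / 2 + (Module.finrank ℝ F : ℝ) / 2 + q) *
        eulerInt ((Module.finrank ℝ E : ℝ) / 2)
          ((Module.finrank ℝ E : ℝ) / 2 + (Module.finrank ℝ F : ℝ) / 2 + q) c) := by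
  obtain ⟨kE, hE0, hE1, hkE⟩ := exists_lintegral_gauss_norm_sq E
  obtain ⟨kF, hF0, hF1, hkF⟩ := exists_lintegral_gauss_norm_sq F
  have ha : 0 < (Module.finrank ℝ E : ℝ) / 2 := by
    have : 0 < Module.finrank ℝ E := Module.finrank_pos
    positivity
  have hb : 0 < (Module.finrank ℝ F : ℝ) / 2 := by
    have : 0 < Module.finrank ℝ F := Module.finrank_pos
    positivity
  set a : ℝ := (Module.finrank ℝ E : ℝ) / 2 with ha_def
  set b : ℝ := (Module.finrank ℝ F : ℝ) / 2 with hb_def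
  have hball : ∀ S : ℝ, 0 < S → ballProb (0 : E) (c * S) = kE * (ENNReal.ofReal ((c * S) ^ a) *
      ∫⁻ t in Set.Ioc (0 : ℝ) 1, ENNReal.ofReal (t ^ (a - 1) * Real.exp (-(1 / 2 * (c * S * t)))))
      := by
    intro S hS
    have hcS : 0 < c * S := by positivity
    have h1 := hkE (Set.indicator (Set.Iic (c * S)) 1) (measurable_one.indicator measurableSet_Iic)
    have h2 : ballProb (0 : E) (c * S)
        = ∫⁻ ζ : E, Set.indicator (Set.Iic (c * S)) 1 (‖ζ‖ ^ 2) ∂(gauss E) := by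
      rw [ballProb, ← lintegral_indicator_one (measurableSet_ball_sq _ _)]
      refine lintegral_congr fun ζ => ?_
      simp [Set.indicator]
    rw [h2, h1, setLIntegral_Ioi_scale hcS]
    congr 1
    rw [← lintegral_const_mul _ (by fun_prop), ← lintegral_indicator measurableSet_Ioi, ← lintegral_indicator measurableSet_Ioc]
    refine lintegral_congr fun t => ?_
    by_cases ht : t ∈ Set.Ioc (0 : ℝ) 1
    · have ht0 : 0 < t := ht.1
      have ht1 : c * S * t ∈ Set.Iic (c * S) := by
        simpa using mul_le_of_le_one_right hcS.le ht.2
      rw [Set.indicator_of_mem ht, Set.indicator_of_mem (show t ∈ Set.Ioi (0 : ℝ) from ht0),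
        Set.indicator_of_mem ht1, Pi.one_apply, mul_one,
        ← ENNReal.ofReal_mul (by positivity), ← ENNReal.ofReal_mul (by positivity)]
      congr 1
      rw [Real.mul_rpow hcS.le ht0.le, Real.rpow_sub_one hcS.ne']
      field_simp
    · rw [Set.indicator_of_notMem ht]
      by_cases ht0 : t ∈ Set.Ioi (0 : ℝ)
      · have ht1 : ¬ c * S * t ∈ Set.Iic (c * S) := by
          intro h
          have h' : c * S * t ≤ c * S * 1 := by simpa using h
          exact ht ⟨ht0, le_of_mul_le_mul_left h' hcS⟩
        rw [Set.indicator_of_mem ht0, Set.indicator_of_notMem ht1, mul_zero, mul_zero]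
      · rw [Set.indicator_of_notMem ht0]
  refine ⟨kF * kE * ENNReal.ofReal (c ^ a * 2 ^ (a + b)), ?_, ?_, fun q => ?_⟩
  · refine mul_ne_zero (mul_ne_zero hF0 hE0) ?_
    rw [Ne, ENNReal.ofReal_eq_zero, not_le]
    positivity
  · exact ENNReal.mul_ne_top (ENNReal.mul_ne_top hF1 hE1) ENNReal.ofReal_ne_top
  have hk : 0 < a + b + q := by positivity
  rw [hkF (fun S => ENNReal.ofReal (S ^ q) * ballProb (0 : E) (c * S)) (by fun_prop)]
  have e1 : ∫⁻ S in Set.Ioi (0 : ℝ), ENNReal.ofReal (S ^ (b - 1) * Real.exp (-(1 / 2 * S))) *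
        (ENNReal.ofReal (S ^ q) * ballProb (0 : E) (c * S))
      = ∫⁻ S in Set.Ioi (0 : ℝ), ∫⁻ t in Set.Ioc (0 : ℝ) 1, kE *
        (ENNReal.ofReal (c ^ a * t ^ (a - 1)) *
          ENNReal.ofReal (S ^ (a + b + q - 1) * Real.exp (-((1 + c * t) / 2 * S)))) := by
    refine setLIntegral_congr_fun measurableSet_Ioi fun S hS => ?_
    have hS' : (0 : ℝ) < S := hS
    rw [hball S hS', lintegral_const_mul _ (by fun_prop), mul_left_comm _ kE, mul_left_comm _ kE,
      ← lintegral_const_mul _ (by fun_prop), ← lintegral_const_mul _ (by fun_prop),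
      ← lintegral_const_mul _ (by fun_prop)]
    congr 1
    refine setLIntegral_congr_fun measurableSet_Ioc fun t ht => ?_
    have ht0 : 0 < t := ht.1
    rw [← ENNReal.ofReal_mul (by positivity), ← ENNReal.ofReal_mul (by positivity),
      ← ENNReal.ofReal_mul (by positivity), ← ENNReal.ofReal_mul (by positivity)]
    congr 1
    have h1 : S ^ (a + b + q - 1) = S ^ (b - 1) * S ^ q * S ^ a := by
      rw [← Real.rpow_natCast, ← Real.rpow_add hS', ← Real.rpow_add hS']
      congr 1; ring
    have h2 : Real.exp (-((1 + c * t) / 2 * S))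
        = Real.exp (-(1 / 2 * S)) * Real.exp (-(1 / 2 * (c * S * t))) := by
      rw [← Real.exp_add]; congr 1; ring
    rw [h1, h2, Real.mul_rpow hc.le hS'.le]
    ring
  rw [e1, lintegral_lintegral_swap (by fun_prop)]
  have e2 : ∫⁻ t in Set.Ioc (0 : ℝ) 1, ∫⁻ S in Set.Ioi (0 : ℝ), kE *
        (ENNReal.ofReal (c ^ a * t ^ (a - 1)) *
          ENNReal.ofReal (S ^ (a + b + q - 1) * Real.exp (-((1 + c * t) / 2 * S))))
      = ∫⁻ t in Set.Ioc (0 : ℝ) 1, kE *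
        (ENNReal.ofReal (c ^ a * 2 ^ (a + b) * (2 ^ q * Real.Gamma (a + b + q))) *
          ENNReal.ofReal (t ^ (a - 1) * (1 + c * t) ^ (-(a + b + q)))) := by
    refine setLIntegral_congr_fun measurableSet_Ioc fun t ht => ?_
    have ht0 : 0 < t := ht.1
    have h1 : 0 < 1 + c * t := by positivity
    have hG := Real.Gamma_pos_of_pos hk
    rw [lintegral_const_mul _ (by fun_prop), lintegral_const_mul _ (by fun_prop),
      lintegral_gamma hk (by positivity), ← ENNReal.ofReal_mul (by positivity),
      ← ENNReal.ofReal_mul (by positivity)]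
    congr 2
    rw [one_div_div, Real.div_rpow two_pos.le h1.le, Real.rpow_neg h1.le,
      Real.rpow_add two_pos (a + b), Real.rpow_natCast]
    field_simp
  have hG := Real.Gamma_pos_of_pos hk
  rw [e2, lintegral_const_mul _ (by fun_prop), lintegral_const_mul _ (by fun_prop),
    setLIntegral_eulerInt ha hc.le, ENNReal.ofReal_mul (by positivity),
    ENNReal.ofReal_mul (p := 2 ^ q * _) (by positivity)]
  ring

/-- A central ball whose squared radius is proportional to an independent chi-square variable
biases that variable upwards. -/
lemma lt_lintegral_mul_ballProb_zero [Nontrivial F] {a c : ℝ} (ha : 0 < a) (hc : 0 < c)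
    (hEa : (Module.finrank ℝ E : ℝ) / 2 = a + 1) :
    ENNReal.ofReal (2 * ((Module.finrank ℝ F : ℝ) / 2 +
        (eulerRatio a ((Module.finrank ℝ F : ℝ) / 2) c)⁻¹)) *
      ∫⁻ η : F, ballProb (0 : E) (c * ‖η‖ ^ 2) ∂(gauss F)
      < ∫⁻ η : F, ENNReal.ofReal (‖η‖ ^ 2) * ballProb (0 : E) (c * ‖η‖ ^ 2) ∂(gauss F) := by
  have : Nontrivial E := by
    refine Module.nontrivial_of_finrank_pos (R := ℝ) ?_
    have : (0 : ℝ) < Module.finrank ℝ E := by linarith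
    exact_mod_cast this
  have hb : 0 < (Module.finrank ℝ F : ℝ) / 2 := by
    have : 0 < Module.finrank ℝ F := Module.finrank_pos
    positivity
  obtain ⟨k, hk0, hk1, hk⟩ := exists_lintegral_norm_sq_pow_mul_ballProb (E := E) (F := F) hc
  have h0 := hk 0
  have h1 := hk 1
  rw [hEa] at h0 h1
  set b : ℝ := (Module.finrank ℝ F : ℝ) / 2 with hb_def
  simp only [pow_zero, ENNReal.ofReal_one, one_mul, Nat.cast_zero, add_zero, pow_one,
    Nat.cast_one] at h0 h1
  have hr0 := eulerRatio_pos b (by linarith : 0 < a + 1) hc.le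
  have hr1 := eulerRatio_succ_lt (b := b) ha hc.le
  have hr2 := eulerRatio_pos b ha hc.le
  have hI := eulerInt_pos (by linarith : 0 < a + 1) hc.le (a + 1 + b)
  have hG := Real.Gamma_pos_of_pos (by positivity : 0 < a + 1 + b)
  rw [h0, h1, mul_left_comm, ← ENNReal.ofReal_mul (by positivity),
    ENNReal.mul_lt_mul_iff_right hk0 hk1]
  refine (ENNReal.ofReal_lt_ofReal_iff_of_nonneg (by positivity)).2 ?_
  -- The exact ratio of the two integrals is `2 (b + 1/N)` with `N` taken at `a + 1`;
  -- `eulerRatio_succ_lt` makes it larger than the value at `a`.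
  have h2 := mul_eulerInt_div (a := a + 1) (b := b) (by linarith) hc.le
  rw [Real.Gamma_add_one (by positivity)]
  have h3 : 2 * ((a + 1 + b) * Real.Gamma (a + 1 + b)) * eulerInt (a + 1) (a + 1 + b + 1) c
      = 2 * (b + (eulerRatio (a + 1) b c)⁻¹) * (Real.Gamma (a + 1 + b) *
        eulerInt (a + 1) (a + 1 + b) c) := by
    linear_combination 2 * Real.Gamma (a + 1 + b) * h2
  rw [h3]
  have h4 := inv_strictAnti₀ hr0 hr1
  gcongr

/-- The noncentral version of `lt_lintegral_mul_ballProb_zero`. -/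
lemma le_lintegral_mul_ballProb [Nontrivial F] {a c : ℝ} (ha : 0 < a) (hc : 0 < c)
    (hEa : (Module.finrank ℝ E : ℝ) / 2 = a + 1) (θ : E) :
    ENNReal.ofReal (2 * ((Module.finrank ℝ F : ℝ) / 2 +
        (eulerRatio a ((Module.finrank ℝ F : ℝ) / 2) c)⁻¹)) *
      ∫⁻ η : F, ballProb θ (c * ‖η‖ ^ 2) ∂(gauss F)
      ≤ ∫⁻ η : F, ENNReal.ofReal (‖η‖ ^ 2) * ballProb θ (c * ‖η‖ ^ 2) ∂(gauss F) := by
  have : Nontrivial E := by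
    refine Module.nontrivial_of_finrank_pos (R := ℝ) ?_
    have : (0 : ℝ) < Module.finrank ℝ E := by linarith
    exact_mod_cast this
  have hzero := (lt_lintegral_mul_ballProb_zero (F := F) ha hc hEa).le
  have hr := eulerRatio_pos ((Module.finrank ℝ F : ℝ) / 2) ha hc.le
  set κ : ℝ := 2 * ((Module.finrank ℝ F : ℝ) / 2 +
    (eulerRatio a ((Module.finrank ℝ F : ℝ) / 2) c)⁻¹) with hκ_def
  have hκ : 0 < κ := by positivity
  set A := ballProb θ (c * κ)
  set B := ballProb (0 : E) (c * κ)
  have hB0 : B ≠ 0 := ballProb_zero_ne_zero (by positivity)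
  -- `A/B` is the ratio of noncentral to central probability at the threshold `‖η‖² = κ`. As the
  -- ratio increases in `‖η‖²`, its deviation from `A/B` has the sign of `‖η‖² - κ`; the inequality
  -- is the product of the two, without quotients or subtraction.
  have hpt : ∀ η : F,
      B * (ENNReal.ofReal κ * ballProb θ (c * ‖η‖ ^ 2)) +
        A * (ENNReal.ofReal (‖η‖ ^ 2) * ballProb (0 : E) (c * ‖η‖ ^ 2))
      ≤ B * (ENNReal.ofReal (‖η‖ ^ 2) * ballProb θ (c * ‖η‖ ^ 2)) +
        A * (ENNReal.ofReal κ * ballProb (0 : E) (c * ‖η‖ ^ 2)) := by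
    intro η
    rcases le_total (‖η‖ ^ 2) κ with h | h
    · have h1 := ballProb_mul_le θ (mul_le_mul_of_nonneg_left h hc.le)
      have := ennreal_rearrangement (ENNReal.ofReal_le_ofReal h) h1
      calc _ = ENNReal.ofReal (‖η‖ ^ 2) * (A * ballProb (0 : E) (c * ‖η‖ ^ 2)) +
            ENNReal.ofReal κ * (ballProb θ (c * ‖η‖ ^ 2) * B) := by ring
        _ ≤ _ := this
        _ = _ := by ring
    · have h1 := ballProb_mul_le θ (mul_le_mul_of_nonneg_left h hc.le)
      have := ennreal_rearrangement (ENNReal.ofReal_le_ofReal h) h1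
      calc _ = ENNReal.ofReal κ * (ballProb θ (c * ‖η‖ ^ 2) * B) +
            ENNReal.ofReal (‖η‖ ^ 2) * (A * ballProb (0 : E) (c * ‖η‖ ^ 2)) := by ring
        _ ≤ _ := this
        _ = _ := by ring
  have hsum := lintegral_mono (μ := gauss F) hpt
  rw [lintegral_add_left (by fun_prop), lintegral_add_left (by fun_prop),
    lintegral_const_mul _ (by fun_prop), lintegral_const_mul _ (by fun_prop),
    lintegral_const_mul _ (by fun_prop), lintegral_const_mul _ (by fun_prop),
    lintegral_const_mul _ (by fun_prop), lintegral_const_mul _ (by fun_prop)] at hsum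
  have hfin : A * (ENNReal.ofReal κ * ∫⁻ η : F, ballProb (0 : E) (c * ‖η‖ ^ 2) ∂(gauss F)) ≠ ∞ := by
    refine ENNReal.mul_ne_top (ballProb_ne_top _ _)
      (ENNReal.mul_ne_top ENNReal.ofReal_ne_top ?_)
    refine ne_top_of_le_ne_top ENNReal.one_ne_top
      ((lintegral_mono fun η => ballProb_le_one _ _).trans ?_)
    simp
  -- The central inequality allows the two terms with the factor `A` to be cancelled.
  have h2 := (add_le_add le_rfl (mul_le_mul_right hzero A)).trans hsum
  have h3 := (ENNReal.add_le_add_iff_right hfin).1 h2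
  exact (ENNReal.mul_le_mul_iff_right hB0 (ballProb_ne_top _ _)).1 h3

end Ball

/-! ### Mixing over the random scale -/

/-- Integrate `(v - 1)(f v - f 1) ≥ 0`; the terms in `f 1` cancel because `v` has mean one. -/
lemma lintegral_mul_mono_of_mean_one {G : Measure ℝ} (hG : IsMixingLaw G) {f : ℝ → ℝ≥0∞}
    (hf : Measurable f) (hmono : ∀ v w, 0 < v → v ≤ w → f v ≤ f w) (h1 : f 1 ≠ ∞) :
    ∫⁻ v, f v ∂G ≤ ∫⁻ v, ENNReal.ofReal v * f v ∂G := by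
  have := hG.prob
  have hpt : ∀ᵐ v ∂G, f v + ENNReal.ofReal v * f 1 ≤ ENNReal.ofReal v * f v + f 1 := by
    filter_upwards [hG.pos] with v hv
    rcases le_total v 1 with h | h
    · have h2 := ennreal_rearrangement (ENNReal.ofReal_le_ofReal h) (hmono v 1 hv h)
      rw [ENNReal.ofReal_one, one_mul, one_mul, add_comm] at h2
      exact h2
    · have h2 := ennreal_rearrangement (ENNReal.ofReal_le_ofReal h) (hmono 1 v one_pos h)
      rw [ENNReal.ofReal_one, one_mul, one_mul, add_comm (f 1)] at h2
      exact h2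
  have h3 := lintegral_mono_ae hpt
  rw [lintegral_add_left hf, lintegral_add_left (by fun_prop), lintegral_mul_const _ (by fun_prop),
    hG.mean_one, one_mul, lintegral_const, measure_univ, mul_one] at h3
  exact (ENNReal.add_le_add_iff_right h1).1 h3

section Mixture

variable {p m : ℕ}

lemma measurableSet_ratio_le (θ : EuclideanSpace ℝ (Fin p)) (s c : ℝ) :
    MeasurableSet {ω : ℝ × ℝ × EuclideanSpace ℝ (Fin p) × EuclideanSpace ℝ (Fin m) |
      ‖θ + √(s * ω.1) • ω.2.2.1‖ ^ 2 ≤ c * ‖√(s * ω.1) • ω.2.2.2‖ ^ 2} :=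
  measurableSet_le (by fun_prop) (by fun_prop)

/-- Given `v` and `η`, dividing the event by the scale `√(s v)` turns it into a ball event for `ζ₁`
with centre `θ/√(s v)`. -/
lemma setLIntegral_ratio_le {G : Measure ℝ} (hG : IsMixingLaw G)
    (θ : EuclideanSpace ℝ (Fin p)) {s : ℝ} (hs : 0 < s) (c : ℝ) {h : ℝ × ℝ → ℝ≥0∞}
    (hh : Measurable h) :
    ∫⁻ ω in {ω : ℝ × ℝ × EuclideanSpace ℝ (Fin p) × EuclideanSpace ℝ (Fin m) |
      ‖θ + √(s * ω.1) • ω.2.2.1‖ ^ 2 ≤ c * ‖√(s * ω.1) • ω.2.2.2‖ ^ 2},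
        h (ω.1, ‖ω.2.2.2‖ ^ 2) ∂(latentLaw p m G)
      = ∫⁻ v, ∫⁻ η : EuclideanSpace ℝ (Fin m), h (v, ‖η‖ ^ 2) *
          ballProb ((√(s * v))⁻¹ • θ) (c * ‖η‖ ^ 2) ∂(gauss _) ∂G := by
  have := hG.prob
  have hm := measurableSet_ratio_le (m := m) θ s c
  rw [← lintegral_indicator hm, lintegral_latentLaw G (Measurable.indicator (by fun_prop) hm)]
  refine lintegral_congr_ae ?_
  filter_upwards [hG.pos] with v hv
  have hr : 0 < √(s * v) := Real.sqrt_pos.2 (by positivity)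
  refine (lintegral_congr fun ζ₀ => ?_).trans (b := ∫⁻ _ : ℝ, ∫⁻ η : EuclideanSpace ℝ (Fin m),
    h (v, ‖η‖ ^ 2) * ballProb ((√(s * v))⁻¹ • θ) (c * ‖η‖ ^ 2) ∂(gauss _) ∂(gauss ℝ)) (by simp)
  rw [lintegral_lintegral_swap]
  · refine lintegral_congr fun η => ?_
    rw [ballProb, ← setLIntegral_const, ← lintegral_indicator (measurableSet_ball_sq _ _)]
    refine lintegral_congr fun ζ => ?_
    have hiff : ‖θ + √(s * v) • ζ‖ ^ 2 ≤ c * ‖√(s * v) • η‖ ^ 2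
        ↔ ‖(√(s * v))⁻¹ • θ + ζ‖ ^ 2 ≤ c * ‖η‖ ^ 2 := by
      have e1 : θ + √(s * v) • ζ = √(s * v) • ((√(s * v))⁻¹ • θ + ζ) := by
        rw [smul_add, smul_inv_smul₀ hr.ne']
      rw [e1, norm_smul, norm_smul, mul_pow, mul_pow, mul_left_comm]
      refine mul_le_mul_iff_right₀ ?_
      have := norm_pos_iff.2 hr.ne'
      positivity
    simp only [Set.indicator, Set.mem_ofPred_eq, hiff]
  · refine Measurable.aemeasurable ?_
    have h2 := Measurable.indicator (f := fun ω : ℝ × ℝ × EuclideanSpace ℝ (Fin p) ×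
      EuclideanSpace ℝ (Fin m) => h (ω.1, ‖ω.2.2.2‖ ^ 2)) (by fun_prop) hm
    refine Measurable.comp h2 (f := fun q : EuclideanSpace ℝ (Fin p) × EuclideanSpace ℝ (Fin m) =>
      (v, ζ₀, q)) ?_
    fun_prop

/-- Given `v`, `le_lintegral_mul_ballProb` bounds the mean of `‖η‖²` on the event by `κ` times its
probability `f v`. Since `θ/√(s v)` moves towards the origin, `f` increases, so weighting by `v`
does not decrease the integral of `f`. -/
lemma setLIntegral_const_le_of_ratio [NeZero m] {G : Measure ℝ} (hG : IsMixingLaw G) {a c : ℝ}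
    (ha : 0 < a) (hc : 0 < c) (hpa : (p : ℝ) / 2 = a + 1)
    (θ : EuclideanSpace ℝ (Fin p)) {s : ℝ} (hs : 0 < s) :
    ∫⁻ _ω in {ω : ℝ × ℝ × EuclideanSpace ℝ (Fin p) × EuclideanSpace ℝ (Fin m) |
      ‖θ + √(s * ω.1) • ω.2.2.1‖ ^ 2 ≤ c * ‖√(s * ω.1) • ω.2.2.2‖ ^ 2},
        ENNReal.ofReal (2 * ((m : ℝ) / 2 + (eulerRatio a ((m : ℝ) / 2) c)⁻¹)) ∂(latentLaw p m G)
      ≤ ∫⁻ ω in {ω : ℝ × ℝ × EuclideanSpace ℝ (Fin p) × EuclideanSpace ℝ (Fin m) |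
      ‖θ + √(s * ω.1) • ω.2.2.1‖ ^ 2 ≤ c * ‖√(s * ω.1) • ω.2.2.2‖ ^ 2},
        ENNReal.ofReal ω.1 * ENNReal.ofReal (‖ω.2.2.2‖ ^ 2) ∂(latentLaw p m G) := by
  have := hG.prob
  set κ : ℝ := 2 * ((m : ℝ) / 2 + (eulerRatio a ((m : ℝ) / 2) c)⁻¹) with hκ
  rw [setLIntegral_ratio_le hG θ hs c (h := fun _ => ENNReal.ofReal κ) measurable_const,
    setLIntegral_ratio_le hG θ hs c
      (h := fun q => ENNReal.ofReal q.1 * ENNReal.ofReal q.2) (by fun_prop)]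
  have hkey := fun v : ℝ => le_lintegral_mul_ballProb (F := EuclideanSpace ℝ (Fin m)) ha hc
    (by rwa [finrank_euclideanSpace, Fintype.card_fin]) ((√(s * v))⁻¹ • θ)
  simp only [finrank_euclideanSpace, Fintype.card_fin, ← hκ] at hkey
  set f : ℝ → ℝ≥0∞ := fun v => ∫⁻ η : EuclideanSpace ℝ (Fin m),
    ballProb ((√(s * v))⁻¹ • θ) (c * ‖η‖ ^ 2) ∂(gauss _) with hf
  have hfm : Measurable f := Measurable.lintegral_prod_right'
    (f := fun q : ℝ × EuclideanSpace ℝ (Fin m) =>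
      ballProb ((√(s * q.1))⁻¹ • θ) (c * ‖q.2‖ ^ 2)) (by fun_prop)
  have hmono : ∀ v w, 0 < v → v ≤ w → f v ≤ f w := by
    intro v w hv hvw
    refine lintegral_mono fun η => ballProb_smul_antitone θ _ (by positivity) ?_
    have := Real.sqrt_pos.2 (mul_pos hs hv)
    gcongr
  have hf1 : f 1 ≠ ∞ := by
    refine ne_top_of_le_ne_top ENNReal.one_ne_top
      ((lintegral_mono fun η => ballProb_le_one _ _).trans ?_)
    simp
  calc ∫⁻ v, ∫⁻ η : EuclideanSpace ℝ (Fin m), ENNReal.ofReal κ *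
          ballProb ((√(s * v))⁻¹ • θ) (c * ‖η‖ ^ 2) ∂(gauss _) ∂G
      = ENNReal.ofReal κ * ∫⁻ v, f v ∂G := by
        rw [← lintegral_const_mul _ hfm]
        exact lintegral_congr fun v => lintegral_const_mul _ (by fun_prop)
    _ ≤ ENNReal.ofReal κ * ∫⁻ v, ENNReal.ofReal v * f v ∂G := by
        exact mul_le_mul_right (lintegral_mul_mono_of_mean_one hG hfm hmono hf1) _
    _ = ∫⁻ v, ENNReal.ofReal v * (ENNReal.ofReal κ * f v) ∂G := by
        rw [← lintegral_const_mul _ (by fun_prop)]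
        exact lintegral_congr fun v => mul_left_comm _ _ _
    _ ≤ _ := by
        refine lintegral_mono fun v => ?_
        refine (mul_le_mul_right (hkey v) _).trans ?_
        rw [← lintegral_const_mul _ (by fun_prop)]
        exact (lintegral_congr fun η => (mul_assoc _ _ _).symm).le

/-- For the centre 0 the event does not depend on `v`, so the factor `v` integrates to one and the
strict central inequality survives. -/
lemma setLIntegral_const_lt_of_ratio [NeZero m] {G : Measure ℝ} (hG : IsMixingLaw G) {a c : ℝ}
    (ha : 0 < a) (hc : 0 < c) (hpa : (p : ℝ) / 2 = a + 1) {s : ℝ} (hs : 0 < s) :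
    ∫⁻ _ω in {ω : ℝ × ℝ × EuclideanSpace ℝ (Fin p) × EuclideanSpace ℝ (Fin m) |
      ‖0 + √(s * ω.1) • ω.2.2.1‖ ^ 2 ≤ c * ‖√(s * ω.1) • ω.2.2.2‖ ^ 2},
        ENNReal.ofReal (2 * ((m : ℝ) / 2 + (eulerRatio a ((m : ℝ) / 2) c)⁻¹)) ∂(latentLaw p m G)
      < ∫⁻ ω in {ω : ℝ × ℝ × EuclideanSpace ℝ (Fin p) × EuclideanSpace ℝ (Fin m) |
      ‖0 + √(s * ω.1) • ω.2.2.1‖ ^ 2 ≤ c * ‖√(s * ω.1) • ω.2.2.2‖ ^ 2},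
        ENNReal.ofReal ω.1 * ENNReal.ofReal (‖ω.2.2.2‖ ^ 2) ∂(latentLaw p m G) := by
  have := hG.prob
  set κ : ℝ := 2 * ((m : ℝ) / 2 + (eulerRatio a ((m : ℝ) / 2) c)⁻¹) with hκ
  rw [setLIntegral_ratio_le hG 0 hs c (h := fun _ => ENNReal.ofReal κ) measurable_const,
    setLIntegral_ratio_le hG 0 hs c
      (h := fun q => ENNReal.ofReal q.1 * ENNReal.ofReal q.2) (by fun_prop)]
  have hkey := lt_lintegral_mul_ballProb_zero (E := EuclideanSpace ℝ (Fin p))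
    (F := EuclideanSpace ℝ (Fin m)) ha hc (by rwa [finrank_euclideanSpace, Fintype.card_fin])
  simp only [finrank_euclideanSpace, Fintype.card_fin, ← hκ] at hkey
  simp only [smul_zero, mul_assoc]
  rw [lintegral_const, measure_univ, mul_one, lintegral_const_mul _ (by fun_prop)]
  refine hkey.trans_le (le_of_eq ?_)
  calc _ = (∫⁻ v, ENNReal.ofReal v ∂G) * ∫⁻ η : EuclideanSpace ℝ (Fin m),
        ENNReal.ofReal (‖η‖ ^ 2) * ballProb (0 : EuclideanSpace ℝ (Fin p)) (c * ‖η‖ ^ 2)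
          ∂(gauss _) := by rw [hG.mean_one, one_mul]
    _ = _ := by
        rw [← lintegral_mul_const _ (by fun_prop)]
        exact lintegral_congr fun v => (lintegral_const_mul _ (by fun_prop)).symm

end Mixture

/-! ### Comparing two multiples of the same statistic -/

lemma setLIntegral_Ioo_indicator_Ici {x₀ φ : ℝ} (h0 : x₀ ≤ φ) (f : ℝ → ℝ≥0∞) :
    ∫⁻ x in Set.Ioo x₀ 1, Set.indicator (Set.Ici φ) f x = ∫⁻ x in Set.Ioc φ 1, f x := by
  rw [setLIntegral_indicator measurableSet_Ici]
  refine setLIntegral_congr ?_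
  filter_upwards [compl_mem_ae_iff.2 (measure_singleton φ), compl_mem_ae_iff.2
    (measure_singleton (1 : ℝ))] with x hx hx1
  refine propext ⟨fun h => ⟨lt_of_le_of_ne h.1 (Ne.symm hx), h.2.2.le⟩, fun h => ⟨h.1.le,
    h0.trans_lt h.1, lt_of_le_of_ne h.2 hx1⟩⟩

lemma setLIntegral_inv_indicator_Ici {x₀ φ : ℝ} (hx : 0 < x₀) (h0 : x₀ ≤ φ) (h1 : φ ≤ 1) :
    ∫⁻ x in Set.Ioo x₀ 1, Set.indicator (Set.Ici φ) (fun x => ENNReal.ofReal x⁻¹) x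
      = ENNReal.ofReal (-Real.log φ) := by
  have hφ : 0 < φ := hx.trans_le h0
  have hint : IntervalIntegrable (fun x : ℝ => x⁻¹) volume φ 1 := by
    refine intervalIntegral.intervalIntegrable_inv (fun x hx => ?_) continuousOn_id
    rw [Set.uIcc_of_le h1] at hx
    exact (hφ.trans_le hx.1).ne'
  have h2 := integral_inv_of_pos hφ one_pos
  rw [setLIntegral_Ioo_indicator_Ici h0, ← Real.log_inv, ← one_div, ← h2,
    intervalIntegral.integral_of_le h1, ofReal_integral_eq_lintegral_ofReal
    ((intervalIntegrable_iff_integrableOn_Ioc_of_le h1).1 hint)]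
  filter_upwards [ae_restrict_mem measurableSet_Ioc] with x hx
  exact (inv_pos.2 (hφ.trans hx.1)).le

section Compare

variable {Ω : Type*} [MeasurableSpace Ω] {P : Measure Ω} {W φ : Ω → ℝ} {x₀ : ℝ}

/-- Layer cake: `-log φ` is the integral of `1/x` over `[φ, 1]`, and Tonelli exchanges the
integrals. `lintegral_one_sub_mul_eq` does the same for `1 - φ`. -/
lemma lintegral_neg_log_eq [SFinite P] (hφm : Measurable φ) (hx : 0 < x₀)
    (hφ : ∀ᵐ ω ∂P, x₀ ≤ φ ω ∧ φ ω ≤ 1) :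
    ∫⁻ ω, ENNReal.ofReal (-Real.log (φ ω)) ∂P
      = ∫⁻ x in Set.Ioo x₀ 1, ∫⁻ _ω in {ω | φ ω ≤ x}, ENNReal.ofReal x⁻¹ ∂P := by
  have hS : MeasurableSet {q : Ω × ℝ | φ q.1 ≤ q.2} := measurableSet_le (by fun_prop) (by fun_prop)
  have e1 : ∫⁻ ω, ENNReal.ofReal (-Real.log (φ ω)) ∂P = ∫⁻ ω, (∫⁻ x in Set.Ioo x₀ 1,
      Set.indicator {q : Ω × ℝ | φ q.1 ≤ q.2} (fun q => ENNReal.ofReal q.2⁻¹) (ω, x)) ∂P := by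
    refine lintegral_congr_ae ?_
    filter_upwards [hφ] with ω hω
    exact (setLIntegral_inv_indicator_Ici hx hω.1 hω.2).symm
  have hI : Measurable (Set.indicator {q : Ω × ℝ | φ q.1 ≤ q.2}
      (fun q : Ω × ℝ => ENNReal.ofReal q.2⁻¹)) := Measurable.indicator (by fun_prop) hS
  rw [e1, lintegral_lintegral_swap (by exact hI.aemeasurable)]
  refine lintegral_congr fun x => ?_
  rw [← lintegral_indicator (measurableSet_le hφm measurable_const)]
  rfl

lemma lintegral_one_sub_mul_eq [SFinite P] (hφm : Measurable φ) (hW : Measurable W)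
    (hφ : ∀ᵐ ω ∂P, x₀ ≤ φ ω ∧ φ ω ≤ 1) :
    ∫⁻ ω, ENNReal.ofReal ((1 - φ ω) * W ω) ∂P
      = ∫⁻ x in Set.Ioo x₀ 1, ∫⁻ ω in {ω | φ ω ≤ x}, ENNReal.ofReal (W ω) ∂P := by
  have hS : MeasurableSet {q : Ω × ℝ | φ q.1 ≤ q.2} := measurableSet_le (by fun_prop) (by fun_prop)
  have e1 : ∫⁻ ω, ENNReal.ofReal ((1 - φ ω) * W ω) ∂P = ∫⁻ ω, (∫⁻ x in Set.Ioo x₀ 1,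
      Set.indicator {q : Ω × ℝ | φ q.1 ≤ q.2} (fun q => ENNReal.ofReal (W q.1)) (ω, x)) ∂P := by
    refine lintegral_congr_ae ?_
    filter_upwards [hφ] with ω hω
    have := setLIntegral_Ioo_indicator_Ici hω.1 (fun _ => ENNReal.ofReal (W ω))
    rw [setLIntegral_const, Real.volume_Ioc, mul_comm,
      ← ENNReal.ofReal_mul (by linarith [hω.2])] at this
    exact this.symm
  have hI : Measurable (Set.indicator {q : Ω × ℝ | φ q.1 ≤ q.2}
      (fun q : Ω × ℝ => ENNReal.ofReal (W q.1))) := Measurable.indicator (by fun_prop) hS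
  rw [e1, lintegral_lintegral_swap (by exact hI.aemeasurable)]
  refine lintegral_congr fun x => ?_
  rw [← lintegral_indicator (measurableSet_le hφm measurable_const)]
  rfl

lemma measurable_setLIntegral_le [SFinite P] (hφm : Measurable φ) {h : Ω × ℝ → ℝ≥0∞}
    (hh : Measurable h) : Measurable fun x => ∫⁻ ω in {ω | φ ω ≤ x}, h (ω, x) ∂P := by
  have hS : MeasurableSet {q : Ω × ℝ | φ q.1 ≤ q.2} := measurableSet_le (by fun_prop) (by fun_prop)
  have e1 : (fun x => ∫⁻ ω in {ω | φ ω ≤ x}, h (ω, x) ∂P)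
      = fun x => ∫⁻ ω, Set.indicator {q : Ω × ℝ | φ q.1 ≤ q.2} h (ω, x) ∂P := by
    funext x
    rw [← lintegral_indicator (measurableSet_le hφm measurable_const)]
    rfl
  rw [e1]
  exact Measurable.lintegral_prod_left' (Measurable.indicator hh hS)

/-- Shrinking an estimator with scaled loss argument `W` by the factor `φ` improves it as soon as
every level set `{φ ≤ x}` carries at least the mass `1 / x` of `W` per unit probability. -/
lemma integral_shrink [IsProbabilityMeasure P] (hφm : Measurable φ) (hWm : Measurable W)
    (hx : 0 < x₀) (hx1 : x₀ < 1) (hφ : ∀ᵐ ω ∂P, x₀ ≤ φ ω ∧ φ ω ≤ 1) (hW : ∀ᵐ ω ∂P, 0 ≤ W ω)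
    (hWfin : ∫⁻ ω, ENNReal.ofReal (W ω) ∂P ≠ ∞)
    (hle : ∀ x, x₀ < x → x < 1 → ∫⁻ _ω in {ω | φ ω ≤ x}, ENNReal.ofReal x⁻¹ ∂P
      ≤ ∫⁻ ω in {ω | φ ω ≤ x}, ENNReal.ofReal (W ω) ∂P) :
    Integrable (fun ω => (1 - φ ω) * W ω + Real.log (φ ω)) P ∧
    0 ≤ ∫ ω, ((1 - φ ω) * W ω + Real.log (φ ω)) ∂P ∧
    ((∀ x, x₀ < x → x < 1 → ∫⁻ _ω in {ω | φ ω ≤ x}, ENNReal.ofReal x⁻¹ ∂P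
      < ∫⁻ ω in {ω | φ ω ≤ x}, ENNReal.ofReal (W ω) ∂P) →
      0 < ∫ ω, ((1 - φ ω) * W ω + Real.log (φ ω)) ∂P) := by
  have e1 := lintegral_neg_log_eq hφm hx hφ
  have e2 := lintegral_one_sub_mul_eq (P := P) hφm hWm hφ
  have lm : AEStronglyMeasurable (fun ω => -Real.log (φ ω)) P :=
    (Real.measurable_log.comp hφm).neg.aestronglyMeasurable
  have n1 : 0 ≤ᵐ[P] fun ω => -Real.log (φ ω) := by
    filter_upwards [hφ] with ω hω
    exact neg_nonneg.2 (Real.log_nonpos (hx.le.trans hω.1) hω.2)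
  have n2 : 0 ≤ᵐ[P] fun ω => (1 - φ ω) * W ω := by
    filter_upwards [hφ, hW] with ω hω hWω
    exact mul_nonneg (by linarith [hω.2]) hWω
  have f2 : ∫⁻ ω, ENNReal.ofReal ((1 - φ ω) * W ω) ∂P ≠ ∞ := by
    refine ne_top_of_le_ne_top hWfin (lintegral_mono_ae ?_)
    filter_upwards [hφ, hW] with ω hω hWω
    refine ENNReal.ofReal_le_ofReal (mul_le_of_le_one_left hWω ?_)
    linarith [hω.1]
  have h12 : ∫⁻ ω, ENNReal.ofReal (-Real.log (φ ω)) ∂P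
      ≤ ∫⁻ ω, ENNReal.ofReal ((1 - φ ω) * W ω) ∂P := by
    rw [e1, e2]
    exact setLIntegral_mono' measurableSet_Ioo fun x hx => hle x hx.1 hx.2
  -- The comparison itself supplies integrability of the logarithmic term.
  have f1 := ne_top_of_le_ne_top f2 h12
  have i1 : Integrable (fun ω => -Real.log (φ ω)) P :=
    integrable_of_lintegral_ofReal_ne_top lm n1 f1
  have i2 : Integrable (fun ω => (1 - φ ω) * W ω) P :=
    integrable_of_lintegral_ofReal_ne_top (by fun_prop) n2 f2
  have i3 : Integrable (fun ω => Real.log (φ ω)) P := by simpa using i1.neg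
  have hval : ∫ ω, ((1 - φ ω) * W ω + Real.log (φ ω)) ∂P
      = (∫⁻ ω, ENNReal.ofReal ((1 - φ ω) * W ω) ∂P).toReal
        - (∫⁻ ω, ENNReal.ofReal (-Real.log (φ ω)) ∂P).toReal := by
    rw [integral_add i2 i3, ← integral_eq_lintegral_of_nonneg_ae n2 (by fun_prop),
      ← integral_eq_lintegral_of_nonneg_ae n1 lm, integral_neg]
    ring
  refine ⟨i2.add i3, ?_, fun hlt => ?_⟩
  · rw [hval, sub_nonneg]
    exact ENNReal.toReal_mono f2 h12
  · rw [hval, sub_pos]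
    refine (ENNReal.toReal_lt_toReal f1 f2).2 ?_
    rw [e1] at f1 ⊢
    rw [e2]
    refine lintegral_strict_mono ?_ ?_ f1 ?_
    · rw [Ne, Measure.restrict_eq_zero, Real.volume_Ioo, ENNReal.ofReal_eq_zero, not_le]
      linarith
    · exact (measurable_setLIntegral_le hφm (h := fun q => ENNReal.ofReal (W q.1))
        (by fun_prop)).aemeasurable
    · filter_upwards [ae_restrict_mem measurableSet_Ioo] with x hx using hlt x hx.1 hx.2

end Compare

/-! ### Risk comparison in the linear model -/

lemma measurable_integral_rpow_mul (k q : ℝ) :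
    Measurable fun r : ℝ => ∫ t in (0 : ℝ)..1, t ^ k * (1 - r * t) ^ q := by
  simp only [intervalIntegral.integral_of_le zero_le_one]
  refine (StronglyMeasurable.integral_prod_right
    (f := fun r t : ℝ => t ^ k * (1 - r * t) ^ q) ?_).measurable
  refine Measurable.stronglyMeasurable ?_
  simp only [Function.uncurry_def]
  fun_prop

lemma measurable_phiH (n p : ℕ) : Measurable (phiH n p) := by
  unfold phiH
  exact measurable_const.mul
    ((measurable_integral_rpow_mul _ _).div (measurable_integral_rpow_mul _ _))

namespace CanonicalCoords

variable {n p : ℕ} {X : Matrix (Fin n) (Fin p) ℝ}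

lemma measurable_deltaU (c : CanonicalCoords X) (hn : p + 1 < n) : Measurable (deltaU X) := by
  have := c.e.measurable
  simp only [funext (c.deltaU_eq hn)]
  fun_prop

lemma measurable_Rsq (c : CanonicalCoords X) (hn : p + 1 < n) : Measurable (Rsq X) := by
  have := c.e.measurable
  simp only [funext (c.Rsq_eq (by omega : n ≠ 0))]
  fun_prop

lemma measurable_deltaH (c : CanonicalCoords X) (hn : p + 1 < n) : Measurable (deltaH X) :=
  ((measurable_phiH n p).comp (c.measurable_Rsq hn)).mul (c.measurable_deltaU hn)

lemma phiH_Rsq_eq (c : CanonicalCoords X) (hp : 3 ≤ p) (hn : p + 1 < n) {y : Fin n → ℝ}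
    (hS : 0 < ‖(c.e y).2.2‖ ^ 2) :
    phiH n p (Rsq X y) = shrink ((p : ℝ) / 2 - 1) (((n - p - 1 : ℕ) : ℝ) / 2)
      (‖(c.e y).2.1‖ ^ 2 / ‖(c.e y).2.2‖ ^ 2) := by
  have hm : ((n - p - 1 : ℕ) : ℝ) = n - p - 1 := by
    rw [Nat.sub_sub, Nat.cast_sub hn.le]; push_cast; ring
  rw [hm, c.Rsq_eq (by omega), ← phiH_eq_shrink hp hn (by positivity)]
  congr 1
  rw [one_add_div hS.ne', div_div_div_cancel_right₀ hS.ne', add_comm]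

lemma isProbabilityMeasure_samplingLaw (c : CanonicalCoords X) (hn : p + 1 < n) {G : Measure ℝ}
    (hG : IsMixingLaw G) (α : ℝ) (β : Fin p → ℝ) {s : ℝ} (hs : 0 < s) :
    IsProbabilityMeasure (samplingLaw X G α β s) := by
  have := hG.prob
  rw [c.samplingLaw_eq hn hG α β hs]
  exact Measure.isProbabilityMeasure_map (c.measurable_observe α β s).aemeasurable

lemma ae_samplingLaw_residual_pos (c : CanonicalCoords X) (hn : p + 1 < n) (G : Measure ℝ)
    (α : ℝ) (β : Fin p → ℝ) (s : ℝ) :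
    ∀ᵐ y ∂(samplingLaw X G α β s), 0 < ‖(c.e y).2.2‖ ^ 2 :=
  (withDensity_absolutelyContinuous _ _).ae_le (c.ae_residual_pos hn)

lemma deltaU_pos (c : CanonicalCoords X) (hn : p + 1 < n) {y : Fin n → ℝ}
    (hS : 0 < ‖(c.e y).2.2‖ ^ 2) : 0 < deltaU X y := by
  have hn' : (p : ℝ) + 1 < n := by exact_mod_cast hn
  rw [c.deltaU_eq hn]
  exact div_pos hS (by linarith)

lemma deltaU_observe_div (c : CanonicalCoords X) (hn : p + 1 < n) (α : ℝ) (β : Fin p → ℝ)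
    {s : ℝ} (hs : 0 < s)
    {ω : ℝ × ℝ × EuclideanSpace ℝ (Fin p) × EuclideanSpace ℝ (Fin (n - p - 1))} (hω : 0 < ω.1) :
    deltaU X (c.observe α β s ω) / s = ((n - p - 1 : ℕ) : ℝ)⁻¹ * (ω.1 * ‖ω.2.2.2‖ ^ 2) := by
  have hm : ((n - p - 1 : ℕ) : ℝ) = n - p - 1 := by
    rw [Nat.sub_sub, Nat.cast_sub hn.le]; push_cast; ring
  rw [c.deltaU_eq hn, ← hm, observe, MeasurableEquiv.apply_symm_apply]
  simp only
  rw [norm_smul, mul_pow, Real.norm_eq_abs, sq_abs, Real.sq_sqrt (by positivity)]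
  field_simp

lemma ae_latentLaw_fst_pos {m : ℕ} {G : Measure ℝ} (hG : IsMixingLaw G) :
    ∀ᵐ ω ∂(latentLaw p m G), 0 < ω.1 :=
  Measure.quasiMeasurePreserving_fst.ae hG.pos

/-- Unbiasedness: the factors `v` and `‖η‖²` are independent with means 1 and `n - p - 1`. -/
lemma lintegral_deltaU_div (c : CanonicalCoords X) (hn : p + 1 < n) {G : Measure ℝ}
    (hG : IsMixingLaw G) (α : ℝ) (β : Fin p → ℝ) {s : ℝ} (hs : 0 < s) :
    ∫⁻ y, ENNReal.ofReal (deltaU X y / s) ∂(samplingLaw X G α β s) = 1 := by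
  have := hG.prob
  have : NeZero (n - p - 1) := ⟨by omega⟩
  have hm0 : ((n - p - 1 : ℕ) : ℝ≥0∞) ≠ 0 := by exact_mod_cast NeZero.ne _
  have hU := c.measurable_deltaU hn
  have e1 : ∀ᵐ ω ∂(latentLaw p (n - p - 1) G),
      ENNReal.ofReal (deltaU X (c.observe α β s ω) / s)
      = ((n - p - 1 : ℕ) : ℝ≥0∞)⁻¹ * (ENNReal.ofReal ω.1 * ENNReal.ofReal (‖ω.2.2.2‖ ^ 2)) := by
    filter_upwards [ae_latentLaw_fst_pos hG] with ω hω
    rw [c.deltaU_observe_div hn α β hs hω, ENNReal.ofReal_mul (by positivity),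
      ENNReal.ofReal_mul hω.le, ENNReal.ofReal_inv_of_pos (by
        exact_mod_cast Nat.pos_of_ne_zero (NeZero.ne _)), ENNReal.ofReal_natCast]
  rw [c.samplingLaw_eq hn hG α β hs, lintegral_map (by fun_prop) (by fun_prop),
    lintegral_congr_ae e1, lintegral_const_mul _ (by fun_prop), lintegral_latentLaw _ (by fun_prop)]
  have e2 : ∀ v : ℝ, ∫⁻ η : EuclideanSpace ℝ (Fin (n - p - 1)),
      ENNReal.ofReal v * ENNReal.ofReal (‖η‖ ^ 2) ∂(gauss _)
      = ENNReal.ofReal v * ((n - p - 1 : ℕ) : ℝ≥0∞) := by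
    intro v
    rw [lintegral_const_mul _ (by fun_prop), lintegral_gauss_norm_sq_self,
      finrank_euclideanSpace, Fintype.card_fin]
  simp only [e2, lintegral_const, measure_univ, mul_one]
  rw [lintegral_mul_const _ (by fun_prop), hG.mean_one, one_mul,
    ENNReal.inv_mul_cancel hm0 (ENNReal.natCast_ne_top _)]

/-- Since the shrinkage factor increases in `U/S`, its sublevel set at `x` is `U ≤ r S`, where `r`
solves `shrink = x`. The same equation expresses `1/x` through `N(r)`, so both sides of the
criterion in `integral_shrink` take the form treated by the mixture lemmas. -/
lemma exists_setLIntegral_level (c : CanonicalCoords X) (hp : 3 ≤ p) (hn : p + 1 < n)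
    {G : Measure ℝ} (hG : IsMixingLaw G) (α : ℝ) (β : Fin p → ℝ) {s : ℝ} (hs : 0 < s) {x : ℝ}
    (hx0 : shrink ((p : ℝ) / 2 - 1) (((n - p - 1 : ℕ) : ℝ) / 2) 0 < x) (hx1 : x < 1) :
    ∃ r : ℝ, 0 < r ∧
      ∫⁻ _y in {y | phiH n p (Rsq X y) ≤ x}, ENNReal.ofReal x⁻¹ ∂(samplingLaw X G α β s)
        = ((n - p - 1 : ℕ) : ℝ≥0∞)⁻¹ * ∫⁻ _ω in {ω : ℝ × ℝ × EuclideanSpace ℝ (Fin p) ×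
          EuclideanSpace ℝ (Fin (n - p - 1)) |
          ‖c.A β + √(s * ω.1) • ω.2.2.1‖ ^ 2 ≤ r * ‖√(s * ω.1) • ω.2.2.2‖ ^ 2},
          ENNReal.ofReal (2 * (((n - p - 1 : ℕ) : ℝ) / 2 +
            (eulerRatio ((p : ℝ) / 2 - 1) (((n - p - 1 : ℕ) : ℝ) / 2) r)⁻¹))
          ∂(latentLaw p (n - p - 1) G) ∧
      ∫⁻ y in {y | phiH n p (Rsq X y) ≤ x}, ENNReal.ofReal (deltaU X y / s)
          ∂(samplingLaw X G α β s)
        = ((n - p - 1 : ℕ) : ℝ≥0∞)⁻¹ * ∫⁻ ω in {ω : ℝ × ℝ × EuclideanSpace ℝ (Fin p) ×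
          EuclideanSpace ℝ (Fin (n - p - 1)) |
          ‖c.A β + √(s * ω.1) • ω.2.2.1‖ ^ 2 ≤ r * ‖√(s * ω.1) • ω.2.2.2‖ ^ 2},
          ENNReal.ofReal ω.1 * ENNReal.ofReal (‖ω.2.2.2‖ ^ 2) ∂(latentLaw p (n - p - 1) G) := by
  have hprob := hG.prob
  have : NeZero (n - p - 1) := ⟨by omega⟩
  have hp' : (3 : ℝ) ≤ p := by exact_mod_cast hp
  have hmpos : (0 : ℝ) < ((n - p - 1 : ℕ) : ℝ) := by
    exact_mod_cast Nat.pos_of_ne_zero (NeZero.ne _)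
  have hU := c.measurable_deltaU hn
  have he := c.e.measurable
  set m : ℕ := n - p - 1 with hm_def
  set a : ℝ := (p : ℝ) / 2 - 1 with ha_def
  have ha : 0 < a := by rw [ha_def]; linarith
  have hb : 0 < (m : ℝ) / 2 := by positivity
  have hx : 0 < x := (shrink_pos ha hb le_rfl).trans hx0
  obtain ⟨r, hr0, hrx⟩ := exists_shrink_eq ha hb hx0 hx1
  -- `r = 0` is excluded because `x` lies strictly above the smallest value of the factor.
  have hr : 0 < r := by
    rcases hr0.eq_or_lt with h | h
    · rw [← h] at hrx; exact absurd hrx hx0.ne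
    · exact h
  set D : Set (Fin n → ℝ) := {y | ‖(c.e y).2.1‖ ^ 2 ≤ r * ‖(c.e y).2.2‖ ^ 2} with hD_def
  have hDm : MeasurableSet D := measurableSet_le (by fun_prop) (by fun_prop)
  have hae : {y | phiH n p (Rsq X y) ≤ x} =ᵐ[samplingLaw X G α β s] D := by
    filter_upwards [c.ae_samplingLaw_residual_pos hn G α β s] with y hy
    refine propext ?_
    change phiH n p (Rsq X y) ≤ x ↔ ‖(c.e y).2.1‖ ^ 2 ≤ r * ‖(c.e y).2.2‖ ^ 2
    rw [c.phiH_Rsq_eq hp hn hy, ← hrx,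
      (shrink_strictMonoOn ha hb).le_iff_le (show _ ∈ Set.Ici (0 : ℝ) by
        simp only [Set.mem_Ici]; positivity) hr0, div_le_iff₀ hy]
  have hpre : c.observe α β s ⁻¹' D = {ω : ℝ × ℝ × EuclideanSpace ℝ (Fin p) ×
      EuclideanSpace ℝ (Fin m) |
      ‖c.A β + √(s * ω.1) • ω.2.2.1‖ ^ 2 ≤ r * ‖√(s * ω.1) • ω.2.2.2‖ ^ 2} := by
    ext ω
    simp only [hD_def, observe, Set.mem_preimage, Set.mem_ofPred_eq,
      MeasurableEquiv.apply_symm_apply]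
    rfl
  have hxr : x⁻¹ = (m : ℝ)⁻¹ * (2 * ((m : ℝ) / 2 + (eulerRatio a ((m : ℝ) / 2) r)⁻¹)) := by
    have := eulerRatio_pos ((m : ℝ) / 2) ha hr0
    rw [← hrx, shrink, inv_div]
    field_simp
  have hinv : ENNReal.ofReal (m : ℝ)⁻¹ = (m : ℝ≥0∞)⁻¹ := by
    rw [ENNReal.ofReal_inv_of_pos hmpos, ENNReal.ofReal_natCast]
  refine ⟨r, hr, ?_, ?_⟩
  · rw [setLIntegral_congr hae, c.samplingLaw_eq hn hG α β hs,
      setLIntegral_map hDm measurable_const (c.measurable_observe α β s), hpre, hxr,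
      ENNReal.ofReal_mul (by positivity), hinv, lintegral_const_mul _ measurable_const]
  · rw [setLIntegral_congr hae, c.samplingLaw_eq hn hG α β hs,
      setLIntegral_map hDm (by fun_prop) (c.measurable_observe α β s), hpre,
      ← lintegral_const_mul _ (by fun_prop)]
    refine lintegral_congr_ae (ae_restrict_of_ae ?_)
    filter_upwards [ae_latentLaw_fst_pos hG] with ω hω
    rw [c.deltaU_observe_div hn α β hs hω, ENNReal.ofReal_mul (by positivity),
      ENNReal.ofReal_mul hω.le, hinv]

lemma deltaH_pos (c : CanonicalCoords X) (hp : 3 ≤ p) (hn : p + 1 < n) {y : Fin n → ℝ}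
    (hS : 0 < ‖(c.e y).2.2‖ ^ 2) : 0 < deltaH X y := by
  have hp' : (3 : ℝ) ≤ p := by exact_mod_cast hp
  have hn' : 0 < n - p - 1 := by omega
  have hm : (0 : ℝ) < ((n - p - 1 : ℕ) : ℝ) := by exact_mod_cast hn'
  refine mul_pos ?_ (c.deltaU_pos hn hS)
  rw [c.phiH_Rsq_eq hp hn hS]
  exact shrink_pos (by linarith) (by positivity) (by positivity)

/-- The loss difference is `(1 - φ) W + log φ` with `W = δ_U/σ²`, and `integral_shrink` applies with
`x₀` the value of the factor at `R² = 0`. Strictness is claimed only at `β = 0`, where the level-set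
inequalities are strict. -/
lemma integral_loss_difference (c : CanonicalCoords X) (hp : 3 ≤ p) (hn : p + 1 < n)
    {G : Measure ℝ} (hG : IsMixingLaw G) (α : ℝ) (β : Fin p → ℝ) {s : ℝ} (hs : 0 < s) :
    Integrable (fun y => steinLoss (deltaU X y) s - steinLoss (deltaH X y) s)
      (samplingLaw X G α β s) ∧
    0 ≤ ∫ y, (steinLoss (deltaU X y) s - steinLoss (deltaH X y) s) ∂(samplingLaw X G α β s) ∧
    (β = 0 →
      0 < ∫ y, (steinLoss (deltaU X y) s - steinLoss (deltaH X y) s) ∂(samplingLaw X G α β s)) := by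
  have : NeZero (n - p - 1) := ⟨by omega⟩
  have hP := c.isProbabilityMeasure_samplingLaw hn hG α β hs
  have hp' : (3 : ℝ) ≤ p := by exact_mod_cast hp
  have hmpos : (0 : ℝ) < ((n - p - 1 : ℕ) : ℝ) := by
    exact_mod_cast Nat.pos_of_ne_zero (NeZero.ne _)
  have hU := c.measurable_deltaU hn
  set a : ℝ := (p : ℝ) / 2 - 1 with ha_def
  have ha : 0 < a := by rw [ha_def]; linarith
  have hpa : (p : ℝ) / 2 = a + 1 := by rw [ha_def]; ring
  have hb : 0 < ((n - p - 1 : ℕ) : ℝ) / 2 := by positivity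
  have hres := c.ae_samplingLaw_residual_pos hn G α β s
  have hdiff : (fun y => (1 - phiH n p (Rsq X y)) * (deltaU X y / s)
      + Real.log (phiH n p (Rsq X y))) =ᵐ[samplingLaw X G α β s]
      fun y => steinLoss (deltaU X y) s - steinLoss (deltaH X y) s := by
    filter_upwards [hres] with y hy
    have h1 := c.deltaU_pos hn hy
    have h2 := c.deltaH_pos hp hn hy
    have h3 : deltaH X y = phiH n p (Rsq X y) * deltaU X y := rfl
    have h4 : 0 < phiH n p (Rsq X y) := by
      rw [h3] at h2; exact (pos_iff_pos_of_mul_pos h2).2 h1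
    rw [steinLoss_sub h1 h2 hs, h3, div_mul_cancel_right₀ h1.ne', Real.log_inv]
    ring
  have key := integral_shrink (P := samplingLaw X G α β s) (W := fun y => deltaU X y / s)
    (φ := fun y => phiH n p (Rsq X y))
    (x₀ := shrink a (((n - p - 1 : ℕ) : ℝ) / 2) 0)
    ((measurable_phiH n p).comp (c.measurable_Rsq hn)) (by fun_prop)
    (shrink_pos ha hb le_rfl) (shrink_lt_one ha hb le_rfl) (by
      filter_upwards [hres] with y hy
      rw [c.phiH_Rsq_eq hp hn hy]
      exact ⟨(shrink_strictMonoOn ha hb).monotoneOn (by simp)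
        (by simp only [Set.mem_Ici]; positivity) (by positivity),
        (shrink_lt_one ha hb (by positivity)).le⟩)
    (by
      filter_upwards [hres] with y hy
      have := c.deltaU_pos hn hy
      positivity)
    (by rw [c.lintegral_deltaU_div hn hG α β hs]; exact ENNReal.one_ne_top)
    (by
      intro x hx0 hx1
      obtain ⟨r, hr, e1, e2⟩ := c.exists_setLIntegral_level hp hn hG α β hs hx0 hx1
      rw [e1, e2]
      exact mul_le_mul_right (setLIntegral_const_le_of_ratio hG ha hr hpa (c.A β) hs) _)
  rw [← integral_congr_ae hdiff]
  refine ⟨key.1.congr hdiff, key.2.1, fun hβ => key.2.2 fun x hx0 hx1 => ?_⟩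
  obtain ⟨r, hr, e1, e2⟩ := c.exists_setLIntegral_level hp hn hG α β hs hx0 hx1
  rw [e1, e2, hβ, map_zero]
  exact (ENNReal.mul_lt_mul_iff_right (ENNReal.inv_ne_zero.2 (ENNReal.natCast_ne_top _))
    (ENNReal.inv_ne_top.2 (by exact_mod_cast NeZero.ne _))).2
    (setLIntegral_const_lt_of_ratio hG ha hr hpa hs)

lemma dominatesByDifference_deltaH (c : CanonicalCoords X) (hp : 3 ≤ p) (hn : p + 1 < n)
    {G : Measure ℝ} (hG : IsMixingLaw G) :
    DominatesByDifference X G (deltaH X) (deltaU X) := by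
  refine ⟨fun α β s hs => ?_, 0, 0, 1, one_pos, ?_⟩
  · have := c.integral_loss_difference hp hn hG α β hs
    exact ⟨this.1, this.2.1⟩
  · exact (c.integral_loss_difference hp hn hG 0 0 one_pos).2.2 rfl

lemma risk_eq_of_ae_pos {G : Measure ℝ} {δ : (Fin n → ℝ) → ℝ} {α : ℝ} {β : Fin p → ℝ} {s : ℝ}
    (hδ : ∀ᵐ y ∂(samplingLaw X G α β s), 0 < δ y) :
    risk X G δ α β s = ∫⁻ y, ENNReal.ofReal (steinLoss (δ y) s) ∂(samplingLaw X G α β s) := by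
  refine lintegral_congr_ae ?_
  filter_upwards [hδ] with y hy
  rw [steinLossE, if_pos hy]

lemma measurable_steinLoss {Ω : Type*} [MeasurableSpace Ω] {f : Ω → ℝ} (hf : Measurable f)
    (s : ℝ) : Measurable fun x => steinLoss (f x) s := by
  unfold steinLoss; fun_prop

lemma riskLE_deltaH (c : CanonicalCoords X) (hp : 3 ≤ p) (hn : p + 1 < n)
    {G : Measure ℝ} (hG : IsMixingLaw G) : RiskLE X G (deltaH X) (deltaU X) := by
  intro α β s hs
  have hres := c.ae_samplingLaw_residual_pos hn G α β s
  have hU : ∀ᵐ y ∂(samplingLaw X G α β s), 0 < deltaU X y := hres.mono fun y => c.deltaU_pos hn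
  have hH : ∀ᵐ y ∂(samplingLaw X G α β s), 0 < deltaH X y := hres.mono fun y => c.deltaH_pos hp hn
  have h := c.integral_loss_difference hp hn hG α β hs
  rw [risk_eq_of_ae_pos hU, risk_eq_of_ae_pos hH]
  exact lintegral_ofReal_le_of_integral_sub_nonneg
    (measurable_steinLoss (c.measurable_deltaU hn) s).aestronglyMeasurable
    (hH.mono fun y hy => steinLoss_nonneg hy hs) (hU.mono fun y hy => steinLoss_nonneg hy hs)
    h.1 h.2.1

end CanonicalCoords

/-! ### Finite risk and strict domination -/

/-- The exponent `-1/4` keeps the bound integrable against the chi-square density even in dimension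
one, where that density behaves like `x^(-1/2)` at 0. -/
lemma abs_log_le {x : ℝ} (hx : 0 < x) : |Real.log x| ≤ x + 4 * x ^ (-(1 / 4) : ℝ) := by
  have h1 := Real.log_le_sub_one_of_pos hx
  have h2 := Real.log_le_sub_one_of_pos (Real.rpow_pos_of_pos hx (-(1 / 4)))
  rw [Real.log_rpow hx] at h2
  have h3 := Real.rpow_pos_of_pos hx (-(1 / 4))
  rw [abs_le]
  constructor <;> linarith

lemma integrable_log_norm_sq_gauss {E : Type*} [NormedAddCommGroup E] [InnerProductSpace ℝ E]
    [FiniteDimensional ℝ E] [MeasurableSpace E] [BorelSpace E] [Nontrivial E] :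
    Integrable (fun η : E => Real.log (‖η‖ ^ 2)) (gauss E) := by
  obtain ⟨k, hk0, hk1, hk⟩ := exists_lintegral_gauss_norm_sq E
  have hd : 1 / 2 ≤ (Module.finrank ℝ E : ℝ) / 2 := by
    have : 0 < Module.finrank ℝ E := Module.finrank_pos
    have : (1 : ℝ) ≤ Module.finrank ℝ E := by exact_mod_cast this
    linarith
  have h1 : Integrable (fun η : E => ‖η‖ ^ 2) (gauss E) :=
    integrable_of_lintegral_ofReal_ne_top (by fun_prop) (ae_of_all _ fun _ => by positivity)
      (by rw [lintegral_gauss_norm_sq_self]; exact ENNReal.natCast_ne_top _)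
  have h2 : Integrable (fun η : E => (‖η‖ ^ 2) ^ (-(1 / 4) : ℝ)) (gauss E) := by
    have hm : Measurable fun η : E => (‖η‖ ^ 2) ^ (-(1 / 4) : ℝ) := by fun_prop
    refine integrable_of_lintegral_ofReal_ne_top hm.aestronglyMeasurable
      (ae_of_all _ fun _ => by positivity) ?_
    rw [hk (fun x => ENNReal.ofReal (x ^ (-(1 / 4) : ℝ))) (by fun_prop)]
    refine ENNReal.mul_ne_top hk1 ?_
    have e1 : ∫⁻ x in Set.Ioi (0 : ℝ), ENNReal.ofReal (x ^ ((Module.finrank ℝ E : ℝ) / 2 - 1) *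
        Real.exp (-(1 / 2 * x))) * ENNReal.ofReal (x ^ (-(1 / 4) : ℝ))
        = ∫⁻ x in Set.Ioi (0 : ℝ), ENNReal.ofReal (x ^ ((Module.finrank ℝ E : ℝ) / 2 - 1 / 4 - 1) *
        Real.exp (-(1 / 2 * x))) := by
      refine setLIntegral_congr_fun measurableSet_Ioi fun x hx => ?_
      have hx' : (0 : ℝ) < x := hx
      rw [← ENNReal.ofReal_mul (by positivity)]
      congr 1
      rw [show (Module.finrank ℝ E : ℝ) / 2 - 1 / 4 - 1
        = (Module.finrank ℝ E : ℝ) / 2 - 1 + -(1 / 4) by ring, Real.rpow_add hx']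
      ring
    rw [e1, lintegral_gamma (by linarith) (by norm_num)]
    exact ENNReal.ofReal_ne_top
  refine (h1.add (h2.const_mul 4)).mono' (by
    refine Measurable.aestronglyMeasurable ?_
    fun_prop) ?_
  filter_upwards [gauss_ae_ne_zero (E := E)] with η hη
  have := norm_pos_iff.2 hη
  exact abs_log_le (by positivity)

/-- Up to a constant `log (δ_U/σ²)` is `log v + log ‖η‖²`. The hypothesis on `G` thus makes the risk
of `δ_U` finite, and the strict expected difference becomes a strict inequality of risks. -/
lemma CanonicalCoords.dominates_deltaH {n p : ℕ} {X : Matrix (Fin n) (Fin p) ℝ}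
    (c : CanonicalCoords X) (hp : 3 ≤ p) (hn : p + 1 < n) {G : Measure ℝ} (hG : IsMixingLaw G)
    (hlog : Integrable Real.log G) : Dominates X G (deltaH X) (deltaU X) := by
  refine ⟨c.riskLE_deltaH hp hn hG, 0, 0, 1, one_pos, ?_⟩
  have hprob := hG.prob
  have : NeZero (n - p - 1) := ⟨by omega⟩
  have hres := c.ae_samplingLaw_residual_pos hn G 0 0 1
  have hU : ∀ᵐ y ∂(samplingLaw X G 0 0 1), 0 < deltaU X y := hres.mono fun y => c.deltaU_pos hn
  have hH : ∀ᵐ y ∂(samplingLaw X G 0 0 1), 0 < deltaH X y := hres.mono fun y => c.deltaH_pos hp hn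
  have h := c.integral_loss_difference hp hn hG 0 0 one_pos
  have hUm := c.measurable_deltaU hn
  have hP := c.isProbabilityMeasure_samplingLaw hn hG 0 0 one_pos
  have i1 : Integrable (fun y => deltaU X y / 1) (samplingLaw X G 0 0 1) :=
    integrable_of_lintegral_ofReal_ne_top
      (by refine Measurable.aestronglyMeasurable ?_; fun_prop) (by
      filter_upwards [hU] with y hy
      simpa using hy.le) (by rw [c.lintegral_deltaU_div hn hG 0 0 one_pos]; exact ENNReal.one_ne_top)
  have i2 : Integrable (fun y => Real.log (deltaU X y / 1)) (samplingLaw X G 0 0 1) := by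
    rw [c.samplingLaw_eq hn hG 0 0 one_pos, integrable_map_measure
      (by refine Measurable.aestronglyMeasurable ?_; fun_prop) (by fun_prop)]
    have j1 : Integrable (fun ω : ℝ × ℝ × EuclideanSpace ℝ (Fin p) ×
        EuclideanSpace ℝ (Fin (n - p - 1)) => Real.log ω.1) (latentLaw p (n - p - 1) G) :=
      hlog.comp_fst _
    have j2 : Integrable (fun ω : ℝ × ℝ × EuclideanSpace ℝ (Fin p) ×
        EuclideanSpace ℝ (Fin (n - p - 1)) => Real.log (‖ω.2.2.2‖ ^ 2))
        (latentLaw p (n - p - 1) G) :=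
      ((integrable_log_norm_sq_gauss.comp_snd _).comp_snd _).comp_snd _
    refine ((integrable_const (Real.log ((n - p - 1 : ℕ) : ℝ)⁻¹)).add (j1.add j2)).congr ?_
    have hη : ∀ᵐ ω ∂(latentLaw p (n - p - 1) G), ω.2.2.2 ≠ 0 :=
      Measure.quasiMeasurePreserving_snd.ae (Measure.quasiMeasurePreserving_snd.ae
        (Measure.quasiMeasurePreserving_snd.ae gauss_ae_ne_zero))
    filter_upwards [ae_latentLaw_fst_pos hG, hη] with ω hω hη
    have hm : ((n - p - 1 : ℕ) : ℝ)⁻¹ ≠ 0 := inv_ne_zero (by exact_mod_cast NeZero.ne _)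
    have hS : ‖ω.2.2.2‖ ^ 2 ≠ 0 := pow_ne_zero _ (norm_ne_zero_iff.2 hη)
    simp only [Pi.add_apply, Function.comp_apply]
    rw [c.deltaU_observe_div hn 0 0 one_pos hω, Real.log_mul hm (mul_ne_zero hω.ne' hS),
      Real.log_mul hω.ne' hS]
  rw [risk_eq_of_ae_pos hU, risk_eq_of_ae_pos hH]
  exact lintegral_ofReal_lt_of_integral_sub_pos
    (hH.mono fun y hy => steinLoss_nonneg hy one_pos)
    (hU.mono fun y hy => steinLoss_nonneg hy one_pos)
    ((i1.sub i2).sub (integrable_const 1)) h.1 (h.2.2 rfl)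

/-! ### Minimaxity -/

@[fun_prop]
lemma measurable_steinLossE {Ω : Type*} [MeasurableSpace Ω] {f g : Ω → ℝ} (hf : Measurable f)
    (hg : Measurable g) : Measurable fun x => steinLossE (f x) (g x) := by
  unfold steinLossE steinLoss
  exact Measurable.ite (measurableSet_lt measurable_const hf) (by fun_prop) measurable_const

/-- The loss depends on `d/s` only. Thus at an observation with residual sum of squares `S` any
estimate acts as the multiplier `D/S`. -/
lemma steinLossE_scale (D : ℝ) {S x : ℝ} (hS : 0 < S) (hx : 0 < x) :
    steinLossE D (S / x) = steinLossE (D / S * x) 1 := by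
  have h : 0 < D ↔ 0 < D / S * x := by
    rw [mul_pos_iff_of_pos_right hx, div_pos_iff_of_pos_right hS]
  have h2 : D / (S / x) = D / S * x / 1 := by field_simp
  simp only [steinLossE, steinLoss, ← h, h2]

section Translation

variable {V : Type*} [NormedAddCommGroup V] [MeasurableSpace V] [BorelSpace V]

/-- If `μ + w` lies in the ball of radius `L - r` and `‖w‖ ≤ r`, then `μ` lies in the ball of radius
`L`; translation invariance does the rest. -/
lemma setLIntegral_closedBall_le_translate {lam : Measure V} [lam.IsAddRightInvariant]
    (f : V → ℝ≥0∞) {L r : ℝ} {w : V} (hw : ‖w‖ ≤ r) :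
    ∫⁻ z in Metric.closedBall 0 (L - r), f z ∂lam
      ≤ ∫⁻ μ in Metric.closedBall 0 L, f (μ + w) ∂lam := by
  rw [← lintegral_indicator Metric.isClosed_closedBall.measurableSet,
    ← lintegral_indicator Metric.isClosed_closedBall.measurableSet,
    ← lintegral_add_right_eq_self _ w]
  refine lintegral_mono fun μ => ?_
  by_cases h : μ + w ∈ Metric.closedBall (0 : V) (L - r)
  · have h' : μ ∈ Metric.closedBall (0 : V) L := by
      rw [mem_closedBall_zero_iff] at h ⊢
      have := norm_sub_le (μ + w) w
      rw [add_sub_cancel_right] at this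
      linarith
    rw [Set.indicator_of_mem h, Set.indicator_of_mem h']
  · rw [Set.indicator_of_notMem h]; exact zero_le

end Translation

section Scale

variable {F : Type*} [NormedAddCommGroup F] [InnerProductSpace ℝ F] [FiniteDimensional ℝ F]
  [MeasurableSpace F] [BorelSpace F] [Nontrivial F]

set_option linter.unusedSectionVars false

/-- Averaging over the scale group, restricted to latent variables of bounded logarithm. -/
lemma setLIntegral_shell_le {χ : ℝ → ℝ≥0∞} (hχ : Measurable χ) {B : ℝ} (hB : 1 ≤ B)
    (hχB : ∀ x, χ x ≠ 0 → B⁻¹ ≤ x ∧ x ≤ B) {T : F × ℝ → ℝ≥0∞} (hT : Measurable T) {v M : ℝ}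
    (hv : B⁻¹ ≤ v ∧ v ≤ B) :
    ∫⁻ y in {y : F | |Real.log (‖y‖ ^ 2)| ≤ M - 2 * Real.log B},
        ENNReal.ofReal ((‖y‖ ^ 2) ^ (-(Module.finrank ℝ F : ℝ) / 2)) *
        ∫⁻ τ, logChiDens (Module.finrank ℝ F) τ * (χ (Real.exp τ) *
          T (y, ‖y‖ ^ 2 / (v * Real.exp τ)))
      ≤ ∫⁻ u in Set.Icc (-M) M, ∫⁻ η : F, χ (‖η‖ ^ 2) *
          T (√(Real.exp u * v) • η, Real.exp u) ∂(gauss F) := by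
  have hB0 : 0 < B := by linarith
  have hlog : ∀ x, B⁻¹ ≤ x ∧ x ≤ B → |Real.log x| ≤ Real.log B := by
    intro x hx
    have hx0 : 0 < x := (inv_pos.2 hB0).trans_le hx.1
    rw [abs_le, ← Real.log_inv]
    exact ⟨Real.log_le_log (inv_pos.2 hB0) hx.1, Real.log_le_log hx0 hx.2⟩
  have hv0 : 0 < v := (inv_pos.2 hB0).trans_le hv.1
  have hI : Measurable (Set.indicator (Set.Icc (-M) M) (1 : ℝ → ℝ≥0∞)) :=
    measurable_one.indicator measurableSet_Icc
  -- Shifting `u` by `log v` absorbs `v` into the scale, so that `lintegral_scale_gauss` applies.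
  set Φ : F × ℝ → ℝ≥0∞ := fun q => Set.indicator (Set.Icc (-M) M) 1 (q.2 - Real.log v) *
    (χ (‖q.1‖ ^ 2 * Real.exp (-q.2)) * T (q.1, Real.exp (q.2 - Real.log v))) with hΦ
  have hΦm : Measurable Φ := by fun_prop
  have e1 : ∫⁻ u in Set.Icc (-M) M, ∫⁻ η : F, χ (‖η‖ ^ 2) *
      T (√(Real.exp u * v) • η, Real.exp u) ∂(gauss F)
      = ∫⁻ u : ℝ, ∫⁻ η, Φ (√(Real.exp u) • η, u) ∂(gauss F) := by
    rw [← lintegral_indicator measurableSet_Icc, ← lintegral_sub_right_eq_self _ (Real.log v)]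
    refine lintegral_congr fun u => ?_
    simp only [hΦ]
    rw [lintegral_const_mul _ (by fun_prop)]
    have h1 : Real.exp (u - Real.log v) * v = Real.exp u := by
      rw [Real.exp_sub, Real.exp_log hv0]; field_simp
    have h2 : ∀ η : F, ‖√(Real.exp u) • η‖ ^ 2 * Real.exp (-u) = ‖η‖ ^ 2 := by
      intro η
      rw [norm_smul, mul_pow, Real.norm_eq_abs, sq_abs, Real.sq_sqrt (Real.exp_pos _).le,
        Real.exp_neg]
      have := Real.exp_pos u
      field_simp
    simp only [h2]
    by_cases hu : u - Real.log v ∈ Set.Icc (-M) M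
    · rw [Set.indicator_of_mem hu, Set.indicator_of_mem hu, h1, Pi.one_apply, one_mul]
    · rw [Set.indicator_of_notMem hu, Set.indicator_of_notMem hu, zero_mul]
  rw [e1, lintegral_scale_gauss hΦm]
  refine le_trans (setLIntegral_mono_ae' (measurableSet_shell _) ?_) (setLIntegral_le_lintegral
    {y : F | |Real.log (‖y‖ ^ 2)| ≤ M - 2 * Real.log B} _)
  filter_upwards [ae_ne_zero (E := F)] with y hy0 hy
  have hS : 0 < ‖y‖ ^ 2 := by have := norm_pos_iff.2 hy0; positivity
  refine mul_le_mul_right (lintegral_mono fun τ => mul_le_mul_right ?_ _) _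
  have h3 : ‖y‖ ^ 2 * Real.exp (-(Real.log (‖y‖ ^ 2) - τ)) = Real.exp τ := by
    rw [neg_sub, Real.exp_sub, Real.exp_log hS]; field_simp
  have h4 : Real.exp (Real.log (‖y‖ ^ 2) - τ - Real.log v) = ‖y‖ ^ 2 / (v * Real.exp τ) := by
    rw [Real.exp_sub, Real.exp_sub, Real.exp_log hS, Real.exp_log hv0, div_div, mul_comm v]
  simp only [hΦ]
  rw [h3, h4]
  by_cases hτ : χ (Real.exp τ) = 0
  · rw [hτ, zero_mul]; exact zero_le
  have h5 := hlog _ (hχB _ hτ)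
  have h6 := hlog v hv
  have h7 : |Real.log (‖y‖ ^ 2)| ≤ M - 2 * Real.log B := hy
  rw [Real.log_exp] at h5
  -- `v` and `e^τ` lie in `[1/B, B]`, so on the reduced shell the log scale cannot leave `[-M, M]`.
  -- The loss of `2 log B` pays for these two shifts.
  have h8 : Real.log (‖y‖ ^ 2) - τ - Real.log v ∈ Set.Icc (-M) M := by
    rw [abs_le] at h5 h6 h7
    constructor <;> linarith [h5.1, h5.2, h6.1, h6.2, h7.1, h7.2]
  rw [Set.indicator_of_mem h8, Pi.one_apply, one_mul]

/-- For fixed `y` the estimator is the multiplier `D y / ‖y‖²` of `v e^τ`, so the inner integral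
over `τ` and `v` is at least `J` up to the normalizing constant, whatever `y` is. The mass of the
shell provides the factor in front. -/
lemma ofReal_mul_le_lintegral_scale {G : Measure ℝ} [SFinite G] {χ : ℝ → ℝ≥0∞}
    (hχ : Measurable χ) {B : ℝ} (hB : 1 ≤ B) (hχB : ∀ x, χ x ≠ 0 → B⁻¹ ≤ x ∧ x ≤ B) {J : ℝ≥0∞}
    (hJ : ∀ d : ℝ, J ≤ ∫⁻ v, χ v * ∫⁻ η : F, χ (‖η‖ ^ 2) *
      steinLossE (d * (v * ‖η‖ ^ 2)) 1 ∂(gauss F) ∂G) {D : F → ℝ} (hD : Measurable D) (M : ℝ) :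
    ENNReal.ofReal (2 * (M - 2 * Real.log B)) * J
      ≤ ∫⁻ v, χ v * (∫⁻ u in Set.Icc (-M) M, ∫⁻ η : F, χ (‖η‖ ^ 2) *
          steinLossE (D (√(Real.exp u * v) • η)) (Real.exp u) ∂(gauss F)) ∂G := by
  have hB0 : 0 < B := by linarith
  set M' := M - 2 * Real.log B with hM'
  set w : F → ℝ≥0∞ := fun y => ENNReal.ofReal ((‖y‖ ^ 2) ^ (-(Module.finrank ℝ F : ℝ) / 2)) with hw
  have hwm : Measurable w := by fun_prop
  set H : ℝ → F → ℝ≥0∞ := fun v y => ∫⁻ τ, logChiDens (Module.finrank ℝ F) τ * (χ (Real.exp τ) *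
    steinLossE (D y / ‖y‖ ^ 2 * (v * Real.exp τ)) 1) with hH
  have hHm : Measurable fun q : ℝ × F => H q.1 q.2 := Measurable.lintegral_prod_right'
    (f := fun q : (ℝ × F) × ℝ => logChiDens (Module.finrank ℝ F) q.2 * (χ (Real.exp q.2) *
      steinLossE (D q.1.2 / ‖q.1.2‖ ^ 2 * (q.1.1 * Real.exp q.2)) 1)) (by fun_prop)
  have h1 : ∀ v, χ v * ∫⁻ y in {y : F | |Real.log (‖y‖ ^ 2)| ≤ M'}, w y * H v y
      ≤ χ v * ∫⁻ u in Set.Icc (-M) M, ∫⁻ η : F, χ (‖η‖ ^ 2) *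
          steinLossE (D (√(Real.exp u * v) • η)) (Real.exp u) ∂(gauss F) := by
    intro v
    by_cases hv : χ v = 0
    · rw [hv, zero_mul, zero_mul]
    have hvB := hχB v hv
    have hv0 : 0 < v := (inv_pos.2 hB0).trans_le hvB.1
    refine mul_le_mul_right (le_trans (le_of_eq ?_) (setLIntegral_shell_le hχ hB hχB
      (T := fun q => steinLossE (D q.1) q.2) (by fun_prop) hvB)) _
    refine setLIntegral_congr_fun_ae (measurableSet_shell _) ?_
    filter_upwards [ae_ne_zero (E := F)] with y hy0 _
    have hS : 0 < ‖y‖ ^ 2 := by have := norm_pos_iff.2 hy0; positivity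
    simp only [hw, hH]
    congr 1
    refine lintegral_congr fun τ => ?_
    rw [steinLossE_scale _ hS (mul_pos hv0 (Real.exp_pos τ))]
  refine le_trans ?_ (lintegral_mono h1)
  have e1 : ∀ v, χ v * ∫⁻ y in {y : F | |Real.log (‖y‖ ^ 2)| ≤ M'}, w y * H v y
      = ∫⁻ y in {y : F | |Real.log (‖y‖ ^ 2)| ≤ M'}, w y * (χ v * H v y) := by
    intro v
    rw [← lintegral_const_mul _ (by fun_prop)]
    exact lintegral_congr fun y => mul_left_comm _ _ _
  simp only [e1]
  rw [lintegral_lintegral_swap (by fun_prop)]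
  have hc0 := chiConst_ne_zero (E := F)
  have hc1 := chiConst_ne_top (E := F)
  have h2 : ∀ y, w y * ((chiConst F)⁻¹ * J) ≤ ∫⁻ v, w y * (χ v * H v y) ∂G := by
    intro y
    rw [lintegral_const_mul _ (by fun_prop)]
    refine mul_le_mul_right ?_ _
    refine (ENNReal.mul_le_mul_iff_right hc0 hc1).1 ?_
    rw [← mul_assoc, ENNReal.mul_inv_cancel hc0 hc1, one_mul, ← lintegral_const_mul _ (by fun_prop)]
    refine (hJ (D y / ‖y‖ ^ 2)).trans (le_of_eq ?_)
    refine lintegral_congr fun v => ?_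
    rw [mul_left_comm]
    congr 1
    exact lintegral_gauss_norm_sq (E := F)
      (h := fun x => χ x * steinLossE (D y / ‖y‖ ^ 2 * (v * x)) 1) (by fun_prop)
  refine le_trans ?_ (lintegral_mono h2)
  rw [lintegral_mul_const _ hwm]
  change _ ≤ shellMass F M' * _
  rw [shellMass_eq, mul_assoc, ← mul_assoc (chiConst F), ENNReal.mul_inv_cancel hc0 hc1, one_mul]

end Scale

/-- Divide by `L^k` and let `L` tend to infinity: a boundary layer of fixed width is negligible. -/
lemma le_of_forall_ofReal_sub_pow_mul_le {x y : ℝ≥0∞} (r : ℝ) (k : ℕ)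
    (h : ∀ L : ℝ, 0 < L → r ≤ L →
      ENNReal.ofReal ((L - r) ^ k) * x ≤ ENNReal.ofReal (L ^ k) * y) : x ≤ y := by
  have hlim : Filter.Tendsto (fun L : ℝ => ENNReal.ofReal ((1 - r / L) ^ k) * x) Filter.atTop
      (nhds (1 * x)) := by
    refine ENNReal.Tendsto.mul_const ?_ (Or.inl one_ne_zero)
    rw [← ENNReal.ofReal_one]
    refine ENNReal.tendsto_ofReal ?_
    have h1 : Filter.Tendsto (fun L : ℝ => (1 - r / L) ^ k) Filter.atTop
        (nhds ((1 - 0) ^ k)) :=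
      (tendsto_const_nhds.sub (Filter.Tendsto.div_atTop tendsto_const_nhds Filter.tendsto_id)).pow k
    simpa using h1
  rw [one_mul] at hlim
  refine le_of_tendsto hlim ?_
  filter_upwards [Filter.eventually_gt_atTop 0, Filter.eventually_ge_atTop r] with L hL hLr
  have hLk : 0 < L ^ k := by positivity
  have h2 := h L hL hLr
  have h3 : (L - r) ^ k = L ^ k * (1 - r / L) ^ k := by
    rw [← mul_pow]; congr 1; field_simp
  rw [h3, ENNReal.ofReal_mul hLk.le, mul_assoc] at h2
  exact (ENNReal.mul_le_mul_iff_right (by simpa using hLk) ENNReal.ofReal_ne_top).1 h2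

section Average

variable {V F : Type*} [NormedAddCommGroup V] [NormedSpace ℝ V] [FiniteDimensional ℝ V]
  [MeasurableSpace V] [BorelSpace V] [NormedAddCommGroup F] [InnerProductSpace ℝ F]
  [FiniteDimensional ℝ F] [MeasurableSpace F] [BorelSpace F] [Nontrivial F]

set_option linter.unusedSectionVars false

/-- The risk is averaged over centres `μ` in a ball of radius `L` and log scales in `[-M, M]`. From
above it is bounded by `ρ`. From below, translation invariance in `μ` removes the noise `ζ` from the
first argument, at the cost of a bounded shift, and `ofReal_mul_le_lintegral_scale` handles the
scale. The truncations `χ` and `ψ` keep the shifts bounded. -/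
lemma average_risk_le {lam : Measure V} [lam.IsAddHaarMeasure] {ν : Measure V} [SFinite ν]
    {G : Measure ℝ} [SFinite G] {χ : ℝ → ℝ≥0∞} (hχ : Measurable χ) {B C : ℝ} (hB : 1 ≤ B)
    (hχB : ∀ x, χ x ≠ 0 → B⁻¹ ≤ x ∧ x ≤ B) {ψ : V → ℝ≥0∞} (hψ : Measurable ψ)
    (hψC : ∀ ζ, ψ ζ ≠ 0 → ‖ζ‖ ≤ C) {J : ℝ≥0∞}
    (hJ : ∀ d : ℝ, J ≤ ∫⁻ v, χ v * ∫⁻ η : F, χ (‖η‖ ^ 2) *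
      steinLossE (d * (v * ‖η‖ ^ 2)) 1 ∂(gauss F) ∂G)
    {D : V × F → ℝ} (hD : Measurable D) {ρ : ℝ≥0∞}
    (hρ : ∀ μ u, ∫⁻ v, χ v * ∫⁻ ζ, ψ ζ * ∫⁻ η : F, χ (‖η‖ ^ 2) *
      steinLossE (D (μ + √(Real.exp u * v) • ζ, √(Real.exp u * v) • η)) (Real.exp u)
        ∂(gauss F) ∂ν ∂G ≤ ρ) (L M : ℝ) :
    lam (Metric.closedBall 0 (L - √(Real.exp M * B) * C)) * ((∫⁻ ζ, ψ ζ ∂ν) *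
        (ENNReal.ofReal (2 * (M - 2 * Real.log B)) * J))
      ≤ lam (Metric.closedBall 0 L) * (ENNReal.ofReal (2 * M) * ρ) := by
  set r := √(Real.exp M * B) * C with hr
  set Q : Measure (ℝ × ℝ × V × F) :=
    (volume.restrict (Set.Icc (-M) M)).prod (G.prod (ν.prod (gauss F))) with hQ
  have hQi : ∀ h : ℝ × ℝ × V × F → ℝ≥0∞, Measurable h →
      ∫⁻ q, h q ∂Q = ∫⁻ u in Set.Icc (-M) M, ∫⁻ v, ∫⁻ ζ, ∫⁻ η, h (u, v, ζ, η) ∂(gauss F) ∂ν ∂G := by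
    intro h hh
    rw [hQ, lintegral_prod _ hh.aemeasurable]
    refine lintegral_congr fun u => ?_
    rw [lintegral_prod _ (by fun_prop)]
    refine lintegral_congr fun v => ?_
    rw [lintegral_prod _ (by fun_prop)]
  set W : ℝ × ℝ × V × F → ℝ≥0∞ := fun q => χ q.2.1 * (ψ q.2.2.1 * χ (‖q.2.2.2‖ ^ 2)) with hW
  have hWm : Measurable W := by fun_prop
  set T : V → ℝ × ℝ × V × F → ℝ≥0∞ := fun z q =>
    steinLossE (D (z, √(Real.exp q.1 * q.2.1) • q.2.2.2)) (Real.exp q.1) with hT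
  have hTm : Measurable fun p : V × (ℝ × ℝ × V × F) => T p.1 p.2 := by fun_prop
  -- the average risk is bounded by the maximal risk
  have hupper : ∫⁻ μ in Metric.closedBall 0 L, (∫⁻ q, W q *
      T (μ + √(Real.exp q.1 * q.2.1) • q.2.2.1) q ∂Q) ∂lam
      ≤ lam (Metric.closedBall 0 L) * (ENNReal.ofReal (2 * M) * ρ) := by
    have h1 : ∀ μ, ∫⁻ q, W q * T (μ + √(Real.exp q.1 * q.2.1) • q.2.2.1) q ∂Q
        ≤ ENNReal.ofReal (2 * M) * ρ := by
      intro μ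
      rw [hQi _ (by fun_prop)]
      have h2 : ∀ u, ∫⁻ v, ∫⁻ ζ, ∫⁻ η, W (u, v, ζ, η) *
          T (μ + √(Real.exp u * v) • ζ) (u, v, ζ, η) ∂(gauss F) ∂ν ∂G ≤ ρ := by
        intro u
        refine le_trans (le_of_eq ?_) (hρ μ u)
        refine lintegral_congr fun v => ?_
        rw [← lintegral_const_mul _ (by
          refine hψ.mul ?_
          exact Measurable.lintegral_prod_right' (f := fun q : V × F => χ (‖q.2‖ ^ 2) *
            steinLossE (D (μ + √(Real.exp u * v) • q.1, √(Real.exp u * v) • q.2)) (Real.exp u))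
            (by fun_prop))]
        refine lintegral_congr fun ζ => ?_
        rw [← lintegral_const_mul _ (by fun_prop), ← lintegral_const_mul _ (by fun_prop)]
        refine lintegral_congr fun η => ?_
        simp only [hW, hT, mul_assoc]
      refine (lintegral_mono h2).trans (le_of_eq ?_)
      rw [setLIntegral_const, Real.volume_Icc, mul_comm]
      congr 2; ring
    refine (lintegral_mono h1).trans (le_of_eq ?_)
    rw [setLIntegral_const, mul_comm]
  refine le_trans ?_ hupper
  rw [lintegral_lintegral_swap (by fun_prop)]
  -- the shifts of the centre that the latent variables can cause are bounded
  have hshift : ∀ᵐ q ∂Q, W q * ∫⁻ z in Metric.closedBall 0 (L - r), T z q ∂lam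
      ≤ ∫⁻ μ in Metric.closedBall 0 L, W q *
        T (μ + √(Real.exp q.1 * q.2.1) • q.2.2.1) q ∂lam := by
    have hu : ∀ᵐ q ∂Q, q.1 ∈ Set.Icc (-M) M :=
      Measure.quasiMeasurePreserving_fst.ae (ae_restrict_mem measurableSet_Icc)
    filter_upwards [hu] with q hq
    rw [lintegral_const_mul _ (by fun_prop)]
    by_cases hWq : W q = 0
    · rw [hWq, zero_mul, zero_mul]
    refine mul_le_mul_right (setLIntegral_closedBall_le_translate (fun z => T z q) ?_) _
    have h1 := (hχB _ (left_ne_zero_of_mul hWq)).2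
    have h2 := hψC _ (left_ne_zero_of_mul (right_ne_zero_of_mul hWq))
    rw [norm_smul, Real.norm_of_nonneg (Real.sqrt_nonneg _), hr]
    have h3 := Real.exp_le_exp.2 hq.2
    have h4 := norm_nonneg q.2.2.1
    have h5 : Real.exp q.1 * q.2.1 ≤ Real.exp M * B := by
      refine mul_le_mul h3 h1 ?_ (Real.exp_pos _).le
      exact (inv_pos.2 (by linarith : 0 < B)).le.trans (hχB _ (left_ne_zero_of_mul hWq)).1
    exact mul_le_mul (Real.sqrt_le_sqrt h5) h2 h4 (Real.sqrt_nonneg _)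
  refine le_trans ?_ (lintegral_mono_ae hshift)
  have e1 : ∀ q, W q * ∫⁻ z in Metric.closedBall 0 (L - r), T z q ∂lam
      = ∫⁻ z in Metric.closedBall 0 (L - r), W q * T z q ∂lam :=
    fun q => (lintegral_const_mul _ (by fun_prop)).symm
  simp only [e1]
  rw [lintegral_lintegral_swap (by fun_prop), mul_comm, ← setLIntegral_const]
  refine lintegral_mono fun z => ?_
  rw [hQi _ (by fun_prop)]
  have e2 : ∀ u v, ∫⁻ ζ, ∫⁻ η, W (u, v, ζ, η) * T z (u, v, ζ, η) ∂(gauss F) ∂ν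
      = (∫⁻ ζ, ψ ζ ∂ν) * (χ v * ∫⁻ η : F, χ (‖η‖ ^ 2) *
          steinLossE (D (z, √(Real.exp u * v) • η)) (Real.exp u) ∂(gauss F)) := by
    intro u v
    rw [← lintegral_mul_const _ hψ]
    refine lintegral_congr fun ζ => ?_
    rw [← lintegral_const_mul _ (by fun_prop), ← lintegral_const_mul _ (by fun_prop)]
    refine lintegral_congr fun η => ?_
    simp only [hW, hT]
    ring
  simp only [e2]
  have hg : Measurable fun q : ℝ × ℝ => χ q.2 * ∫⁻ η : F, χ (‖η‖ ^ 2) *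
      steinLossE (D (z, √(Real.exp q.1 * q.2) • η)) (Real.exp q.1) ∂(gauss F) := by
    refine Measurable.mul (by fun_prop) ?_
    exact Measurable.lintegral_prod_right' (f := fun q : (ℝ × ℝ) × F => χ (‖q.2‖ ^ 2) *
      steinLossE (D (z, √(Real.exp q.1.1 * q.1.2) • q.2)) (Real.exp q.1.1)) (by fun_prop)
  rw [lintegral_lintegral_swap (by exact (measurable_const.mul hg).aemeasurable)]
  have e3 : ∀ v, ∫⁻ u in Set.Icc (-M) M, (∫⁻ ζ, ψ ζ ∂ν) * (χ v * ∫⁻ η : F, χ (‖η‖ ^ 2) *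
          steinLossE (D (z, √(Real.exp u * v) • η)) (Real.exp u) ∂(gauss F))
      = (∫⁻ ζ, ψ ζ ∂ν) * (χ v * ∫⁻ u in Set.Icc (-M) M, ∫⁻ η : F, χ (‖η‖ ^ 2) *
          steinLossE (D (z, √(Real.exp u * v) • η)) (Real.exp u) ∂(gauss F)) := by
    intro v
    have hg2 : Measurable fun q : ℝ × ℝ => ∫⁻ η : F, χ (‖η‖ ^ 2) *
        steinLossE (D (z, √(Real.exp q.1 * q.2) • η)) (Real.exp q.1) ∂(gauss F) :=
      Measurable.lintegral_prod_right' (f := fun q : (ℝ × ℝ) × F => χ (‖q.2‖ ^ 2) *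
        steinLossE (D (z, √(Real.exp q.1.1 * q.1.2) • q.2)) (Real.exp q.1.1)) (by fun_prop)
    rw [lintegral_const_mul _ (by exact hg.comp (f := fun u => (u, v)) (by fun_prop)),
      lintegral_const_mul _ (by exact hg2.comp (f := fun u => (u, v)) (by fun_prop))]
  simp only [e3]
  refine (mul_le_mul_right (ofReal_mul_le_lintegral_scale hχ hB hχB hJ
    (D := fun y => D (z, y)) (by fun_prop) M) _).trans ?_
  exact lintegral_const_mul_le _ _

/-- A lower bound for the maximal risk over the translations of `V` and all scales. -/
lemma le_of_risk_le {lam : Measure V} [lam.IsAddHaarMeasure] {ν : Measure V}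
    [IsProbabilityMeasure ν] {G : Measure ℝ} [SFinite G] {χ : ℝ → ℝ≥0∞} (hχ : Measurable χ) {B : ℝ}
    (hB : 1 ≤ B) (hχB : ∀ x, χ x ≠ 0 → B⁻¹ ≤ x ∧ x ≤ B) (hχ1 : ∀ x, χ x ≤ 1) {J : ℝ≥0∞}
    (hJ : ∀ d : ℝ, J ≤ ∫⁻ v, χ v * ∫⁻ η : F, χ (‖η‖ ^ 2) *
      steinLossE (d * (v * ‖η‖ ^ 2)) 1 ∂(gauss F) ∂G)
    {D : V × F → ℝ} (hD : Measurable D) {ρ : ℝ≥0∞}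
    (hρ : ∀ μ u, ∫⁻ v, ∫⁻ ζ, ∫⁻ η : F,
      steinLossE (D (μ + √(Real.exp u * v) • ζ, √(Real.exp u * v) • η)) (Real.exp u)
        ∂(gauss F) ∂ν ∂G ≤ ρ) : J ≤ ρ := by
  have hball : ∀ C : ℝ, MeasurableSet (Metric.closedBall (0 : V) C) :=
    fun C => Metric.isClosed_closedBall.measurableSet
  have h1 : ∀ C M : ℝ, ∀ L : ℝ, lam (Metric.closedBall 0 (L - √(Real.exp M * B) * C)) *
      (ν (Metric.closedBall 0 C) * (ENNReal.ofReal (2 * (M - 2 * Real.log B)) * J))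
      ≤ lam (Metric.closedBall 0 L) * (ENNReal.ofReal (2 * M) * ρ) := by
    intro C M L
    rw [← lintegral_indicator_one (μ := ν) (hball C)]
    refine average_risk_le hχ hB hχB (measurable_one.indicator (hball C))
      (fun ζ hζ => ?_) hJ hD (fun μ u => ?_) L M
    · simpa using Set.mem_of_indicator_ne_zero hζ
    · refine le_trans (lintegral_mono fun v => ?_) (hρ μ u)
      refine (mul_le_of_le_one_left' (hχ1 v)).trans (lintegral_mono fun ζ => ?_)
      refine (mul_le_of_le_one_left' (Set.indicator_le_self' (by simp) ζ)).trans
        (lintegral_mono fun η => ?_)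
      exact mul_le_of_le_one_left' (hχ1 _)
  -- The limits are taken in the order radius, range of log scales, truncation of `ζ`, because the
  -- shift of the centre depends on `M` and `C`.
  have h2 : ∀ C M : ℝ, 0 ≤ C →
      ν (Metric.closedBall 0 C) * (ENNReal.ofReal (2 * (M - 2 * Real.log B)) * J)
      ≤ ENNReal.ofReal (2 * M) * ρ := by
    intro C M hC
    refine le_of_forall_ofReal_sub_pow_mul_le (√(Real.exp M * B) * C) (Module.finrank ℝ V)
      fun L hL hLr => ?_
    have h := h1 C M L
    rw [Measure.addHaar_closedBall _ _ (sub_nonneg.2 hLr), Measure.addHaar_closedBall _ _ hL.le,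
      mul_right_comm, mul_right_comm _ (lam _)] at h
    exact (ENNReal.mul_le_mul_iff_left (Metric.measure_ball_pos lam _ one_pos).ne'
      measure_ball_lt_top.ne).1 h
  have h3 : ∀ C : ℝ, 0 ≤ C → ν (Metric.closedBall 0 C) * J ≤ ρ := by
    intro C hC
    refine le_of_forall_ofReal_sub_pow_mul_le (4 * Real.log B) 1 fun L _ _ => ?_
    have h := h2 C (L / 2) hC
    rw [show 2 * (L / 2 - 2 * Real.log B) = L - 4 * Real.log B by ring,
      show 2 * (L / 2) = L by ring, mul_left_comm] at h
    simpa using h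
  have h4 : Filter.Tendsto (fun k : ℕ => ν (Metric.closedBall 0 (k : ℝ)) * J) Filter.atTop
      (nhds (1 * J)) := by
    refine ENNReal.Tendsto.mul_const ?_ (Or.inl one_ne_zero)
    have := tendsto_measure_iUnion_atTop (μ := ν)
      (s := fun k : ℕ => Metric.closedBall (0 : V) (k : ℝ))
      (fun i j hij => Metric.closedBall_subset_closedBall (by exact_mod_cast hij))
    rwa [Metric.iUnion_closedBall_nat, measure_univ] at this
  rw [one_mul] at h4
  exact le_of_tendsto' h4 fun k => h3 k (Nat.cast_nonneg k)

end Average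

/-- Among the multiples of a positive statistic `X`, the one with mean `1` has the smallest loss;
here quantified for a finite measure that is nearly a probability measure with `∫ X = m`. -/
lemma lintegral_steinLoss_le {Ω : Type*} [MeasurableSpace Ω] {μ : Measure Ω} [IsFiniteMeasure μ]
    {X : Ω → ℝ} (hX : Measurable X) (hpos : ∀ᵐ ω ∂μ, 0 < X ω) (hfin : Integrable X μ)
    (hμ : 0 < μ.real Set.univ) (hint : 0 < ∫ ω, X ω ∂μ) {m : ℝ} (hm : 0 < m) (d : ℝ) :
    ∫⁻ ω, ENNReal.ofReal (steinLoss (m⁻¹ * X ω) 1) ∂μ ≤ ∫⁻ ω, steinLossE (d * X ω) 1 ∂μ +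
      ENNReal.ofReal (m⁻¹ * ∫ ω, X ω ∂μ - μ.real Set.univ + μ.real Set.univ *
        Real.log (μ.real Set.univ * m / ∫ ω, X ω ∂μ)) := by
  set g := μ.real Set.univ with hg
  set a := ∫ ω, X ω ∂μ with ha
  by_cases htop : ∫⁻ ω, steinLossE (d * X ω) 1 ∂μ = ∞
  · rw [htop, top_add]; exact le_top
  -- A nonpositive multiplier costs infinity on a set of positive mass.
  have hd : 0 < d := by
    by_contra hd
    refine htop ?_
    have h1 : ∀ᵐ ω ∂μ, steinLossE (d * X ω) 1 = ∞ := by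
      filter_upwards [hpos] with ω hω
      rw [steinLossE, if_neg]
      exact not_lt.2 (mul_nonpos_of_nonpos_of_nonneg (not_lt.1 hd) hω.le)
    rw [lintegral_congr_ae h1, lintegral_const]
    refine ENNReal.top_mul fun h => ?_
    rw [hg, Measure.real, h] at hμ
    simp at hμ
  have e1 : ∀ᵐ ω ∂μ, steinLossE (d * X ω) 1 = ENNReal.ofReal (steinLoss (d * X ω) 1) := by
    filter_upwards [hpos] with ω hω
    rw [steinLossE, if_pos (mul_pos hd hω)]
  rw [lintegral_congr_ae e1] at htop ⊢
  have n1 : 0 ≤ᵐ[μ] fun ω => steinLoss (d * X ω) 1 := by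
    filter_upwards [hpos] with ω hω using steinLoss_nonneg (mul_pos hd hω) one_pos
  have n2 : 0 ≤ᵐ[μ] fun ω => steinLoss (m⁻¹ * X ω) 1 := by
    filter_upwards [hpos] with ω hω
    exact steinLoss_nonneg (mul_pos (inv_pos.2 hm) hω) one_pos
  have hi : Integrable (fun ω => steinLoss (d * X ω) 1) μ :=
    integrable_of_lintegral_ofReal_ne_top
      (CanonicalCoords.measurable_steinLoss (by fun_prop) 1).aestronglyMeasurable n1 htop
  have e2 : (fun ω => steinLoss (d * X ω) 1 + ((m⁻¹ - d) * X ω + Real.log (m * d)))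
      =ᵐ[μ] fun ω => steinLoss (m⁻¹ * X ω) 1 := by
    filter_upwards [hpos] with ω hω
    have h1 := steinLoss_sub (mul_pos (inv_pos.2 hm) hω) (mul_pos hd hω) one_pos
    have h2 : m⁻¹ * X ω / (d * X ω) = (m * d)⁻¹ := by field_simp
    rw [h2, Real.log_inv, inv_one, mul_one] at h1
    linear_combination -h1
  have hi1 : Integrable (fun ω => (m⁻¹ - d) * X ω) μ := hfin.const_mul _
  have hi2 : Integrable (fun ω => (m⁻¹ - d) * X ω + Real.log (m * d)) μ :=
    hi1.add (integrable_const _)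
  have hi3 := (hi.add hi2).congr e2
  have hval : ∫ ω, steinLoss (m⁻¹ * X ω) 1 ∂μ = ∫ ω, steinLoss (d * X ω) 1 ∂μ +
      ((m⁻¹ - d) * a + g * Real.log (m * d)) := by
    rw [← integral_congr_ae e2, integral_add hi hi2, integral_add hi1 (integrable_const _),
      integral_const_mul, integral_const, smul_eq_mul]
  -- `log x ≤ x - 1` at `x = d a / g`, with equality at `d = g/a`, the best multiplier under `μ`.
  have hlog : g * Real.log (m * d) ≤ d * a - g + g * Real.log (g * m / a) := by
    have h1 := Real.log_le_sub_one_of_pos (show 0 < d * a / g by positivity)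
    have h2 : Real.log (m * d) = Real.log (d * a / g) + Real.log (g * m / a) := by
      rw [← Real.log_mul (by positivity) (by positivity)]
      congr 1; field_simp
    have h3 : g * Real.log (d * a / g) ≤ g * (d * a / g - 1) := by gcongr
    have h4 : g * (d * a / g - 1) = d * a - g := by field_simp
    rw [h2]; linarith
  rw [← ofReal_integral_eq_lintegral_ofReal hi3 n2, ← ofReal_integral_eq_lintegral_ofReal hi n1]
  refine le_trans (ENNReal.ofReal_le_ofReal ?_) ENNReal.ofReal_add_le
  rw [hval]; linarith

lemma tendsto_setLIntegral_iUnion {Ω : Type*} [MeasurableSpace Ω] {μ : Measure Ω}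
    {K : ℕ → Set Ω} (hK : Monotone K) (hKm : ∀ k, MeasurableSet (K k))
    (hae : ∀ᵐ ω ∂μ, ω ∈ ⋃ k, K k) (h : Ω → ℝ≥0∞) :
    Filter.Tendsto (fun k => ∫⁻ ω in K k, h ω ∂μ) Filter.atTop (nhds (∫⁻ ω, h ω ∂μ)) := by
  have h1 := tendsto_measure_iUnion_atTop (μ := μ.withDensity h) hK
  have h2 : μ.withDensity h (⋃ k, K k) = ∫⁻ ω, h ω ∂μ := by
    rw [withDensity_apply _ (MeasurableSet.iUnion hKm), Measure.restrict_eq_self_of_ae_mem hae]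
  rw [h2] at h1
  refine h1.congr fun k => ?_
  exact withDensity_apply _ (hKm k)

/-- As the sets `K k` exhaust the space, the truncated mass tends to 1 and the truncated mean to
`m`, so the error in `lintegral_steinLoss_le` tends to 0. The limit is taken in `[0, ∞]` and need
not be finite. -/
lemma le_of_forall_truncation {Ω : Type*} [MeasurableSpace Ω] {μ : Measure Ω}
    [IsProbabilityMeasure μ] {X : Ω → ℝ} (hX : Measurable X) (hpos : ∀ᵐ ω ∂μ, 0 < X ω) {m : ℝ}
    (hm : 0 < m) (hmean : ∫⁻ ω, ENNReal.ofReal (X ω) ∂μ = ENNReal.ofReal m)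
    {K : ℕ → Set Ω} (hK : Monotone K) (hKm : ∀ k, MeasurableSet (K k))
    (hae : ∀ᵐ ω ∂μ, ω ∈ ⋃ k, K k) {ρ : ℝ≥0∞}
    (hρ : ∀ k, ∀ J : ℝ≥0∞, (∀ d : ℝ, J ≤ ∫⁻ ω in K k, steinLossE (d * X ω) 1 ∂μ) → J ≤ ρ) :
    ∫⁻ ω, ENNReal.ofReal (steinLoss (m⁻¹ * X ω) 1) ∂μ ≤ ρ := by
  have n0 : 0 ≤ᵐ[μ] X := hpos.mono fun ω h => h.le
  have hXi : Integrable X μ := integrable_of_lintegral_ofReal_ne_top hX.aestronglyMeasurable n0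
    (by rw [hmean]; exact ENNReal.ofReal_ne_top)
  set g : ℕ → ℝ := fun k => (μ.restrict (K k)).real Set.univ with hg
  set a : ℕ → ℝ := fun k => ∫ ω in K k, X ω ∂μ with ha
  have hglim : Filter.Tendsto g Filter.atTop (nhds 1) := by
    have h1 := tendsto_setLIntegral_iUnion hK hKm hae (fun _ => 1)
    rw [lintegral_one, measure_univ] at h1
    have h2 := (ENNReal.tendsto_toReal ENNReal.one_ne_top).comp h1
    refine h2.congr fun k => ?_
    simp only [Function.comp_apply, lintegral_one]
    rfl
  have halim : Filter.Tendsto a Filter.atTop (nhds m) := by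
    have h1 := tendsto_setLIntegral_iUnion hK hKm hae (fun ω => ENNReal.ofReal (X ω))
    rw [hmean] at h1
    have h2 := (ENNReal.tendsto_toReal ENNReal.ofReal_ne_top).comp h1
    rw [ENNReal.toReal_ofReal hm.le] at h2
    refine h2.congr fun k => ?_
    simp only [Function.comp_apply]
    exact (integral_eq_lintegral_of_nonneg_ae (ae_restrict_of_ae n0)
      hX.aestronglyMeasurable).symm
  have herr : Filter.Tendsto (fun k => m⁻¹ * a k - g k + g k * Real.log (g k * m / a k))
      Filter.atTop (nhds 0) := by
    have h1 : Filter.Tendsto (fun k => Real.log (g k * m / a k)) Filter.atTop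
        (nhds (Real.log (1 * m / m))) :=
      ((hglim.mul tendsto_const_nhds).div halim hm.ne').log (by simp [hm.ne'])
    have h2 := ((halim.const_mul m⁻¹).sub hglim).add (hglim.mul h1)
    simpa [hm.ne'] using h2
  have hlim := tendsto_setLIntegral_iUnion hK hKm hae
    (fun ω => ENNReal.ofReal (steinLoss (m⁻¹ * X ω) 1))
  have hrhs : Filter.Tendsto (fun k => ρ + ENNReal.ofReal
      (m⁻¹ * a k - g k + g k * Real.log (g k * m / a k))) Filter.atTop (nhds (ρ + 0)) := by
    refine tendsto_const_nhds.add ?_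
    rw [← ENNReal.ofReal_zero]
    exact ENNReal.tendsto_ofReal herr
  rw [add_zero] at hrhs
  refine le_of_tendsto_of_tendsto hlim hrhs ?_
  filter_upwards [hglim.eventually (lt_mem_nhds one_pos), halim.eventually (lt_mem_nhds hm)]
    with k hgk hak
  rw [← tsub_le_iff_right]
  refine hρ k _ fun d => ?_
  rw [tsub_le_iff_right]
  exact lintegral_steinLoss_le hX (ae_restrict_of_ae hpos) hXi.integrableOn hgk hak hm d

namespace CanonicalCoords

variable {n p : ℕ} {X : Matrix (Fin n) (Fin p) ℝ}

/-- The risk of the unbiased estimator, which does not depend on the parameter. -/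
lemma risk_deltaU (c : CanonicalCoords X) (hn : p + 1 < n) {G : Measure ℝ} (hG : IsMixingLaw G)
    (α : ℝ) (β : Fin p → ℝ) {s : ℝ} (hs : 0 < s) :
    risk X G (deltaU X) α β s =
      ∫⁻ q, ENNReal.ofReal (steinLoss (((n - p - 1 : ℕ) : ℝ)⁻¹ * (q.1 * ‖q.2‖ ^ 2)) 1)
        ∂(G.prod (gauss (EuclideanSpace ℝ (Fin (n - p - 1))))) := by
  have hprob := hG.prob
  have hU := c.measurable_deltaU hn
  have hpos := (c.ae_samplingLaw_residual_pos hn G α β s).mono fun y => c.deltaU_pos hn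
  have hL : Measurable fun q : ℝ × EuclideanSpace ℝ (Fin (n - p - 1)) =>
      ENNReal.ofReal (steinLoss (((n - p - 1 : ℕ) : ℝ)⁻¹ * (q.1 * ‖q.2‖ ^ 2)) 1) :=
    (measurable_steinLoss (by fun_prop) 1).ennreal_ofReal
  have e1 : ∀ᵐ ω ∂(latentLaw p (n - p - 1) G),
      ENNReal.ofReal (steinLoss (deltaU X (c.observe α β s ω)) s) =
      ENNReal.ofReal (steinLoss (((n - p - 1 : ℕ) : ℝ)⁻¹ * (ω.1 * ‖ω.2.2.2‖ ^ 2)) 1) := by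
    filter_upwards [ae_latentLaw_fst_pos hG] with ω hω
    rw [steinLoss, steinLoss, c.deltaU_observe_div hn α β hs hω, div_one]
  rw [risk_eq_of_ae_pos hpos, c.samplingLaw_eq hn hG α β hs,
    lintegral_map (measurable_steinLoss hU s).ennreal_ofReal (by fun_prop),
    lintegral_congr_ae e1, lintegral_latentLaw _ (by
      exact hL.comp (f := fun ω : ℝ × ℝ × EuclideanSpace ℝ (Fin p) ×
        EuclideanSpace ℝ (Fin (n - p - 1)) => (ω.1, ω.2.2.2)) (by fun_prop)),
    lintegral_prod _ hL.aemeasurable]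
  simp

/-- The left side is the constant risk of `deltaU`. The parameters act through the centre `(√n α, A
β)` and the log scale `log s`, so `le_of_risk_le` applies with `v` and `‖η‖²` truncated to compact
intervals, and `le_of_forall_truncation` removes the truncation. -/
lemma risk_deltaU_le_supRisk (c : CanonicalCoords X) (hn : p + 1 < n) {G : Measure ℝ}
    (hG : IsMixingLaw G) {δ : (Fin n → ℝ) → ℝ} (hδ : Measurable δ) :
    ∫⁻ q, ENNReal.ofReal (steinLoss (((n - p - 1 : ℕ) : ℝ)⁻¹ * (q.1 * ‖q.2‖ ^ 2)) 1)
        ∂(G.prod (gauss (EuclideanSpace ℝ (Fin (n - p - 1))))) ≤ supRisk X G δ := by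
  have hprob := hG.prob
  have : NeZero (n - p - 1) := ⟨by omega⟩
  have hes := c.e.symm.measurable
  have hn0 : (0 : ℝ) < n := by exact_mod_cast (by omega : 0 < n)
  have hm : (0 : ℝ) < ((n - p - 1 : ℕ) : ℝ) := by
    exact_mod_cast Nat.pos_of_ne_zero (NeZero.ne _)
  set F := EuclideanSpace ℝ (Fin (n - p - 1))
  set D : (ℝ × EuclideanSpace ℝ (Fin p)) × F → ℝ :=
    fun q => δ (c.e.symm (q.1.1, q.1.2, q.2)) with hD
  have hDm : Measurable D := by fun_prop
  have hrisk : ∀ (μ : ℝ × EuclideanSpace ℝ (Fin p)) (u : ℝ), ∫⁻ v, ∫⁻ ζ, ∫⁻ η : F,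
      steinLossE (D (μ + √(Real.exp u * v) • ζ, √(Real.exp u * v) • η)) (Real.exp u)
        ∂(gauss F) ∂((gauss ℝ).prod (gauss (EuclideanSpace ℝ (Fin p)))) ∂G ≤ supRisk X G δ := by
    intro μ u
    -- The parameter whose centre in canonical coordinates is `μ`.
    have hle : risk X G δ (μ.1 / √n) (c.A.symm μ.2) (Real.exp u) ≤ supRisk X G δ :=
      le_iSup_of_le (μ.1 / √n) (le_iSup_of_le (c.A.symm μ.2) (le_iSup_of_le (Real.exp u)
        (le_iSup_of_le (Real.exp_pos u) le_rfl)))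
    refine le_trans (le_of_eq ?_) hle
    rw [risk, c.samplingLaw_eq hn hG _ _ (Real.exp_pos u), lintegral_map (by fun_prop)
      (by fun_prop), lintegral_latentLaw _ (by fun_prop)]
    refine lintegral_congr fun v => ?_
    have hm1 : Measurable fun ζ : ℝ × EuclideanSpace ℝ (Fin p) => ∫⁻ η : F,
        steinLossE (D (μ + √(Real.exp u * v) • ζ, √(Real.exp u * v) • η)) (Real.exp u)
          ∂(gauss F) := Measurable.lintegral_prod_right'
      (f := fun q : (ℝ × EuclideanSpace ℝ (Fin p)) × F =>
        steinLossE (D (μ + √(Real.exp u * v) • q.1, √(Real.exp u * v) • q.2)) (Real.exp u))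
        (by fun_prop)
    rw [lintegral_prod _ hm1.aemeasurable]
    have hsq : √(n : ℝ) ≠ 0 := (Real.sqrt_pos.2 hn0).ne'
    simp only [hD, observe, LinearEquiv.apply_symm_apply, mul_div_cancel₀ _ hsq, Prod.fst_add,
      Prod.snd_add, Prod.smul_fst, Prod.smul_snd, smul_eq_mul]
    rfl
  set I : ℕ → Set ℝ := fun k => Set.Icc ((k : ℝ) + 1)⁻¹ ((k : ℝ) + 1) with hI
  have hIm : Monotone I := by
    intro i j hij
    have : (i : ℝ) ≤ j := by exact_mod_cast hij
    refine Set.Icc_subset_Icc ?_ (by linarith)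
    gcongr
  have hIu : ∀ x : ℝ, 0 < x → ∃ k, x ∈ I k := by
    intro x hx
    obtain ⟨k, hk⟩ := exists_nat_ge (max x x⁻¹)
    refine ⟨k, inv_le_of_inv_le₀ hx ?_, ?_⟩
    · have := le_max_right x x⁻¹; linarith
    · have := le_max_left x x⁻¹; linarith
  have hposv : ∀ᵐ q ∂(G.prod (gauss F)), 0 < q.1 := Measure.quasiMeasurePreserving_fst.ae hG.pos
  have hposη : ∀ᵐ q ∂(G.prod (gauss F)), 0 < ‖q.2‖ ^ 2 := by
    have h : ∀ᵐ q ∂(G.prod (gauss F)), q.2 ≠ 0 :=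
      Measure.quasiMeasurePreserving_snd.ae gauss_ae_ne_zero
    filter_upwards [h] with q hq
    have := norm_pos_iff.2 hq
    positivity
  have hKm : ∀ k, MeasurableSet {q : ℝ × F | q.1 ∈ I k ∧ ‖q.2‖ ^ 2 ∈ I k} := by
    intro k
    have h1 : Measurable fun q : ℝ × F => ‖q.2‖ ^ 2 := by fun_prop
    exact (measurable_fst measurableSet_Icc).inter (h1 measurableSet_Icc)
  refine le_of_forall_truncation (K := fun k => {q : ℝ × F | q.1 ∈ I k ∧ ‖q.2‖ ^ 2 ∈ I k})
    (X := fun q : ℝ × F => q.1 * ‖q.2‖ ^ 2) (by fun_prop) ?_ hm ?_ ?_ hKm ?_ ?_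
  · filter_upwards [hposv, hposη] with q h1 h2 using mul_pos h1 h2
  · have e1 : ∀ᵐ q ∂(G.prod (gauss F)), ENNReal.ofReal (q.1 * ‖q.2‖ ^ 2)
        = ENNReal.ofReal q.1 * ENNReal.ofReal (‖q.2‖ ^ 2) := by
      filter_upwards [hposv] with q h1 using ENNReal.ofReal_mul h1.le
    rw [lintegral_congr_ae e1, lintegral_prod_mul (f := ENNReal.ofReal)
      (g := fun η : F => ENNReal.ofReal (‖η‖ ^ 2)) (by fun_prop) (by fun_prop), hG.mean_one, one_mul,
      lintegral_gauss_norm_sq_self, finrank_euclideanSpace, Fintype.card_fin,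
      ENNReal.ofReal_natCast]
  · exact fun i j hij q hq => ⟨hIm hij hq.1, hIm hij hq.2⟩
  · filter_upwards [hposv, hposη] with q h1 h2
    obtain ⟨i, hi⟩ := hIu _ h1
    obtain ⟨j, hj⟩ := hIu _ h2
    exact Set.mem_iUnion.2 ⟨max i j, hIm (le_max_left i j) hi, hIm (le_max_right i j) hj⟩
  · intro k J hJ
    have hχm : Measurable (Set.indicator (I k) (1 : ℝ → ℝ≥0∞)) :=
      measurable_one.indicator measurableSet_Icc
    refine le_of_risk_le (lam := (volume : Measure ℝ).prod (volume : Measure (EuclideanSpace ℝ (Fin p))))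
      hχm
      (B := (k : ℝ) + 1) (by linarith [Nat.cast_nonneg (α := ℝ) k])
      (fun x hx => by
        have h : x ∈ I k := Set.mem_of_indicator_ne_zero hx
        exact h)
      (fun x => Set.indicator_le_self' (by simp) x) (fun d => (hJ d).trans (le_of_eq ?_)) hDm hrisk
    rw [← lintegral_indicator (hKm k), lintegral_prod _ (Measurable.indicator (by fun_prop)
      (hKm k)).aemeasurable]
    refine lintegral_congr fun v => ?_
    rw [← lintegral_const_mul _ (by fun_prop)]
    refine lintegral_congr fun η => ?_
    by_cases h1 : v ∈ I k <;> by_cases h2 : ‖η‖ ^ 2 ∈ I k <;> simp [Set.indicator, h1, h2]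

/-- The constant risk of `deltaU` bounds the risk of `deltaH` from above and every maximal risk from
below. -/
lemma isMinimax_deltaH (c : CanonicalCoords X) (hp : 3 ≤ p) (hn : p + 1 < n) {G : Measure ℝ}
    (hG : IsMixingLaw G) : IsMinimax X G (deltaH X) := by
  refine ⟨c.measurable_deltaH hn, fun δ hδ => ?_⟩
  refine iSup_le fun α => iSup_le fun β => iSup_le fun s => iSup_le fun hs => ?_
  refine (c.riskLE_deltaH hp hn hG α β s hs).trans ?_
  rw [c.risk_deltaU hn hG α β hs]
  exact c.risk_deltaU_le_supRisk hn hG hδ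

end CanonicalCoords

end VarianceEstimation

end

theorem theorem4 (n p : ℕ) (hp : 3 ≤ p) (hn : p + 1 < n)
    (X : Matrix (Fin n) (Fin p) ℝ)
    (hXcentred : ∀ j, ∑ i, X i j = 0)
    (hXindep : LinearIndependent ℝ X.col)
    (G : Measure ℝ) (hG : VarianceEstimation.IsMixingLaw G) :
    VarianceEstimation.IsGeneralizedBayes X G (VarianceEstimation.harmonicPrior X)
      (VarianceEstimation.deltaH X) ∧
    VarianceEstimation.IsMinimax X G (VarianceEstimation.deltaH X) ∧
    VarianceEstimation.RiskLE X G (VarianceEstimation.deltaH X) (VarianceEstimation.deltaU X) ∧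
    VarianceEstimation.DominatesByDifference X G
      (VarianceEstimation.deltaH X) (VarianceEstimation.deltaU X) ∧
    (Integrable Real.log G →
      VarianceEstimation.Dominates X G
        (VarianceEstimation.deltaH X) (VarianceEstimation.deltaU X)) := by
  obtain ⟨c⟩ := VarianceEstimation.nonempty_canonicalCoords hn X hXcentred hXindep
  exact ⟨VarianceEstimation.isGeneralizedBayes_deltaH c hp hn hG,
    c.isMinimax_deltaH hp hn hG,
    c.riskLE_deltaH hp hn hG, c.dominatesByDifference_deltaH hp hn hG,
    fun hlog => c.dominates_deltaH hp hn hG hlog⟩
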